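/- Let $R=(R_t)_{t\ge 0}$ be a random process with continuous paths in $\mathbb{R}_+=[0,\infty)$ and let $(\mathbb{P}_x)_{x\ge 0}$ be probability measures such that, under $\mathbb{P}_x$, $R$ is a Bessel process of dimension $-1$ started at $x$ and absorbed at $0$; that is, $R_0=x$ a.s. and $R$ is a Markov process whose transition kernel at time $t>0$ started at $y$ has density $$p_t(y,z)=\frac{z}{t}\Big(\frac{y}{z}\Big)^{3/2} I_{3/2}\Big(\frac{yz}{t}\Big)\exp\Big(-\frac{y^2+z^2}{2t}\Big),\qquad I_{3/2}(w)=\sqrt{\tfrac{2}{\pi w}}\Big(\cosh w-\frac{\sinh w}{w}\Big),$$ on $(0,\infty)$ (with $p_t(0,z)=0$), the remaining mass being an atom at $0$. For $\varepsilon\ge 0$ set $T_\varepsilon=\inf\{t\ge 0:R_t=\varepsilon\}$. For $x>0$ and $t>0$ let $r_t(x,0)=\frac{x^3}{\sqrt{2\pi t^5}}\,e^{-x^2/(2t)}$, and for $x>\varepsilon>0$ and $t>0$ let $$r_t(x,\varepsilon)=\Big(\frac{1}{2\varepsilon^3}\,\mathrm{erfc}(\theta)\,e^{\theta^2}-\frac{1}{\varepsilon^2\sqrt{2\pi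 t}}+\frac{x}{\varepsilon\sqrt{2\pi t^3}}\Big)(x-\varepsilon)\,e^{-(x-\varepsilon)^2/(2t)},\qquad \theta=\frac{\sqrt t}{\varepsilon\sqrt 2}+\frac{x-\varepsilon}{\sqrt{2t}},$$ where $\mathrm{erfc}(u)=\frac{2}{\sqrt\pi}\int_u^\infty e^{-v^2}\,dv$. Then, for all $x>\varepsilon\ge 0$ and $t>0$, one can define a probability measure $\Pi^{(x,\varepsilon)}_t(d\mathrm{w})$ on $C([0,t],\mathbb{R}_+)$ (with the topology of uniform convergence and its Borel $\sigma$-field) in such a way that the following holds. For all $x>\varepsilon\ge 0$, one has $T_\varepsilon<\infty$ $\mathbb{P}_x$-a.s., the function $t\mapsto r_t(x,\varepsilon)$ is a density of the law of $T_\varepsilon$ under $\mathbb{P}_x$, and: (i) The collection $(\Pi^{(x,\varepsilon)}_t)_{t>0}$ is a regular version of the conditional distributions of $(R_s)_{0\le s\le T_\varepsilon}$ knowing $T_\varepsilon=t$ under $\mathbb{P}_x$. (ii) For every $0\le s<t$, the distribution of $(\mathrm{w}(u))_{0\le u\le s}$ under $\Pi^{(x,\varepsilon)}_t(d\mathrm{w})$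 is absolutely continuous with respect to the distribution of $(R_u)_{0\le u\le s}$ under $\mathbb{P}_x$, with Radon–Nikodym density $$(\mathrm{w}(u))_{0\le u\le s}\mapsto \mathbf{1}_{\{\mathrm{w}(u)>\varepsilon\ \forall u\in[0,s]\}}\;\frac{r_{t-s}(\mathrm{w}(s),\varepsilon)}{r_t(x,\varepsilon)}.$$ Furthermore, for every $x>0$ and $t>0$, $\Pi^{(x+\varepsilon,\varepsilon)}_t$ converges weakly to $\Pi^{(x,0)}_t$ as $\varepsilon\to 0$, $\varepsilon>0$. -/

import Mathlib

open MeasureTheory ProbabilityTheory Filter Topology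
open scoped NNReal ENNReal

noncomputable section

namespace BesselBridge

/-- Spaces of continuous functions (with the compact-open topology, i.e. the topology of uniform
convergence on compact sets) carry their Borel σ-algebra. -/
instance pathMeasurableSpace {X Y : Type*} [TopologicalSpace X] [TopologicalSpace Y] :
    MeasurableSpace C(X, Y) := borel _

instance pathBorelSpace {X Y : Type*} [TopologicalSpace X] [TopologicalSpace Y] :
    BorelSpace C(X, Y) := ⟨rfl⟩

/-- Lebesgue measure on `[0, ∞)`. -/
def lebNN : Measure ℝ≥0 := ((volume : Measure ℝ).restrict (Set.Ici 0)).map Real.toNNReal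

/-! ### The Bessel process of dimension `-1` -/

/-- The modified Bessel function `I_{3/2}` on `(0, ∞)`, in closed form. -/
def besselI (w : ℝ) : ℝ :=
  √(2 / (Real.pi * w)) * (Real.cosh w - Real.sinh w / w)

/-- Transition density `p_t(y, z)` on `(0, ∞)` of the Bessel process of dimension `-1`
(index `ν = -3/2`), absorbed at `0`:
`p_t(y, z) = (z / t) (y / z)^{|ν|} I_{|ν|}(y z / t) exp (-(y² + z²) / (2 t))`.
It vanishes when `y = 0`. -/
def transitionDensity (t y z : ℝ) : ℝ :=
  z / t * (y / z) ^ (3 / 2 : ℝ) * besselI (y * z / t) * Real.exp (-(y ^ 2 + z ^ 2) / (2 * t))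

/-- The density as a function with values in `[0, ∞]`. -/
def transitionDensityNN (t y z : ℝ≥0) : ℝ≥0∞ := ENNReal.ofReal (transitionDensity t y z)

theorem measurable_transitionDensityNN (t : ℝ≥0) :
    Measurable (Function.uncurry (transitionDensityNN t)) := by
  unfold Function.uncurry transitionDensityNN transitionDensity besselI
  simp only [Real.cosh_eq, Real.sinh_eq]
  fun_prop

instance sFinite_lebNN : SFinite lebNN := by
  unfold lebNN
  infer_instance

/-- Transition kernel at time `t > 0` of the Bessel process of dimension `-1` absorbed at `0`:
started at `y`, it has density `p_t(y, ·)` on `(0, ∞)`, and the remaining mass is the probability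
of having been absorbed at `0` by time `t` (this mass is `1` when `y = 0`). -/
def transitionKernel (t : ℝ≥0) : Kernel ℝ≥0 ℝ≥0 where
  toFun y := lebNN.withDensity (transitionDensityNN t y) +
    (1 - ∫⁻ z, transitionDensityNN t y z ∂lebNN) • Measure.dirac 0
  measurable' := by
    have h := measurable_transitionDensityNN t
    refine Measure.measurable_of_measurable_coe _ fun s hs => ?_
    have h1 : Measurable fun y => ∫⁻ z, transitionDensityNN t y z ∂lebNN :=
      Measurable.lintegral_prod_right' h
    have h2 : Measurable fun y => ∫⁻ z in s, transitionDensityNN t y z ∂lebNN :=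
      Measurable.lintegral_prod_right' h
    simp only [Measure.add_apply, Measure.smul_apply, withDensity_apply _ hs, smul_eq_mul]
    exact h2.add ((measurable_const.sub h1).mul_const _)

/-- The value at the final time of a path on `[0, s]`. -/
def endpoint {s : ℝ≥0} (w : C(Set.Icc 0 s, ℝ≥0)) : ℝ≥0 := w ⟨s, zero_le, le_rfl⟩

theorem measurable_endpoint {s : ℝ≥0} : Measurable (endpoint (s := s)) :=
  (continuous_eval_const _).measurable

/-- Under `P`, the random continuous path `R` is a Bessel process of dimension `-1` started at `x`:
it starts at `x`, and it is a Markov process with the transition kernels above, i.e. for all `s`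
and all `t > 0`, the conditional law of `R_{s+t}` given `(R_u)_{0 ≤ u ≤ s}` is the transition
kernel at time `t` taken at `R_s`. -/
structure IsBesselNegOne {Ω : Type*} [MeasurableSpace Ω] (R : Ω → C(ℝ≥0, ℝ≥0)) (x : ℝ≥0)
    (P : Measure Ω) : Prop where
  isProbabilityMeasure : IsProbabilityMeasure P
  measurable : Measurable R
  start : ∀ᵐ ω ∂P, R ω 0 = x
  markov : ∀ s t : ℝ≥0, 0 < t →
    HasCondDistrib (fun ω => R ω (s + t)) (fun ω => (R ω).restrict (Set.Icc 0 s))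
      ((transitionKernel t).comap endpoint measurable_endpoint) P

/-! ### First-passage times -/

/-- `T_ε = inf {t ≥ 0 : w(t) = ε}`, with value `∞` if the path never hits `ε`. -/
def passageTime (ε : ℝ≥0) (w : C(ℝ≥0, ℝ≥0)) : ℝ≥0∞ :=
  ⨅ (t : ℝ≥0) (_ : w t = ε), (t : ℝ≥0∞)

/-- The complementary error function. -/
def erfc (x : ℝ) : ℝ := 2 / √Real.pi * ∫ y in Set.Ioi x, Real.exp (-y ^ 2)

/-- The function `r_t(x, ε)`, for `t > 0` and `x > ε ≥ 0`. -/
def passageDensity (t x ε : ℝ) : ℝ :=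
  if ε = 0 then x ^ 3 / √(2 * Real.pi * t ^ 5) * Real.exp (-x ^ 2 / (2 * t))
  else
    (1 / (2 * ε ^ 3) * erfc (√t / (ε * √2) + (x - ε) / √(2 * t))
          * Real.exp ((√t / (ε * √2) + (x - ε) / √(2 * t)) ^ 2)
        - 1 / (ε ^ 2 * √(2 * Real.pi * t)) + x / (ε * √(2 * Real.pi * t ^ 3)))
      * (x - ε) * Real.exp (-(x - ε) ^ 2 / (2 * t))

/-! ### Operations on paths -/

/-- The path `w` stopped at time `τ`. It encodes, together with `τ`, the finite path
`(w(u))_{0 ≤ u ≤ τ}`. -/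
def stopPath (τ : ℝ≥0) (w : C(ℝ≥0, ℝ≥0)) : C(ℝ≥0, ℝ≥0) :=
  ⟨fun u => w (min u τ), by fun_prop⟩

/-- A path on `[0, t]`, continued after time `t` by its final value. -/
def extendPath {t : ℝ≥0} (w : C(Set.Icc 0 t, ℝ≥0)) : C(ℝ≥0, ℝ≥0) :=
  ⟨fun u => w ⟨min u t, zero_le, min_le_right u t⟩, by fun_prop⟩

/-- Restriction to `[0, s]` of a path on `[0, t]`, for `s ≤ t`. -/
def restrictPath {s t : ℝ≥0} (h : s ≤ t) (w : C(Set.Icc 0 t, ℝ≥0)) : C(Set.Icc 0 s, ℝ≥0) :=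
  ⟨fun u => w ⟨u, zero_le, u.2.2.trans h⟩, by fun_prop⟩

/-- The probability measures `(B t)_{t > 0}` form a regular version of the conditional
distributions of `(R_u)_{0 ≤ u ≤ T_ε}` knowing `T_ε = t` under `P`. -/
def IsRegularPassageBridge {Ω : Type*} [MeasurableSpace Ω] (R : Ω → C(ℝ≥0, ℝ≥0))
    (P : Measure Ω) (ε : ℝ≥0) (B : (t : ℝ≥0) → ProbabilityMeasure C(Set.Icc 0 t, ℝ≥0)) : Prop :=
  ∃ κ : Kernel ℝ≥0 C(ℝ≥0, ℝ≥0), IsMarkovKernel κ ∧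
    (∀ t : ℝ≥0, 0 < t → κ t = (B t : Measure C(Set.Icc 0 t, ℝ≥0)).map extendPath) ∧
    HasCondDistrib (fun ω => stopPath (passageTime ε (R ω)).toNNReal (R ω))
      (fun ω => (passageTime ε (R ω)).toNNReal) κ P

open Classical in
/-- The function `w ↦ 1_{w(u) > ε for all u ∈ [0, s]} r_{t-s}(w(s), ε) / r_t(x, ε)` on paths on
`[0, s]`. -/
def bridgeDensity (x ε s t : ℝ≥0) (w : C(Set.Icc 0 s, ℝ≥0)) : ℝ≥0∞ :=
  if ∀ u, ε < w u then
    ENNReal.ofReal (passageDensity ((t : ℝ) - s) (endpoint w) ε / passageDensity t x ε)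
  else 0

end BesselBridge

end

noncomputable section

namespace BesselBridge

section

/-! ### Gaussian integrals and Laplace transforms -/

/-! Write φ_q(y) = (1 + yq)e^{-yq}. The Bessel index is half-integral, so every function involved is
elementary. Integrating the transition density in z shows that its missing mass at time t is ∫₀ᵗ
r_s(y,0) ds, and r(y,0) has Laplace transform φ_q(y) at q²/2 (`transitionKernel_mass`,
`laplace_bessel`). For ε > 0 the formula for r_t(a + ε, ε) is the average over an exponential
variable v of a kernel made of Gaussian densities at a and a + εv (`passageDensity_add`).
Positivity, uniform bounds, joint continuity down to ε = 0, and the Laplace transform φ_q(a +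
ε)/φ_q(ε) are all read off that integrand.

To reach 0 the path must cross ε, which suggests E_x[exp(-q²T_ε/2)] φ_q(ε) = φ_q(x). The hypotheses
give only the Markov property at fixed times, so the identity is obtained by optional stopping: the
amount of exponential time spent at 0 has conditional mean given by `zeroTimesMean`, which is
evaluated at discretisations of T_ε from above. Uniqueness of Laplace transforms identifies the law
of T_ε, also conditionally on the past of a time s before T_ε
(`IsBesselNegOne.map_passageTime_sub`).

Conditioning at two different times must give the same law of T_ε. Hence M_s = r_{t-s}(R_s, ε) on {s
< T_ε}, and 0 elsewhere, has the martingale property on [0, t)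
(`IsBesselNegOne.setLIntegral_passageDensityNN`). The densities M_s/M_0 therefore define consistent
probability measures on paths up to s < t. These extend to [0, t] because the paths tend to ε at
time t. Indeed (y - ε)³ r_u(y, ε) ≤ 56√u, so being far above ε shortly before t forces M to be
small, while under the h-transform the probability that M ever falls to c is at most c/M_0
(`IsBesselNegOne.bridgeLaw_far`). With a geometric sequence of times, Borel–Cantelli makes the
frozen paths almost surely Cauchy, and the bridge is the law of their limit
(`IsBesselNegOne.exists_bridge`).

Property (ii) is then the definition of the bridge. For (i), the joint law of T_ε and of the path up
to a fixed s is known on {T_ε > s}. Cutting the path at the grid point just below T_ε gives the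
disintegration cell by cell, and refining the grid gives it for the path stopped at T_ε.

For the weak convergence, Brownian scaling represents the process started at x + ε as cR(·/c²) under
P_x, with c = (x + ε)/x. Fatou's lemma and continuity of r at ε = 0 give the portmanteau inequality
for open sets of paths up to s < t, and the end estimate, uniform for small ε, lets s increase to t
(`tendsto_bridge`). -/

/-- The Gaussian density with variance `t`. -/
def heat (t y : ℝ) : ℝ := Real.exp (-y ^ 2 / (2 * t)) / √(2 * Real.pi * t)

theorem heat_nonneg (t y : ℝ) : 0 ≤ heat t y := by unfold heat; positivity

theorem heat_pos {t : ℝ} (ht : 0 < t) (y : ℝ) : 0 < heat t y := by unfold heat; positivity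

theorem heat_neg (t y : ℝ) : heat t (-y) = heat t y := by simp [heat]

theorem heat_anti {t : ℝ} (ht : 0 < t) {y z : ℝ} (hy : 0 ≤ y) (hyz : y ≤ z) :
    heat t z ≤ heat t y := by
  unfold heat
  gcongr

@[fun_prop]
theorem measurable_heat : Measurable fun p : ℝ × ℝ => heat p.1 p.2 := by
  unfold heat; fun_prop

/-- The distribution function of the standard normal law. -/
def normalCdf (u : ℝ) : ℝ := 1 / 2 + ∫ v in (0 : ℝ)..u, heat 1 v

theorem continuous_heat_one : Continuous (heat 1) := by unfold heat; fun_prop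

theorem hasDerivAt_normalCdf (u : ℝ) : HasDerivAt normalCdf (heat 1 u) u := by
  unfold normalCdf
  exact (intervalIntegral.integral_hasDerivAt_right
    (continuous_heat_one.intervalIntegrable _ _)
    (continuous_heat_one.stronglyMeasurableAtFilter _ _)
    continuous_heat_one.continuousAt).const_add _

theorem continuous_normalCdf : Continuous normalCdf :=
  continuous_iff_continuousAt.2 fun u => (hasDerivAt_normalCdf u).continuousAt

theorem normalCdf_zero : normalCdf 0 = 1 / 2 := by simp [normalCdf]

theorem normalCdf_neg (u : ℝ) : normalCdf (-u) = 1 - normalCdf u := by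
  unfold normalCdf
  have h := intervalIntegral.integral_comp_neg (a := 0) (b := u) (heat 1)
  simp only [heat_neg, neg_zero] at h
  rw [intervalIntegral.integral_symm, ← h]
  ring

theorem tendsto_normalCdf_atTop : Tendsto normalCdf atTop (𝓝 1) := by
  have e : heat 1 = fun v => Real.exp (-(1 / 2) * v ^ 2) * (√(2 * Real.pi))⁻¹ := by
    ext v; unfold heat; rw [div_eq_mul_inv]; congr 2 <;> ring_nf
  have hint : Integrable (heat 1) := by
    rw [e]; exact (integrable_exp_neg_mul_sq (by norm_num)).mul_const _
  have h := (intervalIntegral_tendsto_integral_Ioi 0 hint.integrableOn tendsto_id).const_add (1 / 2)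
  have h2 : ∫ v in Set.Ioi (0 : ℝ), heat 1 v = 1 / 2 := by
    rw [e, integral_mul_const, integral_gaussian_Ioi]
    rw [show Real.pi / (1 / 2) = 2 * Real.pi by ring]
    have : √(2 * Real.pi) ≠ 0 := by positivity
    field_simp
  rw [h2] at h
  norm_num at h
  exact h

theorem tendsto_normalCdf_atBot : Tendsto normalCdf atBot (𝓝 0) := by
  have h := (tendsto_normalCdf_atTop.comp tendsto_neg_atBot_atTop).const_sub 1
  simp only [Function.comp_def, sub_self] at h
  refine h.congr fun u => ?_
  rw [normalCdf_neg]; ring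

/-- The value f(0) plays no role: f is redefined at 0 as its right limit, which makes it continuous
on [0, ∞), and the nonnegativity of the derivative supplies integrability. -/
theorem integral_Ioi_of_hasDerivAt_of_nonneg_of_tendsto {f f' : ℝ → ℝ} {m l : ℝ}
    (hderiv : ∀ x, 0 < x → HasDerivAt f (f' x) x) (hpos : ∀ x, 0 < x → 0 ≤ f' x)
    (h0 : Tendsto f (𝓝[>] 0) (𝓝 m)) (hl : Tendsto f atTop (𝓝 l)) :
    IntegrableOn f' (Set.Ioi 0) ∧ ∫ x in Set.Ioi 0, f' x = l - m := by
  set F := Function.update f 0 m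
  have hF : ∀ x, 0 < x → F =ᶠ[𝓝 x] f := fun x hx => by
    filter_upwards [eventually_gt_nhds hx] with y hy
    simp [F, hy.ne']
  have hc : ContinuousWithinAt F (Set.Ici 0) 0 := by
    rw [← Set.Ioi_insert, continuousWithinAt_insert_self, ContinuousWithinAt]
    simp only [F, Function.update_self]
    refine h0.congr' ?_
    filter_upwards [self_mem_nhdsWithin] with y hy
    simp [(Set.mem_Ioi.1 hy).ne']
  have hd : ∀ x ∈ Set.Ioi (0 : ℝ), HasDerivAt F (f' x) x := fun x hx =>
    (hderiv x hx).congr_of_eventuallyEq (hF x hx)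
  have hl' : Tendsto F atTop (𝓝 l) := by
    refine hl.congr' ?_
    filter_upwards [eventually_gt_atTop 0] with y hy
    simp [F, hy.ne']
  refine ⟨integrableOn_Ioi_deriv_of_nonneg hc hd hpos hl', ?_⟩
  rw [integral_Ioi_of_hasDerivAt_of_nonneg hc hd hpos hl']
  simp [F]

/-- The heat kernel damped exponentially at rate `q² / 2`. -/
def dampedHeat (q t y : ℝ) : ℝ := Real.exp (-q ^ 2 * t / 2) * heat t y

/-- Completing the square: (qt - y)²/(2t) = y²/(2t) + q²t/2 - qy. -/
theorem heat_one_div_sqrt {q t y : ℝ} (ht : 0 < t) :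
    heat 1 ((q * t - y) / √t) = Real.exp (q * y) * √t * dampedHeat q t y := by
  have h1 : 0 < √t := Real.sqrt_pos.2 ht
  unfold dampedHeat heat
  rw [mul_one, mul_one, Real.sqrt_mul (by positivity) t, div_pow, Real.sq_sqrt ht.le]
  rw [show -((q * t - y) ^ 2 / t) / 2 = q * y + (-q ^ 2 * t / 2 + -y ^ 2 / (2 * t)) by
    field_simp; ring, Real.exp_add, Real.exp_add]
  field_simp

theorem hasDerivAt_drift {q t y : ℝ} (ht : 0 < t) :
    HasDerivAt (fun t => (q * t - y) / √t) (q / (2 * √t) + y / (2 * t * √t)) t := by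
  have h1 : 0 < √t := Real.sqrt_pos.2 ht
  have h2 : √t ^ 2 = t := Real.sq_sqrt ht.le
  have h := (((hasDerivAt_id t).const_mul q).sub_const y).div (Real.hasDerivAt_sqrt ht.ne') h1.ne'
  refine h.congr_deriv ?_
  simp only [id]
  field_simp
  rw [h2]
  ring

/-- The prefactor cancels the e^{qy} of `heat_one_div_sqrt`. Applied to q and -q, this gives two
primitives from whose combinations the Laplace transforms below are computed. -/
theorem hasDerivAt_exp_mul_normalCdf {q t y : ℝ} (ht : 0 < t) :
    HasDerivAt (fun t => Real.exp (-(y * q)) * normalCdf ((q * t - y) / √t))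
      (dampedHeat q t y * (q / 2 + y / (2 * t))) t := by
  have h1 : 0 < √t := Real.sqrt_pos.2 ht
  have h2 : √t ^ 2 = t := Real.sq_sqrt ht.le
  have h := ((hasDerivAt_normalCdf _).comp t (hasDerivAt_drift (q := q) (y := y) ht)).const_mul
    (Real.exp (-(y * q)))
  refine h.congr_deriv ?_
  rw [heat_one_div_sqrt ht, Real.exp_neg, mul_comm q y]
  have : Real.exp (y * q) ≠ 0 := (Real.exp_pos _).ne'
  field_simp

theorem hasDerivAt_dampedHeat {q t y : ℝ} (ht : 0 < t) :
    HasDerivAt (fun t => dampedHeat q t y)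
      (dampedHeat q t y * (-q ^ 2 / 2 - 1 / (2 * t) + y ^ 2 / (2 * t ^ 2))) t := by
  have h1 : 0 < √t := Real.sqrt_pos.2 ht
  have h2 : √t ^ 2 = t := Real.sq_sqrt ht.le
  have h3 : 0 < √(2 * Real.pi) := by positivity
  have e : (fun t => dampedHeat q t y) = fun t =>
      Real.exp (-q ^ 2 * t / 2) * (Real.exp (-y ^ 2 / 2 * t⁻¹) / (√(2 * Real.pi) * √t)) := by
    ext t
    rw [dampedHeat, heat, Real.sqrt_mul (by positivity)]
    congr 3; field_simp
  rw [e]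
  have ha : HasDerivAt (fun t => -q ^ 2 * t / 2) (-q ^ 2 / 2) t := by
    simpa using ((hasDerivAt_id t).const_mul (-q ^ 2)).div_const 2
  have hb : HasDerivAt (fun t => -y ^ 2 / 2 * t⁻¹) (-y ^ 2 / 2 * (-(t ^ 2)⁻¹)) t :=
    (hasDerivAt_inv ht.ne').const_mul _
  have h := ha.exp.mul (hb.exp.div ((Real.hasDerivAt_sqrt ht.ne').const_mul (√(2 * Real.pi)))
    (by positivity))
  refine h.congr_deriv ?_
  simp only [Pi.div_apply, dampedHeat, heat, Real.sqrt_mul (show (0:ℝ) ≤ 2 * Real.pi by positivity) t]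
  rw [show -y ^ 2 / 2 * t⁻¹ = -y ^ 2 / (2 * t) by field_simp]
  field_simp
  rw [h2]
  ring

theorem dampedHeat_neg (q t y : ℝ) : dampedHeat (-q) t y = dampedHeat q t y := by
  simp [dampedHeat]

theorem dampedHeat_nonneg (q t y : ℝ) : 0 ≤ dampedHeat q t y := by
  unfold dampedHeat heat; positivity

theorem dampedHeat_le_heat {q t y : ℝ} (ht : 0 ≤ t) : dampedHeat q t y ≤ heat t y := by
  unfold dampedHeat
  refine mul_le_of_le_one_left (heat_nonneg _ _) (Real.exp_le_one_iff.2 ?_)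
  nlinarith [sq_nonneg q, mul_nonneg (sq_nonneg q) ht]

theorem tendsto_dampedHeat_zero (q : ℝ) {y : ℝ} (hy : 0 < y) :
    Tendsto (fun t => dampedHeat q t y) (𝓝[>] 0) (𝓝 0) := by
  have h : Tendsto (fun t : ℝ => 2 / (y ^ 2 * √(2 * Real.pi)) * √t) (𝓝[>] 0) (𝓝 0) := by
    have : Tendsto (fun t : ℝ => 2 / (y ^ 2 * √(2 * Real.pi)) * √t) (𝓝 0)
        (𝓝 (2 / (y ^ 2 * √(2 * Real.pi)) * √0)) := by
      apply Continuous.tendsto; fun_prop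
    simpa using this.mono_left nhdsWithin_le_nhds
  refine squeeze_zero' (Eventually.of_forall fun t => dampedHeat_nonneg _ _ _) ?_ h
  filter_upwards [self_mem_nhdsWithin] with t ht
  have ht : 0 < t := ht
  refine (dampedHeat_le_heat ht.le).trans ?_
  unfold heat
  rw [Real.sqrt_mul (by positivity)]
  have h1 : 0 < √t := Real.sqrt_pos.2 ht
  have h2 : √t ^ 2 = t := Real.sq_sqrt ht.le
  have h3 : Real.exp (-y ^ 2 / (2 * t)) ≤ 2 * t / y ^ 2 := by
    rw [show -y ^ 2 / (2 * t) = -(y ^ 2 / (2 * t)) by ring, Real.exp_neg,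
      inv_le_comm₀ (Real.exp_pos _) (by positivity)]
    refine le_trans (le_of_eq ?_) ((lt_add_one (y ^ 2 / (2 * t))).le.trans (Real.add_one_le_exp _))
    field_simp
  calc _ ≤ 2 * t / y ^ 2 / (√(2 * Real.pi) * √t) := by gcongr
    _ = _ := by
      rw [← h2]; simp only [Real.sqrt_sq h1.le]; field_simp

theorem tendsto_dampedHeat_atTop (q y : ℝ) :
    Tendsto (fun t => dampedHeat q t y) atTop (𝓝 0) := by
  have h : Tendsto (fun t : ℝ => (√(2 * Real.pi * t))⁻¹) atTop (𝓝 0) :=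
    tendsto_inv_atTop_zero.comp (Real.tendsto_sqrt_atTop.comp
      (tendsto_id.const_mul_atTop (by positivity)))
  refine squeeze_zero' (Eventually.of_forall fun t => dampedHeat_nonneg _ _ _) ?_ h
  filter_upwards [eventually_gt_atTop 0] with t ht
  refine (dampedHeat_le_heat ht.le).trans ?_
  unfold heat
  rw [div_eq_mul_inv]
  refine mul_le_of_le_one_left (by positivity) (Real.exp_le_one_iff.2 ?_)
  rw [neg_div, neg_nonpos]; positivity

theorem tendsto_drift_zero (q : ℝ) {y : ℝ} (hy : 0 < y) :
    Tendsto (fun t => (q * t - y) / √t) (𝓝[>] 0) atBot := by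
  have h1 : Tendsto (fun t : ℝ => √t) (𝓝[>] 0) (𝓝[>] 0) := by
    refine tendsto_nhdsWithin_iff.2 ⟨?_, ?_⟩
    · have : Tendsto (fun t : ℝ => √t) (𝓝 0) (𝓝 (√0)) := Real.continuous_sqrt.tendsto 0
      simpa using this.mono_left nhdsWithin_le_nhds
    · filter_upwards [self_mem_nhdsWithin] with t ht using Real.sqrt_pos.2 ht
  have h2 : Tendsto (fun t : ℝ => q * t - y) (𝓝[>] 0) (𝓝 (-y)) := by
    have : Tendsto (fun t : ℝ => q * t - y) (𝓝 0) (𝓝 (q * 0 - y)) := by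
      apply Continuous.tendsto; fun_prop
    simpa using this.mono_left nhdsWithin_le_nhds
  simp_rw [div_eq_mul_inv]
  exact h2.neg_mul_atTop (by linarith) (tendsto_inv_nhdsGT_zero.comp h1)

theorem tendsto_drift_atTop {q : ℝ} (hq : 0 < q) (y : ℝ) :
    Tendsto (fun t => (q * t - y) / √t) atTop atTop := by
  have h1 : Tendsto (fun t : ℝ => q * √t + -(|y|)) atTop atTop :=
    tendsto_atTop_add_const_right _ _ (Real.tendsto_sqrt_atTop.const_mul_atTop hq)
  refine tendsto_atTop_mono' _ ?_ h1
  filter_upwards [eventually_ge_atTop 1] with t ht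
  have h0 : 0 < t := by linarith
  have h3 : 1 ≤ √t := Real.one_le_sqrt.2 ht
  have h2 : √t ^ 2 = t := Real.sq_sqrt h0.le
  rw [le_div_iff₀ (by linarith)]
  nlinarith [le_abs_self y, abs_nonneg y, mul_le_mul_of_nonneg_left h3 (abs_nonneg y)]

/-- An antiderivative of `t ↦ exp (-q² t / 2) (q / 2 + y / (2 t)) g_t(y)`. -/
def driftCdf (q t y : ℝ) : ℝ := Real.exp (-(y * q)) * normalCdf ((q * t - y) / √t)

theorem tendsto_driftCdf_zero (q : ℝ) {y : ℝ} (hy : 0 < y) :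
    Tendsto (fun t => driftCdf q t y) (𝓝[>] 0) (𝓝 0) := by
  simpa [driftCdf] using
    (tendsto_normalCdf_atBot.comp (tendsto_drift_zero q hy)).const_mul (Real.exp (-(y * q)))

theorem tendsto_driftCdf_atTop {q : ℝ} (hq : 0 < q) (y : ℝ) :
    Tendsto (fun t => driftCdf q t y) atTop (𝓝 (Real.exp (-(y * q)))) := by
  simpa [driftCdf] using
    (tendsto_normalCdf_atTop.comp (tendsto_drift_atTop hq y)).const_mul (Real.exp (-(y * q)))

theorem tendsto_driftCdf_neg_atTop {q : ℝ} (hq : 0 < q) (y : ℝ) :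
    Tendsto (fun t => driftCdf (-q) t y) atTop (𝓝 0) := by
  have h := tendsto_normalCdf_atBot.comp
    (tendsto_neg_atTop_atBot.comp (tendsto_drift_atTop hq (-y)))
  have h' := h.const_mul (Real.exp (-(y * -q)))
  rw [mul_zero] at h'
  refine h'.congr fun t => ?_
  simp only [Function.comp_apply, driftCdf]
  congr 2
  ring

theorem tendsto_driftCdf_zero_atTop (y : ℝ) :
    Tendsto (fun t => driftCdf 0 t y) atTop (𝓝 (1 / 2)) := by
  have h : Tendsto (fun t : ℝ => (0 * t - y) / √t) atTop (𝓝 0) := by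
    simpa [div_eq_mul_inv] using
      (tendsto_inv_atTop_zero.comp Real.tendsto_sqrt_atTop).const_mul (-y)
  have h' := (continuous_normalCdf.tendsto 0).comp h
  rw [normalCdf_zero] at h'
  refine h'.congr fun t => ?_
  simp [driftCdf]

/-- Laplace transform of the law of the first hitting time of `0` by a Brownian motion. -/
theorem laplace_levy {q y : ℝ} (hq : 0 ≤ q) (hy : 0 < y) :
    IntegrableOn (fun t => dampedHeat q t y * (y / t)) (Set.Ioi 0) ∧
      ∫ t in Set.Ioi 0, dampedHeat q t y * (y / t) = Real.exp (-(y * q)) := by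
  rw [show Real.exp (-(y * q)) = Real.exp (-(y * q)) - 0 by ring]
  -- In the sum over ±q the terms ±q/2 cancel and y/t remains.
  refine integral_Ioi_of_hasDerivAt_of_nonneg_of_tendsto
    (f := fun t => driftCdf q t y + driftCdf (-q) t y) ?_ ?_ ?_ ?_
  · intro t ht
    refine ((hasDerivAt_exp_mul_normalCdf (q := q) ht).add
      (hasDerivAt_exp_mul_normalCdf (q := -q) ht)).congr_deriv ?_
    rw [dampedHeat_neg]; field_simp; ring
  · intro t ht
    have := dampedHeat_nonneg q t y
    positivity
  · simpa using (tendsto_driftCdf_zero q hy).add (tendsto_driftCdf_zero (-q) hy)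
  -- For q = 0 there is no drift: both terms tend to 1/2, instead of one to e^{-yq} and the other to
  -- 0.
  · rcases hq.eq_or_lt with rfl | hq
    · have h := (tendsto_driftCdf_zero_atTop y).add (tendsto_driftCdf_zero_atTop y)
      simp only [neg_zero, mul_zero, Real.exp_zero]
      norm_num at h ⊢
      exact h
    · simpa using (tendsto_driftCdf_atTop hq y).add (tendsto_driftCdf_neg_atTop hq y)

/-- The primitive vanishing at `0` of `t ↦ exp (-q² t / 2) r_t(y, 0)`. -/
def besselCdf (q t y : ℝ) : ℝ :=
  2 * y * dampedHeat q t y + ((1 + y * q) * driftCdf q t y + (1 - y * q) * driftCdf (-q) t y)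

/-- With the weights 1 ± yq the drift terms contribute yq² + y/t, which cancels everything in the
derivative of the heat term except y³/t². -/
theorem hasDerivAt_besselCdf {q t y : ℝ} (ht : 0 < t) :
    HasDerivAt (fun t => besselCdf q t y) (dampedHeat q t y * (y ^ 3 / t ^ 2)) t := by
  refine (((hasDerivAt_dampedHeat (q := q) (y := y) ht).const_mul (2 * y)).add
    (((hasDerivAt_exp_mul_normalCdf (q := q) ht).const_mul (1 + y * q)).add
      ((hasDerivAt_exp_mul_normalCdf (q := -q) ht).const_mul (1 - y * q)))).congr_deriv ?_
  rw [dampedHeat_neg]; field_simp; ring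

theorem tendsto_besselCdf_zero (q : ℝ) {y : ℝ} (hy : 0 < y) :
    Tendsto (fun t => besselCdf q t y) (𝓝[>] 0) (𝓝 0) := by
  simpa [besselCdf] using ((tendsto_dampedHeat_zero q hy).const_mul (2 * y)).add
    (((tendsto_driftCdf_zero q hy).const_mul (1 + y * q)).add
      ((tendsto_driftCdf_zero (-q) hy).const_mul (1 - y * q)))

theorem laplace_bessel {q y : ℝ} (hq : 0 ≤ q) (hy : 0 < y) :
    IntegrableOn (fun t => dampedHeat q t y * (y ^ 3 / t ^ 2)) (Set.Ioi 0) ∧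
      ∫ t in Set.Ioi 0, dampedHeat q t y * (y ^ 3 / t ^ 2) =
        (1 + y * q) * Real.exp (-(y * q)) := by
  rw [← sub_zero ((1 + y * q) * Real.exp (-(y * q)))]
  refine integral_Ioi_of_hasDerivAt_of_nonneg_of_tendsto (fun t ht => hasDerivAt_besselCdf ht)
    ?_ (tendsto_besselCdf_zero q hy) ?_
  · intro t ht
    have := dampedHeat_nonneg q t y
    positivity
  · have h0 := (tendsto_dampedHeat_atTop q y).const_mul (2 * y)
    rw [mul_zero] at h0
    rcases hq.eq_or_lt with rfl | hq
    · have h := h0.add (((tendsto_driftCdf_zero_atTop y).const_mul (1 + y * 0)).add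
        ((tendsto_driftCdf_zero_atTop y).const_mul (1 - y * 0)))
      unfold besselCdf
      norm_num at h ⊢
      exact h
    · simpa [besselCdf] using h0.add (((tendsto_driftCdf_atTop hq y).const_mul (1 + y * q)).add
        ((tendsto_driftCdf_neg_atTop hq y).const_mul (1 - y * q)))

/-- Evaluation of the q = 0 primitive, where the two drift terms coincide. This distribution
function of the absorption time is to be matched with the mass missing from the transition density.
-/
theorem integral_bessel {t y : ℝ} (ht : 0 < t) (hy : 0 < y) :
    ∫ s in (0 : ℝ)..t, heat s y * (y ^ 3 / s ^ 2) =
      2 * y * heat t y + 2 * normalCdf (-y / √t) := by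
  have e : ∀ s, dampedHeat 0 s y = heat s y := fun s => by simp [dampedHeat]
  have hi := (laplace_bessel le_rfl hy).1
  simp only [e] at hi
  have h := intervalIntegral.integral_eq_sub_of_hasDerivAt_of_tendsto ht
    (f := fun t => besselCdf 0 t y) (f' := fun s => heat s y * (y ^ 3 / s ^ 2))
    (fa := 0) (fb := besselCdf 0 t y)
    (fun s hs => by
      have h := hasDerivAt_besselCdf (q := 0) (y := y) hs.1
      rwa [e] at h)
    ((intervalIntegrable_iff_integrableOn_Ioc_of_le ht.le).2
      (hi.mono_set Set.Ioc_subset_Ioi_self)) (tendsto_besselCdf_zero 0 hy)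
    ((hasDerivAt_besselCdf ht).continuousAt.tendsto.mono_left nhdsWithin_le_nhds)
  rw [h]
  simp [besselCdf, driftCdf, e]
  ring

end

section

/-! ### The first-passage density -/

/-- With u = z²/2, these are uⁿ/n! ≤ e^u for n = 1, 2, 3. -/
theorem pow_mul_exp_neg_sq_le {z : ℝ} :
    z ^ 2 * Real.exp (-z ^ 2 / 2) ≤ 2 ∧ z ^ 4 * Real.exp (-z ^ 2 / 2) ≤ 8 ∧
      z ^ 6 * Real.exp (-z ^ 2 / 2) ≤ 48 := by
  have hu : 0 ≤ z ^ 2 / 2 := by positivity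
  have e : Real.exp (-z ^ 2 / 2) = (Real.exp (z ^ 2 / 2))⁻¹ := by
    rw [← Real.exp_neg]; congr 1; ring
  have h1 := Real.pow_div_factorial_le_exp (z ^ 2 / 2) hu 1
  have h2 := Real.pow_div_factorial_le_exp (z ^ 2 / 2) hu 2
  have h3 := Real.pow_div_factorial_le_exp (z ^ 2 / 2) hu 3
  norm_num [Nat.factorial] at h1 h2 h3
  rw [e]
  refine ⟨?_, ?_, ?_⟩ <;> rw [← div_eq_mul_inv, div_le_iff₀ (Real.exp_pos _)] <;> nlinarith

theorem heat_scale {t : ℝ} (ht : 0 < t) (y : ℝ) :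
    heat t y = Real.exp (-(y / √t) ^ 2 / 2) / (√(2 * Real.pi) * √t) := by
  rw [heat, Real.sqrt_mul (by positivity), div_pow, Real.sq_sqrt ht.le]
  congr 2; field_simp

theorem one_le_sqrt_two_pi : 1 ≤ √(2 * Real.pi) := by
  rw [Real.one_le_sqrt]; nlinarith [Real.pi_gt_three]

theorem pow_mul_heat_le {t y : ℝ} (ht : 0 < t) (hy : 0 ≤ y) :
    y * heat t y ≤ 2 ∧ y ^ 3 * heat t y ≤ 5 * t ∧ y ^ 4 * heat t y ≤ 8 * (t * √t) ∧
      y ^ 6 * heat t y ≤ 48 * (t ^ 2 * √t) := by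
  have h1 : 0 < √t := Real.sqrt_pos.2 ht
  have h2 : √t ^ 2 = t := Real.sq_sqrt ht.le
  obtain ⟨z, rfl⟩ : ∃ z, y = z * √t := ⟨y / √t, by field_simp⟩
  have hz : 0 ≤ z := by
    by_contra hz; push Not at hz; nlinarith
  obtain ⟨b2, b4, b6⟩ := pow_mul_exp_neg_sq_le (z := z)
  have hE : Real.exp (-z ^ 2 / 2) ≤ 1 := Real.exp_le_one_iff.2 (by nlinarith [sq_nonneg z])
  have e : heat t (z * √t) = Real.exp (-z ^ 2 / 2) / √(2 * Real.pi) / √t := by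
    rw [heat_scale ht, mul_div_assoc, div_self h1.ne', mul_one, div_div]
  have hE' : 0 < Real.exp (-z ^ 2 / 2) := Real.exp_pos _
  set E := Real.exp (-z ^ 2 / 2)
  have hd : E / √(2 * Real.pi) ≤ E := div_le_self hE'.le one_le_sqrt_two_pi
  -- Odd powers are interpolated: 2z ≤ 1 + z² and 2z³ ≤ z² + z⁴.
  have b1 : z * E ≤ 2 := by nlinarith [mul_nonneg (sq_nonneg (z - 1)) hE'.le]
  have b3 : z ^ 3 * E ≤ 5 := by nlinarith [mul_nonneg (sq_nonneg (z ^ 2 - z)) hE'.le]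
  have key : ∀ n C, z ^ n * E ≤ C → z ^ n * (E / √(2 * Real.pi)) ≤ C := fun n C h =>
    (mul_le_mul_of_nonneg_left hd (pow_nonneg hz n)).trans h
  rw [e]
  set D := E / √(2 * Real.pi)
  refine ⟨?_, ?_, ?_, ?_⟩
  · have := key 1 2 (by simpa using b1)
    calc _ = z ^ 1 * D := by field_simp
      _ ≤ _ := this
  · calc _ = z ^ 3 * D * √t ^ 2 := by field_simp
      _ ≤ 5 * √t ^ 2 := by gcongr; exact key 3 5 b3
      _ = _ := by rw [h2]
  · calc _ = z ^ 4 * D * (√t ^ 2 * √t) := by field_simp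
      _ ≤ 8 * (√t ^ 2 * √t) := by gcongr; exact key 4 8 b4
      _ = _ := by rw [h2]
  · calc _ = z ^ 6 * D * ((√t ^ 2) ^ 2 * √t) := by field_simp
      _ ≤ 48 * ((√t ^ 2) ^ 2 * √t) := by gcongr; exact key 6 48 b6
      _ = _ := by rw [h2]

/-- The integrand in the representation of `r_t(a + ε, ε)` as an average over an exponential
variable. -/
def passageKernel (t a ε v : ℝ) : ℝ :=
  a * ((heat t a - heat t (a + ε * v)) / t + (a + ε * v) ^ 2 * heat t (a + ε * v) / t ^ 2)

theorem passageKernel_nonneg {t a ε v : ℝ} (ht : 0 < t) (ha : 0 ≤ a) (hε : 0 ≤ ε) (hv : 0 ≤ v) :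
    0 ≤ passageKernel t a ε v := by
  have h := heat_anti ht ha (le_add_of_nonneg_right (mul_nonneg hε hv))
  have h2 := heat_nonneg t (a + ε * v)
  have h3 : 0 ≤ (heat t a - heat t (a + ε * v)) / t := div_nonneg (by linarith) ht.le
  unfold passageKernel
  positivity

theorem passageKernel_pos {t a ε v : ℝ} (ht : 0 < t) (ha : 0 < a) (hε : 0 ≤ ε) (hv : 0 ≤ v) :
    0 < passageKernel t a ε v := by
  have h := heat_anti ht ha.le (le_add_of_nonneg_right (mul_nonneg hε hv))
  have h2 := heat_pos ht (a + ε * v)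
  have h3 : 0 ≤ (heat t a - heat t (a + ε * v)) / t := div_nonneg (by linarith) ht.le
  have h4 := mul_nonneg hε hv
  unfold passageKernel
  positivity

/-- The factor a is absorbed by a ≤ a + εv, and 7 = 2 + 5 adds two constants of `pow_mul_heat_le`.
Uniformity in a, ε and v is what allows dominated convergence down to ε = 0. -/
theorem passageKernel_le {t a ε v : ℝ} (ht : 0 < t) (ha : 0 ≤ a) (hε : 0 ≤ ε) (hv : 0 ≤ v) :
    passageKernel t a ε v ≤ 7 / t := by
  have hy : a ≤ a + ε * v := le_add_of_nonneg_right (mul_nonneg hε hv)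
  unfold passageKernel
  set y := a + ε * v
  have h0 := heat_nonneg t y
  have h1 := (pow_mul_heat_le ht ha).1
  have h2 := (pow_mul_heat_le ht (ha.trans hy)).2.1
  have h3 : a * y ^ 2 * heat t y ≤ y ^ 3 * heat t y := by
    have : a * (y ^ 2 * heat t y) ≤ y * (y ^ 2 * heat t y) := by gcongr
    nlinarith
  calc _ ≤ a * (heat t a / t + y ^ 2 * heat t y / t ^ 2) := by gcongr; linarith
    _ = (a * heat t a) / t + (a * y ^ 2 * heat t y) / t ^ 2 := by ring
    _ ≤ 2 / t + (5 * t) / t ^ 2 :=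
      add_le_add (div_le_div_of_nonneg_right h1 ht.le)
        (div_le_div_of_nonneg_right (h3.trans h2) (by positivity))
    _ = 7 / t := by field_simp; norm_num

/-- Again a ≤ a + εv, with 56 = 8 + 48. The factor √t, vanishing as t → 0, is what forces the
bridges towards ε at their end. -/
theorem cube_mul_passageKernel_le {t a ε v : ℝ} (ht : 0 < t) (ha : 0 ≤ a) (hε : 0 ≤ ε)
    (hv : 0 ≤ v) : a ^ 3 * passageKernel t a ε v ≤ 56 * √t := by
  have hy : a ≤ a + ε * v := le_add_of_nonneg_right (mul_nonneg hε hv)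
  unfold passageKernel
  set y := a + ε * v
  have h0 := heat_nonneg t y
  have h1 := (pow_mul_heat_le ht ha).2.2.1
  have h2 := (pow_mul_heat_le ht (ha.trans hy)).2.2.2
  have h3 : a ^ 4 * (y ^ 2 * heat t y) ≤ y ^ 6 * heat t y := by
    have : a ^ 4 * (y ^ 2 * heat t y) ≤ y ^ 4 * (y ^ 2 * heat t y) := by gcongr
    linarith [show y ^ 4 * (y ^ 2 * heat t y) = y ^ 6 * heat t y by ring]
  calc _ ≤ a ^ 3 * (a * (heat t a / t + y ^ 2 * heat t y / t ^ 2)) := by gcongr; linarith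
    _ = (a ^ 4 * heat t a) / t + (a ^ 4 * (y ^ 2 * heat t y)) / t ^ 2 := by ring
    _ ≤ 8 * (t * √t) / t + 48 * (t ^ 2 * √t) / t ^ 2 :=
      add_le_add (div_le_div_of_nonneg_right h1 ht.le)
        (div_le_div_of_nonneg_right (h3.trans h2) (by positivity))
    _ = 56 * √t := by field_simp; norm_num

theorem integrableOn_exp_neg_mul_of_bound {f : ℝ → ℝ} (hf : Measurable f) {C : ℝ}
    (hC : ∀ v, 0 < v → |f v| ≤ C) :
    IntegrableOn (fun v => Real.exp (-v) * f v) (Set.Ioi 0) := by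
  have h := (integrableOn_exp_neg_Ioi 0).mul_const C
  refine h.mono' (by fun_prop) ?_
  filter_upwards [ae_restrict_mem measurableSet_Ioi] with v hv
  rw [norm_mul, Real.norm_eq_abs, Real.norm_eq_abs, abs_of_pos (Real.exp_pos _)]
  gcongr
  exact hC v hv

@[fun_prop]
theorem measurable_passageKernel :
    Measurable fun p : ℝ × ℝ × ℝ × ℝ => passageKernel p.1 p.2.1 p.2.2.1 p.2.2.2 := by
  unfold passageKernel heat; fun_prop

theorem integrableOn_passageKernel {t a ε : ℝ} (ht : 0 < t) (ha : 0 ≤ a) (hε : 0 ≤ ε) :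
    IntegrableOn (fun v => Real.exp (-v) * passageKernel t a ε v) (Set.Ioi 0) := by
  refine integrableOn_exp_neg_mul_of_bound (C := 7 / t) (by unfold passageKernel heat; fun_prop)
    fun v hv => ?_
  rw [abs_of_nonneg (passageKernel_nonneg ht ha hε hv.le)]
  exact passageKernel_le ht ha hε hv.le

/-- Substitute y = θ + bv with b = ε/√(2t) in the integral defining `erfc`. Since 2θbv = v + aεv/t,
the three exponents add up to -v - (a + εv)²/(2t). -/
theorem erfc_mul_exp {t a ε : ℝ} (ht : 0 < t) (hε : 0 < ε) :
    erfc (√t / (ε * √2) + a / √(2 * t)) * Real.exp ((√t / (ε * √2) + a / √(2 * t)) ^ 2) *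
      Real.exp (-a ^ 2 / (2 * t)) =
        2 * ε * ∫ v in Set.Ioi 0, Real.exp (-v) * heat t (a + ε * v) := by
  have h1 : 0 < √t := Real.sqrt_pos.2 ht
  have h2 : √t ^ 2 = t := Real.sq_sqrt ht.le
  have h3 : √2 ^ 2 = (2 : ℝ) := Real.sq_sqrt (by norm_num)
  have h4 : 0 < √(2 : ℝ) := by positivity
  have h5 : 0 < √Real.pi := Real.sqrt_pos.2 Real.pi_pos
  set θ := √t / (ε * √2) + a / √(2 * t) with hθ
  set b := ε / √(2 * t) with hb
  have hb0 : 0 < b := by positivity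
  have e1 : ∫ y in Set.Ioi θ, Real.exp (-y ^ 2) =
      b * ∫ v in Set.Ioi 0, Real.exp (-(θ + b * v) ^ 2) := by
    have h := integral_comp_mul_left_Ioi (fun u => Real.exp (-(θ + u) ^ 2)) 0 hb0
    rw [mul_zero] at h
    rw [h, smul_eq_mul, ← mul_assoc, mul_inv_cancel₀ hb0.ne', one_mul]
    have := (measurePreserving_add_left volume θ).setIntegral_preimage_emb
      (measurableEmbedding_addLeft θ) (fun y => Real.exp (-y ^ 2)) (Set.Ioi θ)
    simpa using this.symm
  have e2 : ∀ v, Real.exp (-(θ + b * v) ^ 2) * Real.exp (θ ^ 2) * Real.exp (-a ^ 2 / (2 * t)) =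
      √(2 * Real.pi * t) * (Real.exp (-v) * heat t (a + ε * v)) := fun v => by
    have : √(2 * Real.pi * t) ≠ 0 := by positivity
    rw [heat, ← Real.exp_add, ← Real.exp_add, mul_div_assoc', mul_div_cancel₀ _ this,
      ← Real.exp_add]
    congr 1
    rw [hθ, hb, Real.sqrt_mul (by norm_num)]
    have : √t ^ 3 = t * √t := by rw [pow_succ, h2]
    field_simp
    ring_nf
    simp only [h2, h3]
    ring
  unfold erfc
  rw [e1]
  calc _ = 2 / √Real.pi * b * ∫ v in Set.Ioi 0,
        Real.exp (-(θ + b * v) ^ 2) * Real.exp (θ ^ 2) * Real.exp (-a ^ 2 / (2 * t)) := by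
        rw [integral_mul_const, integral_mul_const]; ring
    _ = 2 / √Real.pi * b * √(2 * Real.pi * t) *
        ∫ v in Set.Ioi 0, Real.exp (-v) * heat t (a + ε * v) := by
        simp_rw [e2]; rw [integral_const_mul]; ring
    _ = _ := by
      congr 1
      rw [hb, Real.sqrt_mul (by norm_num), Real.sqrt_mul (by positivity),
        Real.sqrt_mul (by norm_num)]
      field_simp

theorem hasDerivAt_heat {t : ℝ} (ht : 0 < t) (y : ℝ) :
    HasDerivAt (heat t) (-(y / t) * heat t y) y := by
  have h : HasDerivAt (fun y => -y ^ 2 / (2 * t)) (-(y / t)) y := by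
    refine ((hasDerivAt_pow 2 y).neg.div_const (2 * t)).congr_deriv ?_
    field_simp; norm_num
  refine (h.exp.div_const (√(2 * Real.pi * t))).congr_deriv ?_
  unfold heat; ring

theorem continuous_heat {t : ℝ} (ht : 0 < t) : Continuous (heat t) :=
  continuous_iff_continuousAt.2 fun y => (hasDerivAt_heat ht y).continuousAt

theorem heat_le {t : ℝ} (ht : 0 < t) (y : ℝ) : heat t y ≤ heat t 0 := by
  rcases le_total 0 y with h | h
  · exact heat_anti ht le_rfl h
  · rw [← heat_neg]; exact heat_anti ht le_rfl (by linarith)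

theorem tendsto_exp_neg_mul_of_bound {f : ℝ → ℝ} {C : ℝ} (hC : ∀ v, 0 < v → |f v| ≤ C) :
    Tendsto (fun v => Real.exp (-v) * f v) atTop (𝓝 0) := by
  have h : Tendsto (fun v : ℝ => Real.exp (-v) * C) atTop (𝓝 0) := by
    simpa using (Real.tendsto_exp_neg_atTop_nhds_zero).mul_const C
  refine squeeze_zero_norm' ?_ h
  filter_upwards [eventually_gt_atTop 0] with v hv
  rw [norm_mul, Real.norm_eq_abs, Real.norm_eq_abs, abs_of_pos (Real.exp_pos _)]
  gcongr
  exact hC v hv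

/-- The factor y²/t² - 1/t is the one produced by the second derivative of the heat kernel in space.
Two integrations by parts against e^{-v} move both derivatives, each at the price of 1/ε. -/
theorem integral_exp_mul_heat_snd {t a ε : ℝ} (ht : 0 < t) (ha : 0 ≤ a) (hε : 0 < ε) :
    ∫ v in Set.Ioi 0, Real.exp (-v) *
        (((a + ε * v) ^ 2 / t ^ 2 - 1 / t) * heat t (a + ε * v)) =
      a * heat t a / (ε * t) - heat t a / ε ^ 2 +
        (∫ v in Set.Ioi 0, Real.exp (-v) * heat t (a + ε * v)) / ε ^ 2 := by
  have hm : Measurable (heat t) := (continuous_heat ht).measurable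
  have b0 : ∀ v, 0 < v → |heat t (a + ε * v)| ≤ heat t 0 := fun v _ => by
    rw [abs_of_nonneg (heat_nonneg _ _)]; exact heat_le ht _
  have hy : ∀ v, 0 < v → 0 ≤ a + ε * v := fun v hv => by positivity
  have b1 : ∀ v, 0 < v → |(a + ε * v) * heat t (a + ε * v)| ≤ 2 := fun v hv => by
    rw [abs_of_nonneg (mul_nonneg (hy v hv) (heat_nonneg _ _))]
    exact (pow_mul_heat_le ht (hy v hv)).1
  have b2 : ∀ v, 0 < v → |((a + ε * v) ^ 2 / t ^ 2 - 1 / t) * heat t (a + ε * v)| ≤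
      (2 + 5 * t) / t ^ 2 + heat t 0 / t := fun v hv => by
    have h := pow_mul_heat_le ht (hy v hv)
    have h0 := heat_nonneg t (a + ε * v)
    have h2 : (a + ε * v) ^ 2 * heat t (a + ε * v) ≤ 2 + 5 * t := by
      nlinarith [mul_nonneg (mul_nonneg (hy v hv) (sq_nonneg (a + ε * v - 1))) h0]
    rw [sub_mul]
    refine (abs_sub _ _).trans ?_
    rw [abs_of_nonneg (by positivity), abs_of_nonneg (by positivity)]
    refine add_le_add ?_ ?_
    · rw [div_mul_eq_mul_div]; gcongr
    · rw [div_mul_eq_mul_div, one_mul]; gcongr; exact heat_le ht _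
  have i0 := integrableOn_exp_neg_mul_of_bound (by fun_prop) b0
  have i2 := integrableOn_exp_neg_mul_of_bound (by fun_prop) b2
  have hd : ∀ v ∈ Set.Ici (0 : ℝ), HasDerivAt
      (fun v => Real.exp (-v) * (-((a + ε * v) * heat t (a + ε * v)) / (ε * t) +
        heat t (a + ε * v) / ε ^ 2))
      (Real.exp (-v) * (((a + ε * v) ^ 2 / t ^ 2 - 1 / t) * heat t (a + ε * v)) -
        Real.exp (-v) * heat t (a + ε * v) / ε ^ 2) v := fun v _ => by
    have hl : HasDerivAt (fun v => a + ε * v) ε v := by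
      simpa using ((hasDerivAt_id v).const_mul ε).const_add a
    have hg := (hasDerivAt_heat ht (a + ε * v)).comp v hl
    have he : HasDerivAt (fun v : ℝ => Real.exp (-v)) (-Real.exp (-v)) v := by
      simpa using (hasDerivAt_neg v).exp
    refine (he.mul (((hl.mul hg).neg.div_const (ε * t)).add (hg.div_const (ε ^ 2)))).congr_deriv ?_
    simp only [Function.comp_apply, Pi.add_apply, Pi.neg_apply, Pi.mul_apply, Function.comp_def]
    field_simp
    ring
  have hl : Tendsto (fun v => Real.exp (-v) * (-((a + ε * v) * heat t (a + ε * v)) / (ε * t) +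
        heat t (a + ε * v) / ε ^ 2)) atTop (𝓝 0) := by
    have h := ((tendsto_exp_neg_mul_of_bound b1).neg.div_const (ε * t)).add
      ((tendsto_exp_neg_mul_of_bound b0).div_const (ε ^ 2))
    norm_num at h
    refine h.congr fun v => ?_
    ring
  have h := integral_Ioi_of_hasDerivAt_of_tendsto' hd (i2.sub (i0.div_const _)) hl
  rw [integral_sub i2 (i0.div_const _), integral_div] at h
  rw [sub_eq_iff_eq_add] at h
  rw [h]
  simp only [neg_zero, Real.exp_zero, mul_zero, add_zero]
  ring

/-- The `erfc` term is an exponential average of heat kernels (`erfc_mul_exp`), and its coefficient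
together with the negative powers of ε is what two integrations by parts produce. The right-hand
side is regular at ε = 0, so it treats both cases of the definition at once and yields all the
properties of r used later. -/
theorem passageDensity_add {t a ε : ℝ} (ht : 0 < t) (ha : 0 ≤ a) (hε : 0 ≤ ε) :
    passageDensity t (a + ε) ε = ∫ v in Set.Ioi 0, Real.exp (-v) * passageKernel t a ε v := by
  have h1 : 0 < √t := Real.sqrt_pos.2 ht
  have hp : 0 < √(2 * Real.pi) := by positivity
  rcases hε.eq_or_lt with rfl | hε
  · simp only [passageKernel, zero_mul, add_zero, sub_self, zero_div, zero_add, passageDensity,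
      if_true]
    rw [integral_mul_const, integral_exp_neg_Ioi_zero, one_mul, heat,
      show 2 * Real.pi * t ^ 5 = 2 * Real.pi * t * (t ^ 2) ^ 2 by ring,
      Real.sqrt_mul (by positivity), Real.sqrt_sq (by positivity)]
    field_simp
  · have hm : Measurable (heat t) := (continuous_heat ht).measurable
    have e : ∀ v, Real.exp (-v) * passageKernel t a ε v = Real.exp (-v) * (a * heat t a / t) +
        a * (Real.exp (-v) * (((a + ε * v) ^ 2 / t ^ 2 - 1 / t) * heat t (a + ε * v))) :=
      fun v => by unfold passageKernel; field_simp; ring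
    have i1 : IntegrableOn (fun v => Real.exp (-v) * (a * heat t a / t)) (Set.Ioi 0) :=
      (integrableOn_exp_neg_Ioi 0).mul_const _
    have i2 : IntegrableOn (fun v =>
        a * (Real.exp (-v) * (((a + ε * v) ^ 2 / t ^ 2 - 1 / t) * heat t (a + ε * v))))
        (Set.Ioi 0) := by
      have := (integrableOn_passageKernel ht ha hε.le).sub i1
      refine this.congr (ae_of_all _ fun v => ?_)
      simp [e]
    simp_rw [e]
    rw [integral_add i1 i2, integral_mul_const, integral_const_mul, integral_exp_neg_Ioi_zero,
      integral_exp_mul_heat_snd ht ha hε]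
    have hE := erfc_mul_exp (a := a) ht hε
    have hE' : (∫ v in Set.Ioi 0, Real.exp (-v) * heat t (a + ε * v)) =
        erfc (√t / (ε * √2) + a / √(2 * t)) * Real.exp ((√t / (ε * √2) + a / √(2 * t)) ^ 2) *
          Real.exp (-a ^ 2 / (2 * t)) / (2 * ε) := by
      rw [hE, mul_div_cancel_left₀ _ (by positivity)]
    rw [hE', passageDensity, if_neg hε.ne', add_sub_cancel_right, heat,
      show 2 * Real.pi * t ^ 3 = 2 * Real.pi * t * t ^ 2 by ring,
      Real.sqrt_mul (by positivity) (t ^ 2), Real.sqrt_sq ht.le]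
    have : 0 < √(2 * Real.pi * t) := by positivity
    field_simp
    ring

theorem passageDensity_pos {t a ε : ℝ} (ht : 0 < t) (ha : 0 < a) (hε : 0 ≤ ε) :
    0 < passageDensity t (a + ε) ε := by
  rw [passageDensity_add ht ha.le hε, setIntegral_pos_iff_support_of_nonneg_ae]
  · refine lt_of_lt_of_le ?_ (measure_mono (s := Set.Ioi (0 : ℝ)) fun v hv => ?_)
    · simp
    · exact ⟨(mul_pos (Real.exp_pos _) (passageKernel_pos ht ha hε (Set.mem_Ioi.1 hv).le)).ne', hv⟩
  · filter_upwards [ae_restrict_mem measurableSet_Ioi] with v hv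
    exact mul_nonneg (Real.exp_pos _).le (passageKernel_nonneg ht ha.le hε (Set.mem_Ioi.1 hv).le)
  · exact integrableOn_passageKernel ht ha.le hε

theorem passageDensity_le {t a ε : ℝ} (ht : 0 < t) (ha : 0 ≤ a) (hε : 0 ≤ ε) :
    passageDensity t (a + ε) ε ≤ 7 / t := by
  rw [passageDensity_add ht ha hε]
  calc _ ≤ ∫ v in Set.Ioi (0 : ℝ), Real.exp (-v) * (7 / t) := by
        refine setIntegral_mono_on (integrableOn_passageKernel ht ha hε)
          ((integrableOn_exp_neg_Ioi 0).mul_const _) measurableSet_Ioi fun v hv => ?_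
        have := passageKernel_le ht ha hε (Set.mem_Ioi.1 hv).le
        gcongr
    _ = 7 / t := by rw [integral_mul_const, integral_exp_neg_Ioi_zero, one_mul]

theorem cube_mul_passageDensity_le {t a ε : ℝ} (ht : 0 < t) (ha : 0 ≤ a) (hε : 0 ≤ ε) :
    a ^ 3 * passageDensity t (a + ε) ε ≤ 56 * √t := by
  rw [passageDensity_add ht ha hε, ← integral_const_mul]
  calc _ ≤ ∫ v in Set.Ioi (0 : ℝ), Real.exp (-v) * (56 * √t) := by
        refine setIntegral_mono_on ((integrableOn_passageKernel ht ha hε).const_mul _)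
          ((integrableOn_exp_neg_Ioi 0).mul_const _) measurableSet_Ioi fun v hv => ?_
        have := cube_mul_passageKernel_le ht ha hε (Set.mem_Ioi.1 hv).le
        calc _ = Real.exp (-v) * (a ^ 3 * passageKernel t a ε v) := by ring
          _ ≤ _ := by gcongr
    _ = 56 * √t := by rw [integral_mul_const, integral_exp_neg_Ioi_zero, one_mul]

/-- Dominated convergence in the exponential average. The level may tend to 0, although the explicit
formula is singular there. -/
theorem tendsto_passageDensity {ι : Type*} {l : Filter ι} [l.IsCountablyGenerated]
    {τ α η : ι → ℝ} {t a ε : ℝ} (ht : 0 < t) (ha : 0 ≤ a) (hε : 0 ≤ ε)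
    (hτ : Tendsto τ l (𝓝 t)) (hα : Tendsto α l (𝓝 a)) (hη : Tendsto η l (𝓝 ε))
    (hα0 : ∀ᶠ i in l, 0 ≤ α i) (hη0 : ∀ᶠ i in l, 0 ≤ η i) :
    Tendsto (fun i => passageDensity (τ i) (α i + η i) (η i)) l
      (𝓝 (passageDensity t (a + ε) ε)) := by
  rw [passageDensity_add ht ha hε]
  have hτ0 : ∀ᶠ i in l, t / 2 < τ i := hτ.eventually_const_lt (by linarith)
  have h : Tendsto (fun i => ∫ v in Set.Ioi 0, Real.exp (-v) * passageKernel (τ i) (α i) (η i) v) l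
      (𝓝 (∫ v in Set.Ioi 0, Real.exp (-v) * passageKernel t a ε v)) := by
    -- The constant 14/t dominates 7/τ as soon as τ > t/2.
    refine tendsto_integral_filter_of_dominated_convergence
      (fun v => Real.exp (-v) * (14 / t)) ?_ ?_ ((integrableOn_exp_neg_Ioi 0).mul_const _) ?_
    · refine Eventually.of_forall fun i => Measurable.aestronglyMeasurable ?_
      unfold passageKernel heat; fun_prop
    · filter_upwards [hτ0, hα0, hη0] with i h1 h2 h3
      have h0 : 0 < τ i := by linarith
      filter_upwards [ae_restrict_mem measurableSet_Ioi] with v hv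
      have hv := (Set.mem_Ioi.1 hv).le
      rw [Real.norm_of_nonneg (mul_nonneg (Real.exp_pos _).le (passageKernel_nonneg h0 h2 h3 hv))]
      gcongr
      refine (passageKernel_le h0 h2 h3 hv).trans ?_
      rw [div_le_div_iff₀ h0 ht]; linarith
    · refine ae_of_all _ fun v => Tendsto.const_mul _ ?_
      have hh : ∀ β : ι → ℝ, ∀ b, Tendsto β l (𝓝 b) →
          Tendsto (fun i => heat (τ i) (β i)) l (𝓝 (heat t b)) := fun β b hβ => by
        unfold heat
        refine Tendsto.div ?_ ?_ (by positivity)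
        · exact (Real.continuous_exp.tendsto _).comp
            (((hβ.pow 2).neg).div (hτ.const_mul 2) (by positivity))
        · exact (Real.continuous_sqrt.tendsto _).comp (hτ.const_mul _)
      have hy := hα.add (hη.mul_const v)
      exact hα.mul ((((hh _ _ hα).sub (hh _ _ hy)).div hτ ht.ne').add
        (((hy.pow 2).mul (hh _ _ hy)).div (hτ.pow 2) (by positivity)))
  refine h.congr' ?_
  filter_upwards [hτ0, hα0, hη0] with i h1 h2 h3
  rw [passageDensity_add (by linarith) h2 h3]

theorem measurable_erfc : Measurable erfc := by
  refine Measurable.const_mul ?_ _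
  have hi : Integrable fun y : ℝ => Real.exp (-y ^ 2) := by
    simpa using integrable_exp_neg_mul_sq one_pos
  refine Antitone.measurable fun a b hab => ?_
  exact setIntegral_mono_set hi.integrableOn (ae_of_all _ fun y => (Real.exp_pos _).le)
    (Set.Ioi_subset_Ioi hab).eventuallyLE

@[fun_prop]
theorem measurable_passageDensity {α : Type*} [MeasurableSpace α] {f g h : α → ℝ}
    (hf : Measurable f) (hg : Measurable g) (hh : Measurable h) :
    Measurable fun p => passageDensity (f p) (g p) (h p) := by
  have := measurable_erfc
  unfold passageDensity
  refine Measurable.ite (hh (measurableSet_singleton 0)) ?_ ?_ <;> fun_prop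

/-- With y = a + εv, the kernel is the Lévy density at a, minus a/y times the Lévy density at y,
plus a/y times the Bessel density at y. The transforms of the last two combine to aq e^{-yq}. -/
theorem laplace_passageKernel {q a ε v : ℝ} (hq : 0 ≤ q) (ha : 0 < a) (hε : 0 ≤ ε) (hv : 0 ≤ v) :
    ∫⁻ t in Set.Ioi 0, ENNReal.ofReal (Real.exp (-q ^ 2 * t / 2) * passageKernel t a ε v) =
      ENNReal.ofReal (Real.exp (-(a * q)) + a * q * Real.exp (-((a + ε * v) * q))) := by
  have hy : 0 < a + ε * v := by positivity
  obtain ⟨i1, e1⟩ := laplace_levy hq ha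
  obtain ⟨i2, e2⟩ := laplace_levy hq hy
  obtain ⟨i3, e3⟩ := laplace_bessel hq hy
  set y := a + ε * v with hyd
  have e : ∀ t, Real.exp (-q ^ 2 * t / 2) * passageKernel t a ε v =
      (dampedHeat q t a * (a / t) - a / y * (dampedHeat q t y * (y / t))) +
        a / y * (dampedHeat q t y * (y ^ 3 / t ^ 2)) := fun t => by
    unfold passageKernel dampedHeat
    rw [← hyd]
    field_simp
  have i5 : IntegrableOn (fun t => dampedHeat q t a * (a / t) -
      a / y * (dampedHeat q t y * (y / t))) (Set.Ioi 0) := i1.sub (i2.const_mul (a / y))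
  have i4 := i5.add (i3.const_mul (a / y))
  rw [← ofReal_integral_eq_lintegral_ofReal]
  · simp_rw [e]
    rw [integral_add i5 (i3.const_mul (a / y)),
      integral_sub i1 (i2.const_mul (a / y)), integral_const_mul, integral_const_mul, e1, e2, e3]
    congr 1
    field_simp
    ring
  · exact i4.congr (ae_of_all _ fun t => (e t).symm)
  · filter_upwards [ae_restrict_mem measurableSet_Ioi] with t ht
    exact mul_nonneg (Real.exp_pos _).le (passageKernel_nonneg ht ha.le hε hv)

/-- Laplace transform of the first-passage density. -/
theorem laplace_passageDensity {q a ε : ℝ} (hq : 0 ≤ q) (ha : 0 < a) (hε : 0 ≤ ε) :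
    ∫⁻ t in Set.Ioi 0, ENNReal.ofReal (Real.exp (-q ^ 2 * t / 2) * passageDensity t (a + ε) ε) =
      ENNReal.ofReal ((1 + (a + ε) * q) * Real.exp (-((a + ε) * q)) /
        ((1 + ε * q) * Real.exp (-(ε * q)))) := by
  have hq' : 0 < 1 + ε * q := by positivity
  calc _ = ∫⁻ t in Set.Ioi 0, ∫⁻ v in Set.Ioi 0,
        ENNReal.ofReal (Real.exp (-q ^ 2 * t / 2) * (Real.exp (-v) * passageKernel t a ε v)) := by
        refine setLIntegral_congr_fun measurableSet_Ioi fun t ht => ?_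
        have ht : 0 < t := ht
        rw [passageDensity_add ht ha.le hε, ← integral_const_mul,
          ofReal_integral_eq_lintegral_ofReal
            ((integrableOn_passageKernel ht ha.le hε).const_mul _)]
        filter_upwards [ae_restrict_mem measurableSet_Ioi] with v hv
        exact mul_nonneg (Real.exp_pos _).le (mul_nonneg (Real.exp_pos _).le
          (passageKernel_nonneg ht ha.le hε (Set.mem_Ioi.1 hv).le))
    _ = ∫⁻ v in Set.Ioi 0, ∫⁻ t in Set.Ioi 0,
        ENNReal.ofReal (Real.exp (-q ^ 2 * t / 2) * (Real.exp (-v) * passageKernel t a ε v)) := by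
        rw [lintegral_lintegral_swap]
        unfold Function.uncurry passageKernel heat
        fun_prop
    _ = ∫⁻ v in Set.Ioi 0, ENNReal.ofReal (Real.exp (-v) *
          (Real.exp (-(a * q)) + a * q * Real.exp (-((a + ε * v) * q)))) := by
        refine setLIntegral_congr_fun measurableSet_Ioi fun v hv => ?_
        simp only [← mul_assoc, mul_comm _ (Real.exp (-v))]
        simp only [mul_assoc]
        simp_rw [ENNReal.ofReal_mul (Real.exp_pos (-v)).le]
        rw [lintegral_const_mul, laplace_passageKernel hq ha hε (Set.mem_Ioi.1 hv).le]
        · simp only [mul_assoc]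
        · unfold passageKernel heat; fun_prop
    -- As e^{-v}e^{-εqv} has integral 1/(1 + εq), the average is e^{-aq}(1 + aq/(1 + εq)), which is
    -- the claimed quotient.
    _ = ENNReal.ofReal (∫ v in Set.Ioi 0, (Real.exp (-(a * q)) * Real.exp (-v) +
          a * q * Real.exp (-(a * q)) * Real.exp (-(1 + ε * q) * v))) := by
        rw [ofReal_integral_eq_lintegral_ofReal]
        · refine lintegral_congr fun v => ?_
          congr 1
          rw [show -((a + ε * v) * q) = -(a * q) + -(ε * v * q) by ring, Real.exp_add,
            show -(1 + ε * q) * v = -v + -(ε * v * q) by ring, Real.exp_add]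
          ring
        · exact ((integrableOn_exp_neg_Ioi 0).const_mul _).add
            ((integrableOn_exp_mul_Ioi (by linarith) 0).const_mul _)
        · exact ae_of_all _ fun v => by positivity
    _ = _ := by
        rw [integral_add ((integrableOn_exp_neg_Ioi 0).const_mul _)
          ((integrableOn_exp_mul_Ioi (by linarith) 0).const_mul _), integral_const_mul,
          integral_const_mul, integral_exp_neg_Ioi_zero, integral_exp_mul_Ioi (by linarith)]
        congr 1
        rw [show -((a + ε) * q) = -(a * q) + -(ε * q) by ring, Real.exp_add]
        have : Real.exp (-(ε * q)) ≠ 0 := (Real.exp_pos _).ne'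
        simp only [mul_zero, Real.exp_zero]
        field_simp
        ring

end

section

/-! ### The transition kernel -/

theorem lintegral_lebNN {f : ℝ≥0 → ℝ≥0∞} (hf : Measurable f) :
    ∫⁻ z, f z ∂lebNN = ∫⁻ z in Set.Ioi (0 : ℝ), f z.toNNReal := by
  unfold lebNN
  rw [lintegral_map hf measurable_real_toNNReal, restrict_Ioi_eq_restrict_Ici]

theorem lebNN_singleton (a : ℝ≥0) : lebNN {a} = 0 := by
  rw [← lintegral_indicator_one (measurableSet_singleton a),
    lintegral_lebNN (measurable_one.indicator (measurableSet_singleton a)),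
    setLIntegral_congr_fun (g := ({(a : ℝ)} : Set ℝ).indicator 1) measurableSet_Ioi]
  · rw [lintegral_indicator_one (measurableSet_singleton _)]
    exact le_antisymm ((Measure.restrict_apply_le _ _).trans (by simp)) zero_le
  · intro z hz
    have hz : 0 < z := hz
    by_cases h : z = a
    · simp [h]
    · have : z.toNNReal ≠ a := fun h' => h (by rw [← h', Real.coe_toNNReal _ hz.le])
      simp [h, this]

instance : NullSingletonClass lebNN := ⟨lebNN_singleton⟩

theorem sinh_le_mul_cosh {w : ℝ} (hw : 0 ≤ w) : Real.sinh w ≤ w * Real.cosh w := by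
  have hd : ∀ x : ℝ, HasDerivAt (fun x => x * Real.cosh x - Real.sinh x) (x * Real.sinh x) x :=
    fun x => by
      refine (((hasDerivAt_id x).mul (Real.hasDerivAt_cosh x)).sub
        (Real.hasDerivAt_sinh x)).congr_deriv ?_
      simp
  have hm : MonotoneOn (fun x => x * Real.cosh x - Real.sinh x) (Set.Ici 0) := by
    refine monotoneOn_of_deriv_nonneg (convex_Ici 0)
      (fun x _ => (hd x).continuousAt.continuousWithinAt)
      (fun x _ => (hd x).differentiableAt.differentiableWithinAt) fun x hx => ?_
    rw [(hd x).deriv]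
    rw [interior_Ici] at hx
    exact mul_nonneg hx.out.le (Real.sinh_nonneg_iff.2 hx.out.le)
  have := hm Set.self_mem_Ici hw hw
  simp at this
  linarith

theorem transitionDensity_nonneg {t y z : ℝ} (ht : 0 < t) (hy : 0 ≤ y) (hz : 0 ≤ z) :
    0 ≤ transitionDensity t y z := by
  have hw : 0 ≤ y * z / t := by positivity
  have h : 0 ≤ besselI (y * z / t) := by
    unfold besselI
    refine mul_nonneg (Real.sqrt_nonneg _) (sub_nonneg.2 ?_)
    rcases hw.eq_or_lt with h0 | h0
    · rw [← h0]; simp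
    · rw [div_le_iff₀ h0, mul_comm (Real.cosh _)]; exact sinh_le_mul_cosh hw
  unfold transitionDensity
  positivity

theorem transitionDensity_zero_left (t z : ℝ) : transitionDensity t 0 z = 0 := by
  simp [transitionDensity]

/-- The half-integral order makes the Bessel function elementary: cosh and sinh times the Gaussian
factor are the sum and the difference of heat kernels at z - y and z + y. -/
theorem transitionDensity_eq {t y z : ℝ} (ht : 0 < t) (hy : 0 < y) (hz : 0 < z) :
    transitionDensity t y z = y / z * (heat t (z - y) + heat t (z + y)) -
      t / z ^ 2 * (heat t (z - y) - heat t (z + y)) := by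
  have hpi := Real.pi_pos
  have e1 : (y / z) ^ (3 / 2 : ℝ) = y / z * (√y / √z) := by
    rw [show (3 / 2 : ℝ) = 1 + 1 / 2 by norm_num, Real.rpow_add (by positivity), Real.rpow_one,
      ← Real.sqrt_eq_rpow, Real.sqrt_div hy.le]
  have e2 : √(2 / (Real.pi * (y * z / t))) = 2 * t / (√(2 * Real.pi * t) * (√y * √z)) := by
    rw [← Real.sqrt_mul hy.le, ← Real.sqrt_mul (by positivity),
      Real.sqrt_eq_iff_mul_self_eq (by positivity) (by positivity), div_mul_div_comm,
      Real.mul_self_sqrt (by positivity)]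
    field_simp
  have e3 : Real.cosh (y * z / t) * Real.exp (-(y ^ 2 + z ^ 2) / (2 * t)) =
      √(2 * Real.pi * t) * (heat t (z - y) + heat t (z + y)) / 2 := by
    have : √(2 * Real.pi * t) ≠ 0 := by positivity
    unfold heat
    rw [Real.cosh_eq, div_mul_eq_mul_div, add_mul, ← Real.exp_add, ← Real.exp_add,
      show y * z / t + -(y ^ 2 + z ^ 2) / (2 * t) = -(z - y) ^ 2 / (2 * t) by field_simp; ring,
      show -(y * z / t) + -(y ^ 2 + z ^ 2) / (2 * t) = -(z + y) ^ 2 / (2 * t) by field_simp; ring]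
    field_simp
  have e4 : Real.sinh (y * z / t) * Real.exp (-(y ^ 2 + z ^ 2) / (2 * t)) =
      √(2 * Real.pi * t) * (heat t (z - y) - heat t (z + y)) / 2 := by
    have : √(2 * Real.pi * t) ≠ 0 := by positivity
    unfold heat
    rw [Real.sinh_eq, div_mul_eq_mul_div, sub_mul, ← Real.exp_add, ← Real.exp_add,
      show y * z / t + -(y ^ 2 + z ^ 2) / (2 * t) = -(z - y) ^ 2 / (2 * t) by field_simp; ring,
      show -(y * z / t) + -(y ^ 2 + z ^ 2) / (2 * t) = -(z + y) ^ 2 / (2 * t) by field_simp; ring]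
    field_simp
  have h1 : 0 < √y := Real.sqrt_pos.2 hy
  have h2 : 0 < √z := Real.sqrt_pos.2 hz
  have h2' : √z ^ 2 = z := Real.sq_sqrt hz.le
  have h3 : 0 < √(2 * Real.pi * t) := by positivity
  unfold transitionDensity besselI
  rw [e1, e2]
  calc _ = z / t * (y / z * (√y / √z)) * (2 * t / (√(2 * Real.pi * t) * (√y * √z))) *
        (Real.cosh (y * z / t) * Real.exp (-(y ^ 2 + z ^ 2) / (2 * t)) -
          Real.sinh (y * z / t) * Real.exp (-(y ^ 2 + z ^ 2) / (2 * t)) / (y * z / t)) := by ring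
    _ = _ := by
      rw [e3, e4]
      field_simp
      rw [h2']

/-- There is an explicit primitive in z. Its term in t/z becomes a derivative at z = 0, whence the
boundary contribution 2y g_t(y). -/
theorem integral_transitionDensity {t y : ℝ} (ht : 0 < t) (hy : 0 < y) :
    IntegrableOn (transitionDensity t y) (Set.Ioi 0) ∧
      ∫ z in Set.Ioi 0, transitionDensity t y z =
        1 - (2 * y * heat t y + 2 * normalCdf (-y / √t)) := by
  have h1 : 0 < √t := Real.sqrt_pos.2 ht
  have hH : ∀ z y : ℝ, HasDerivAt (fun z => normalCdf ((z + y) / √t)) (heat t (z + y)) z :=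
    fun z y => by
      have h := (hasDerivAt_normalCdf ((z + y) / √t)).comp z
        (((hasDerivAt_id z).add_const y).div_const (√t))
      refine h.congr_deriv ?_
      have : √(2 * Real.pi) ≠ 0 := by positivity
      rw [heat_scale ht, heat]
      simp only [mul_one]
      field_simp
  have hg : ∀ z y : ℝ, HasDerivAt (fun z => heat t (z + y)) (-((z + y) / t) * heat t (z + y)) z :=
    fun z y => by
      have h := (hasDerivAt_heat ht (z + y)).comp z ((hasDerivAt_id' z).add_const y)
      rw [mul_one] at h
      exact h
  have hN : ∀ y, Tendsto (fun z => normalCdf ((z + y) / √t)) atTop (𝓝 1) := fun y =>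
    tendsto_normalCdf_atTop.comp
      ((tendsto_atTop_add_const_right _ _ tendsto_id).atTop_div_const h1)
  rw [show 1 - (2 * y * heat t y + 2 * normalCdf (-y / √t)) =
    0 - (2 * y * heat t y + (normalCdf (-y / √t) - normalCdf (y / √t))) by
      rw [show normalCdf (y / √t) = 1 - normalCdf (-y / √t) by
        rw [← normalCdf_neg]; congr 1; ring]
      ring]
  refine integral_Ioi_of_hasDerivAt_of_nonneg_of_tendsto
    (f := fun z => t / z * (heat t (z + -y) - heat t (z + y)) +
      (normalCdf ((z + -y) / √t) - normalCdf ((z + y) / √t))) ?_ ?_ ?_ ?_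
  · intro z hz
    have hd : HasDerivAt (fun z => t / z) (-(t / z ^ 2)) z := by
      refine ((hasDerivAt_inv hz.ne').const_mul t).congr_deriv ?_
      field_simp
    refine ((hd.mul ((hg z (-y)).sub (hg z y))).add ((hH z (-y)).sub (hH z y))).congr_deriv ?_
    rw [transitionDensity_eq ht hy hz, ← sub_eq_add_neg]
    simp only [Pi.sub_apply, ← sub_eq_add_neg]
    field_simp
    ring
  · exact fun z hz => transitionDensity_nonneg ht hy.le hz.le
  · refine Tendsto.add ?_ ?_
    · have h : HasDerivAt (fun z => heat t (z + -y) - heat t (z + y))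
          (2 * (y / t) * heat t y) 0 := by
        refine ((hg 0 (-y)).sub (hg 0 y)).congr_deriv ?_
        simp only [zero_add, heat_neg]
        ring
      have h' := (h.tendsto_slope_zero.mono_left
        (nhdsWithin_mono 0 fun z (hz : 0 < z) => hz.ne')).const_mul t
      rw [show t * (2 * (y / t) * heat t y) = 2 * y * heat t y by field_simp] at h'
      refine h'.congr fun z => ?_
      simp only [zero_add, heat_neg, sub_self, sub_zero, smul_eq_mul]
      ring
    · have h := ((hH 0 (-y)).sub (hH 0 y)).continuousAt.tendsto
      simp only [Pi.sub_apply, zero_add] at h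
      exact h.mono_left nhdsWithin_le_nhds
  · have hb : ∀ y, Tendsto (fun z => t / z * heat t (z + y)) atTop (𝓝 0) := fun y => by
      have h0 : Tendsto (fun z : ℝ => t / z * heat t 0) atTop (𝓝 0) := by
        simpa using (tendsto_const_nhds.div_atTop tendsto_id).mul_const (heat t 0)
      refine squeeze_zero' ?_ ?_ h0
      · filter_upwards [eventually_gt_atTop 0] with z hz
        exact mul_nonneg (by positivity) (heat_nonneg _ _)
      · filter_upwards [eventually_gt_atTop 0] with z hz
        have := heat_le ht (z + y)
        gcongr
    have h := ((hb (-y)).sub (hb y)).add ((hN (-y)).sub (hN y))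
    norm_num at h
    refine h.congr fun z => ?_
    rw [mul_sub]

/-- The probability of having been absorbed at `0` by time `t`, started at `y > 0`. -/
theorem transitionKernel_mass {t y : ℝ≥0} (ht : 0 < t) (hy : 0 < y) :
    ∫⁻ z, transitionDensityNN t y z ∂lebNN =
      1 - ∫⁻ s in Set.Ioc (0 : ℝ) t, ENNReal.ofReal (passageDensity s y 0) := by
  have ht' : (0 : ℝ) < t := ht
  have hy' : (0 : ℝ) < y := hy
  obtain ⟨hi, he⟩ := integral_transitionDensity ht' hy'
  rw [lintegral_lebNN (measurable_transitionDensityNN t).of_uncurry_left]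
  have e1 : ∫⁻ z in Set.Ioi (0 : ℝ), transitionDensityNN t y z.toNNReal =
      ENNReal.ofReal (∫ z in Set.Ioi 0, transitionDensity t y z) := by
    rw [ofReal_integral_eq_lintegral_ofReal hi]
    · refine setLIntegral_congr_fun measurableSet_Ioi fun z hz => ?_
      simp only [transitionDensityNN, Real.coe_toNNReal _ (Set.mem_Ioi.1 hz).le]
    · filter_upwards [ae_restrict_mem measurableSet_Ioi] with z hz
      exact transitionDensity_nonneg ht' hy'.le (Set.mem_Ioi.1 hz).le
  have hL := laplace_bessel le_rfl hy'
  have e0 : ∀ s, 0 < s → passageDensity s y 0 = dampedHeat 0 s y * (y ^ 3 / s ^ 2) := fun s hs => by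
    have h := passageDensity_add hs hy'.le le_rfl
    rw [add_zero] at h
    rw [h]
    simp only [passageKernel, zero_mul, add_zero, sub_self, zero_div, zero_add]
    rw [integral_mul_const, integral_exp_neg_Ioi_zero]
    simp [dampedHeat]
    ring
  have e2 : ∫⁻ s in Set.Ioc (0 : ℝ) t, ENNReal.ofReal (passageDensity s y 0) =
      ENNReal.ofReal (2 * y * heat t y + 2 * normalCdf (-y / √t)) := by
    rw [← integral_bessel ht' hy', intervalIntegral.integral_of_le ht'.le,
      ofReal_integral_eq_lintegral_ofReal]
    · refine setLIntegral_congr_fun measurableSet_Ioc fun s hs => ?_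
      simp only [e0 s hs.1]
      simp [dampedHeat]
    · have := hL.1.mono_set (Set.Ioc_subset_Ioi_self : Set.Ioc (0 : ℝ) t ⊆ _)
      simpa [dampedHeat, IntegrableOn] using this
    · filter_upwards [ae_restrict_mem measurableSet_Ioc] with s hs
      have := heat_nonneg s y
      positivity
  rw [e1, he, e2, ENNReal.ofReal_sub, ENNReal.ofReal_one]
  rw [← integral_bessel ht' hy']
  refine intervalIntegral.integral_nonneg ht'.le fun s hs => ?_
  have := heat_nonneg s y
  positivity

theorem transitionKernel_mass_zero (t : ℝ≥0) :
    ∫⁻ z, transitionDensityNN t 0 z ∂lebNN = 0 := by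
  simp [transitionDensityNN, transitionDensity_zero_left]

theorem transitionKernel_mass_le {t : ℝ≥0} (ht : 0 < t) (y : ℝ≥0) :
    ∫⁻ z, transitionDensityNN t y z ∂lebNN ≤ 1 := by
  rcases eq_zero_or_pos y with rfl | hy
  · rw [transitionKernel_mass_zero]; exact zero_le
  · rw [transitionKernel_mass ht hy]; exact tsub_le_self

theorem transitionKernel_apply (t y : ℝ≥0) : transitionKernel t y =
    lebNN.withDensity (transitionDensityNN t y) +
      (1 - ∫⁻ z, transitionDensityNN t y z ∂lebNN) • Measure.dirac 0 := rfl

theorem transitionKernel_univ {t : ℝ≥0} (ht : 0 < t) (y : ℝ≥0) :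
    transitionKernel t y Set.univ = 1 := by
  rw [transitionKernel_apply]
  simp only [Measure.add_apply, Measure.smul_apply, withDensity_apply _ MeasurableSet.univ,
    Measure.restrict_univ, measure_univ, smul_eq_mul, mul_one]
  exact add_tsub_cancel_of_le (transitionKernel_mass_le ht y)

theorem isMarkovKernel_transitionKernel {t : ℝ≥0} (ht : 0 < t) :
    IsMarkovKernel (transitionKernel t) := ⟨fun y => ⟨transitionKernel_univ ht y⟩⟩

theorem lintegral_passageDensity_zero {y : ℝ≥0} (hy : 0 < y) :
    ∫⁻ s in Set.Ioi (0 : ℝ), ENNReal.ofReal (passageDensity s y 0) = 1 := by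
  have h := laplace_passageDensity (q := 0) le_rfl (show (0 : ℝ) < y from hy) le_rfl
  simpa using h

/-- Lebesgue measure does not charge 0, so only the atom counts. Recovering F from 1 - (1 - F) in
[0, ∞] requires F to be finite and at most 1, which holds because r(y, 0) has total mass 1. -/
theorem transitionKernel_singleton_zero {t y : ℝ≥0} (ht : 0 < t) (hy : 0 < y) :
    transitionKernel t y {0} =
      ∫⁻ s in Set.Ioc (0 : ℝ) t, ENNReal.ofReal (passageDensity s y 0) := by
  rw [transitionKernel_apply]
  simp only [Measure.add_apply, Measure.smul_apply, withDensity_apply _ (measurableSet_singleton _),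
    Measure.dirac_apply_of_mem (Set.mem_singleton _), smul_eq_mul, mul_one]
  rw [setLIntegral_measure_zero _ _ (lebNN_singleton 0), zero_add, transitionKernel_mass ht hy]
  refine ENNReal.sub_sub_cancel ENNReal.one_ne_top ?_
  rw [← lintegral_passageDensity_zero hy]
  exact lintegral_mono_set Set.Ioc_subset_Ioi_self

theorem transitionKernel_zero_singleton (t : ℝ≥0) : transitionKernel t 0 {0} = 1 := by
  rw [transitionKernel_apply]
  simp only [Measure.add_apply, Measure.smul_apply, withDensity_apply _ (measurableSet_singleton _),
    Measure.dirac_apply_of_mem (Set.mem_singleton _), smul_eq_mul, mul_one]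
  rw [setLIntegral_measure_zero _ _ (lebNN_singleton 0), transitionKernel_mass_zero]
  simp

/-! ### Absorption by an independent exponential time -/

/-- The Laplace transform, at `q² / 2`, of the absorption time started at `y`. -/
def absorptionLaplace (q y : ℝ) : ℝ := (1 + y * q) * Real.exp (-(y * q))

theorem continuous_absorptionLaplace (q : ℝ) : Continuous (absorptionLaplace q) := by
  unfold absorptionLaplace; fun_prop

theorem absorptionLaplace_pos {q y : ℝ} (hq : 0 ≤ q) (hy : 0 ≤ y) : 0 < absorptionLaplace q y := by
  unfold absorptionLaplace; positivity

theorem absorptionLaplace_le_one (q y : ℝ) :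
    absorptionLaplace q y ≤ 1 := by
  unfold absorptionLaplace
  rw [Real.exp_neg, ← div_eq_mul_inv, div_le_one (Real.exp_pos _), add_comm]
  exact Real.add_one_le_exp _

/-- The density of the exponential law of rate `q² / 2`. -/
def expRate (q : ℝ) (t : ℝ) : ℝ≥0∞ := ENNReal.ofReal (q ^ 2 / 2 * Real.exp (-q ^ 2 * t / 2))

@[fun_prop]
theorem measurable_expRate (q : ℝ) : Measurable (expRate q) := by unfold expRate; fun_prop

theorem lintegral_expRate {q : ℝ} (hq : 0 < q) (s : ℝ) :
    ∫⁻ t in Set.Ioi s, expRate q t = ENNReal.ofReal (Real.exp (-q ^ 2 * s / 2)) := by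
  have hq2 : 0 < q ^ 2 := by positivity
  have e : ∀ t, q ^ 2 / 2 * Real.exp (-q ^ 2 * t / 2) =
      q ^ 2 / 2 * Real.exp (-(q ^ 2 / 2) * t) := fun t => by congr 2; ring
  unfold expRate
  rw [← ofReal_integral_eq_lintegral_ofReal]
  · simp_rw [e]
    rw [integral_const_mul, integral_exp_mul_Ioi (by linarith)]
    congr 1
    rw [show -(q ^ 2 / 2) * s = -q ^ 2 * s / 2 by ring]
    field_simp
  · simp_rw [e]
    exact (integrableOn_exp_mul_Ioi (by linarith) s).const_mul _
  · exact ae_of_all _ fun t => by positivity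

/-- Both sides are the probability that absorption occurs before an independent exponential time of
rate q²/2: Tonelli exchanges the distribution function of the absorption time for its Laplace
transform. -/
theorem lintegral_expRate_mul_transitionKernel {q : ℝ} (hq : 0 < q) (y : ℝ≥0) :
    ∫⁻ t in Set.Ioi (0 : ℝ), expRate q t * transitionKernel t.toNNReal y {0} =
      ENNReal.ofReal (absorptionLaplace q y) := by
  rcases eq_zero_or_pos y with rfl | hy
  · simp only [transitionKernel_zero_singleton, mul_one]
    rw [lintegral_expRate hq]
    simp [absorptionLaplace]
  · have hm : Measurable fun s : ℝ => ENNReal.ofReal (passageDensity s y 0) := by fun_prop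
    calc _ = ∫⁻ t in Set.Ioi (0 : ℝ), ∫⁻ s in Set.Ioi (0 : ℝ),
          expRate q t * {p : ℝ × ℝ | p.2 ≤ p.1}.indicator 1 (t, s) *
            ENNReal.ofReal (passageDensity s y 0) := by
          refine setLIntegral_congr_fun measurableSet_Ioi fun t ht => ?_
          have ht : 0 < t := ht
          simp only [mul_assoc]
          rw [transitionKernel_singleton_zero (Real.toNNReal_pos.2 ht) hy,
            Real.coe_toNNReal _ ht.le, lintegral_const_mul]
          · congr 1
            rw [← Set.Ioi_inter_Iic, Set.inter_comm, ← setLIntegral_indicator measurableSet_Iic]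
            refine lintegral_congr fun s => ?_
            by_cases h : s ≤ t <;> simp [Set.indicator, h]
          · refine Measurable.mul ?_ hm
            exact (measurable_one.indicator
              (measurableSet_le measurable_snd measurable_fst)).comp (by fun_prop)
      _ = ∫⁻ s in Set.Ioi (0 : ℝ), ∫⁻ t in Set.Ioi (0 : ℝ),
          expRate q t * {p : ℝ × ℝ | p.2 ≤ p.1}.indicator 1 (t, s) *
            ENNReal.ofReal (passageDensity s y 0) := by
          rw [lintegral_lintegral_swap]
          refine Measurable.aemeasurable ?_
          refine Measurable.mul (Measurable.mul (by fun_prop) ?_) (by fun_prop)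
          exact (measurable_one.indicator
              (measurableSet_le measurable_snd measurable_fst)).comp (by fun_prop)
      _ = ∫⁻ s in Set.Ioi (0 : ℝ),
          ENNReal.ofReal (Real.exp (-q ^ 2 * s / 2) * passageDensity s (y + 0) 0) := by
          refine setLIntegral_congr_fun measurableSet_Ioi fun s hs => ?_
          have hs : 0 < s := hs
          rw [lintegral_mul_const, ENNReal.ofReal_mul (Real.exp_pos _).le, ← lintegral_expRate hq,
            add_zero]
          · congr 1
            rw [setLIntegral_congr (Ioi_ae_eq_Ici (a := s)), ← Set.inter_eq_left.2
              (show Set.Ici s ⊆ Set.Ioi 0 from fun t ht => hs.trans_le ht),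
              ← setLIntegral_indicator measurableSet_Ici]
            refine lintegral_congr fun t => ?_
            by_cases h : s ≤ t <;> simp [Set.indicator, h]
          · refine Measurable.mul (by fun_prop) ?_
            exact (measurable_one.indicator
              (measurableSet_le measurable_snd measurable_fst)).comp (by fun_prop)
      _ = _ := by
          rw [laplace_passageDensity hq.le (show (0 : ℝ) < y from hy) le_rfl]
          simp [absorptionLaplace]

/-! ### Scaling of the transition kernel -/

theorem transitionDensity_scale {c t y z : ℝ} (hc : 0 < c) (ht : 0 < t) :
    c * transitionDensity (c ^ 2 * t) (c * y) (c * z) = transitionDensity t y z := by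
  unfold transitionDensity
  rw [mul_div_mul_left _ _ hc.ne', show c * y * (c * z) / (c ^ 2 * t) = y * z / t by field_simp,
    show -((c * y) ^ 2 + (c * z) ^ 2) / (2 * (c ^ 2 * t)) = -(y ^ 2 + z ^ 2) / (2 * t) by
      field_simp]
  field_simp

theorem lintegral_transitionDensityNN_scale {c t : ℝ≥0} (hc : 0 < c) (ht : 0 < t) (y : ℝ≥0)
    {f : ℝ≥0 → ℝ≥0∞} (hf : Measurable f) :
    ∫⁻ z, transitionDensityNN (c ^ 2 * t) (c * y) z * f z ∂lebNN =
      ∫⁻ z, transitionDensityNN t y z * f (c * z) ∂lebNN := by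
  have hc' : (0 : ℝ) < c := hc
  have hm : ∀ t y, Measurable (transitionDensityNN t y) := fun t y =>
    (measurable_transitionDensityNN t).of_uncurry_left
  have hm1 := hm (c ^ 2 * t) (c * y)
  have hm2 := hm t y
  rw [lintegral_lebNN (by fun_prop), lintegral_lebNN (by fun_prop)]
  conv_lhs => rw [← Real.smul_map_volume_mul_left hc'.ne']
  rw [Measure.restrict_smul, lintegral_smul_measure, Measure.restrict_map (by fun_prop)
    measurableSet_Ioi, lintegral_map (by fun_prop) (by fun_prop), smul_eq_mul,
    ← lintegral_const_mul _ (by fun_prop)]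
  have hp : (fun x => (c : ℝ) * x) ⁻¹' Set.Ioi 0 = Set.Ioi 0 := by
    ext x; simp [hc']
  rw [hp]
  refine setLIntegral_congr_fun measurableSet_Ioi fun z hz => ?_
  have hz : 0 < z := hz
  have e : (c * z : ℝ).toNNReal = c * z.toNNReal := by
    rw [Real.toNNReal_mul hc'.le, Real.toNNReal_coe]
  simp only [e]
  rw [← mul_assoc]
  congr 1
  unfold transitionDensityNN
  rw [abs_of_pos hc', ← ENNReal.ofReal_mul hc'.le]
  congr 1
  push_cast
  exact transitionDensity_scale hc' ht

theorem lintegral_transitionKernel {t y : ℝ≥0} {f : ℝ≥0 → ℝ≥0∞} (hf : Measurable f) :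
    ∫⁻ z, f z ∂(transitionKernel t y) = ∫⁻ z, transitionDensityNN t y z * f z ∂lebNN +
      (1 - ∫⁻ z, transitionDensityNN t y z ∂lebNN) * f 0 := by
  rw [transitionKernel_apply, lintegral_add_measure, lintegral_smul_measure, lintegral_dirac,
    lintegral_withDensity_eq_lintegral_mul _ (measurable_transitionDensityNN t).of_uncurry_left hf]
  rfl

/-- The absolutely continuous parts correspond by z ↦ cz. Hence their masses agree, so the atoms
have equal weight, and 0 is fixed by the scaling. -/
theorem lintegral_transitionKernel_scale {c t : ℝ≥0} (hc : 0 < c) (ht : 0 < t) (y : ℝ≥0)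
    {f : ℝ≥0 → ℝ≥0∞} (hf : Measurable f) :
    ∫⁻ z, f z ∂(transitionKernel (c ^ 2 * t) (c * y)) =
      ∫⁻ z, f (c * z) ∂(transitionKernel t y) := by
  have h1 := lintegral_transitionDensityNN_scale hc ht y (f := 1) measurable_one
  simp only [Pi.one_apply, mul_one] at h1
  rw [lintegral_transitionKernel hf, lintegral_transitionKernel (by fun_prop),
    lintegral_transitionDensityNN_scale hc ht y hf, h1, mul_zero]

/-! ### Uniqueness of Laplace transforms -/

open BoundedContinuousFunction in
/-- Two finite measures on `[0, ∞)` with the same Laplace transform are equal. -/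
theorem ext_of_laplace {μ ν : Measure ℝ≥0} [IsFiniteMeasure μ] [IsFiniteMeasure ν]
    (h : ∀ q : ℝ, 0 < q → ∫⁻ t, ENNReal.ofReal (Real.exp (-q ^ 2 * t / 2)) ∂μ =
      ∫⁻ t, ENNReal.ofReal (Real.exp (-q ^ 2 * t / 2)) ∂ν) : μ = ν := by
  have h1 : ∀ r : ℝ, 0 < r → ∫ t : ℝ≥0, Real.exp (-(r * t)) ∂μ = ∫ t : ℝ≥0, Real.exp (-(r * t)) ∂ν := by
    intro r hr
    rw [integral_eq_lintegral_of_nonneg_ae (ae_of_all _ fun t => (Real.exp_pos _).le)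
        (by fun_prop),
      integral_eq_lintegral_of_nonneg_ae (ae_of_all _ fun t => (Real.exp_pos _).le) (by fun_prop)]
    have := h (√(2 * r)) (by positivity)
    rw [Real.sq_sqrt (by positivity)] at this
    have e : ∀ t : ℝ≥0, -(2 * r) * (t : ℝ) / 2 = -(r * t) := fun t => by ring
    simp_rw [e] at this
    rw [this]
  have hint : ∀ (ρ : Measure ℝ≥0) [IsFiniteMeasure ρ] (r : ℝ), 0 ≤ r →
      Integrable (fun t : ℝ≥0 => Real.exp (-(r * t))) ρ := fun ρ _ r hr => by
    refine Integrable.of_bound (by fun_prop) 1 (ae_of_all _ fun t => ?_)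
    rw [Real.norm_of_nonneg (Real.exp_pos _).le, Real.exp_le_one_iff]
    have : 0 ≤ r * t := by positivity
    linarith
  -- Equality of the total masses is not in the hypothesis, which has q > 0; it is the limit at rate
  -- 0.
  have h0 : ∫ t : ℝ≥0, Real.exp (-(0 * t)) ∂μ = ∫ t : ℝ≥0, Real.exp (-(0 * t)) ∂ν := by
    have lim : ∀ (ρ : Measure ℝ≥0) [IsFiniteMeasure ρ],
        Tendsto (fun r : ℝ => ∫ t : ℝ≥0, Real.exp (-(r * t)) ∂ρ) (𝓝[>] 0)
          (𝓝 (∫ t : ℝ≥0, Real.exp (-(0 * t)) ∂ρ)) := fun ρ _ => by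
      refine tendsto_integral_filter_of_dominated_convergence (fun _ => 1)
        (Eventually.of_forall fun r => by fun_prop) ?_ (integrable_const _) ?_
      · filter_upwards [self_mem_nhdsWithin] with r hr
        refine ae_of_all _ fun t => ?_
        rw [Real.norm_of_nonneg (Real.exp_pos _).le, Real.exp_le_one_iff]
        have : 0 ≤ r * t := mul_nonneg (Set.mem_Ioi.1 hr).le t.2
        linarith
      · refine ae_of_all _ fun t => ?_
        have : Continuous fun r : ℝ => Real.exp (-(r * t)) := by fun_prop
        exact (this.tendsto 0).mono_left nhdsWithin_le_nhds
    refine tendsto_nhds_unique ((lim μ).congr' ?_) (lim ν)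
    filter_upwards [self_mem_nhdsWithin] with r hr using h1 r hr
  -- Polynomials in e^{-t} form a subalgebra separating points, and their integrals are combinations
  -- of Laplace transforms at natural numbers.
  let e : ℝ≥0 →ᵇ ℝ := BoundedContinuousFunction.ofNormedAddCommGroup
    (fun t : ℝ≥0 => Real.exp (-t)) (by fun_prop) 1 fun t => by
      rw [Real.norm_of_nonneg (Real.exp_pos _).le, Real.exp_le_one_iff]; simp
  have he : ∀ t, e t = Real.exp (-t) := fun t => rfl
  have hpow : ∀ (n : ℕ) (t : ℝ≥0), (e ^ n) t = Real.exp (-((n : ℝ) * t)) := fun n t => by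
    rw [BoundedContinuousFunction.coe_pow, Pi.pow_apply, he, ← Real.exp_nat_mul]; congr 1; ring
  let A : StarSubalgebra ℝ (ℝ≥0 →ᵇ ℝ) :=
    { Algebra.adjoin ℝ {e} with
      star_mem' := fun {f} hf => by
        have : star f = f := by ext t; simp
        rw [this]; exact hf }
  refine ext_of_forall_mem_subalgebra_integral_eq_of_polish (𝕜 := ℝ) (A := A) ?_ ?_
  · intro s t hst
    refine ⟨fun u => Real.exp (-u), ⟨⟨fun u => Real.exp (-u), by fun_prop⟩, ?_, rfl⟩, fun h' => ?_⟩
    · refine ⟨e, Algebra.subset_adjoin rfl, rfl⟩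
    · exact hst (by simpa using h')
  · intro g hg
    have hg : g ∈ Algebra.adjoin ℝ {e} := hg
    rw [Algebra.adjoin_singleton_eq_range_aeval] at hg
    obtain ⟨p, rfl⟩ := hg
    have hP : ∀ t, (Polynomial.aeval e p) t =
        ∑ n ∈ Finset.range (p.natDegree + 1), p.coeff n * Real.exp (-((n : ℝ) * t)) := fun t => by
      rw [Polynomial.aeval_eq_sum_range, BoundedContinuousFunction.coe_sum, Finset.sum_apply]
      refine Finset.sum_congr rfl fun n _ => ?_
      simp only [BoundedContinuousFunction.coe_smul, hpow, smul_eq_mul]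
    have hI : ∀ n : ℕ, ∫ t : ℝ≥0, Real.exp (-((n : ℝ) * t)) ∂μ =
        ∫ t : ℝ≥0, Real.exp (-((n : ℝ) * t)) ∂ν := fun n => by
      rcases Nat.eq_zero_or_pos n with rfl | hn
      · simpa using h0
      · exact h1 n (by exact_mod_cast hn)
    change ∫ t, (Polynomial.aeval e p) t ∂μ = ∫ t, (Polynomial.aeval e p) t ∂ν
    simp_rw [hP]
    rw [integral_finsetSum _ fun (n : ℕ) _ => (hint μ n n.cast_nonneg).const_mul (p.coeff n),
      integral_finsetSum _ fun (n : ℕ) _ => (hint ν n n.cast_nonneg).const_mul (p.coeff n)]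
    simp_rw [integral_const_mul, hI]

end

section

/-! ### Paths and first-passage times -/

theorem exists_passageTime_eq {ε : ℝ≥0} {w : C(ℝ≥0, ℝ≥0)} (h : passageTime ε w ≠ ∞) :
    ∃ τ : ℝ≥0, passageTime ε w = τ ∧ w τ = ε := by
  set S := {t : ℝ≥0 | w t = ε}
  have hne : S.Nonempty := by
    by_contra hS
    refine h ?_
    unfold passageTime
    refine iInf₂_eq_top.2 fun t ht => ?_
    exact absurd ⟨t, ht⟩ hS
  have hcl : IsClosed S := isClosed_singleton.preimage w.continuous
  have hmem := hcl.csInf_mem hne (OrderBot.bddBelow S)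
  refine ⟨sInf S, le_antisymm (iInf₂_le _ hmem) (le_iInf₂ fun t ht => ?_), hmem⟩
  exact_mod_cast csInf_le (OrderBot.bddBelow S) ht

theorem passageTime_le_iff {ε s : ℝ≥0} {w : C(ℝ≥0, ℝ≥0)} :
    passageTime ε w ≤ s ↔ ∃ u ≤ s, w u = ε := by
  constructor
  · intro h
    obtain ⟨τ, h1, h2⟩ := exists_passageTime_eq (h.trans_lt ENNReal.coe_lt_top).ne
    exact ⟨τ, by rw [h1] at h; exact_mod_cast h, h2⟩
  · rintro ⟨u, hu, h⟩
    exact (iInf₂_le u h).trans (by exact_mod_cast hu)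

theorem apply_passageTime {ε : ℝ≥0} {w : C(ℝ≥0, ℝ≥0)} (h : passageTime ε w ≠ ∞) :
    w (passageTime ε w).toNNReal = ε := by
  obtain ⟨τ, h1, h2⟩ := exists_passageTime_eq h
  rw [h1, ENNReal.toNNReal_coe, h2]

/-- Intermediate values: a path starting above ε cannot be at or below ε without having hit ε. -/
theorem lt_passageTime_iff {ε s : ℝ≥0} {w : C(ℝ≥0, ℝ≥0)} (hw : ε < w 0) :
    s < passageTime ε w ↔ ∀ u ≤ s, ε < w u := by
  rw [← not_le, passageTime_le_iff]
  push Not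
  refine ⟨fun h u hu => ?_, fun h u hu => (h u hu).ne'⟩
  by_contra hlt
  push Not at hlt
  obtain ⟨v, hv, hv'⟩ := intermediate_value_Icc' (zero_le (a := u)) w.continuous.continuousOn
    ⟨hlt, hw.le⟩
  exact h v (hv.2.trans hu) hv'

theorem isOpen_lt_passageTime (ε s : ℝ≥0) :
    IsOpen {w : C(Set.Icc 0 s, ℝ≥0) | ∀ u, w u ≠ ε} := by
  have := ContinuousMap.isOpen_setOfPred_mapsTo (X := Set.Icc 0 s) (Y := ℝ≥0) isCompact_univ
    (isOpen_compl_singleton (x := ε))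
  simpa [Set.MapsTo] using this

theorem continuous_restrict_Icc (s : ℝ≥0) :
    Continuous fun w : C(ℝ≥0, ℝ≥0) => w.restrict (Set.Icc 0 s) :=
  ContinuousMap.continuous_restrict _

theorem continuous_restrictPath {s t : ℝ≥0} (h : s ≤ t) : Continuous (restrictPath h) :=
  ContinuousMap.continuous_precomp
    (⟨fun u => ⟨u, zero_le, u.2.2.trans h⟩, by fun_prop⟩ : C(Set.Icc 0 s, Set.Icc 0 t))

/-- Expresses survival up to s as an open condition on the path up to s, which gives both the
measurability of the passage time and that of survival in the past of s. -/
theorem lt_passageTime_eq_preimage (ε s : ℝ≥0) :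
    {w : C(ℝ≥0, ℝ≥0) | s < passageTime ε w} =
      (fun w : C(ℝ≥0, ℝ≥0) => w.restrict (Set.Icc 0 s)) ⁻¹' {w | ∀ u, w u ≠ ε} := by
  ext w
  simp only [Set.mem_ofPred_eq, Set.mem_preimage, ← not_le, passageTime_le_iff]
  push Not
  exact ⟨fun h u => h u u.2.2, fun h u hu => h ⟨u, zero_le, hu⟩⟩

theorem measurable_passageTime (ε : ℝ≥0) : Measurable (passageTime ε) := by
  refine measurable_of_Ioi fun s => ?_
  induction s with
  | top => simp
  | coe s =>
    change MeasurableSet {w | (s : ℝ≥0∞) < passageTime ε w}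
    rw [lt_passageTime_eq_preimage]
    exact ((isOpen_lt_passageTime ε s).preimage (continuous_restrict_Icc s)).measurableSet

variable {Ω : Type*} {R : Ω → C(ℝ≥0, ℝ≥0)} {x ε : ℝ≥0}

/-- The σ-algebra generated by the path up to time `s`. -/
@[reducible]
def pathSigma (R : Ω → C(ℝ≥0, ℝ≥0)) (s : ℝ≥0) : MeasurableSpace Ω :=
  MeasurableSpace.comap (fun ω => (R ω).restrict (Set.Icc 0 s)) inferInstance

theorem pathSigma_mono (R : Ω → C(ℝ≥0, ℝ≥0)) {s t : ℝ≥0} (h : s ≤ t) :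
    pathSigma R s ≤ pathSigma R t := by
  rintro _ ⟨A, hA, rfl⟩
  exact ⟨restrictPath h ⁻¹' A, (continuous_restrictPath h).measurable hA, rfl⟩

theorem measurable_pathSigma_apply (R : Ω → C(ℝ≥0, ℝ≥0)) {u s : ℝ≥0} (hu : u ≤ s) :
    Measurable[pathSigma R s] fun ω => R ω u := by
  have : (fun ω => R ω u) = (fun w : C(Set.Icc 0 s, ℝ≥0) => w ⟨u, zero_le, hu⟩) ∘
      fun ω => (R ω).restrict (Set.Icc 0 s) := rfl
  rw [this]
  exact (continuous_eval_const _).measurable.comp (comap_measurable _)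

/-- The event that the level `ε` is not reached by time `s`. -/
def alive (R : Ω → C(ℝ≥0, ℝ≥0)) (ε s : ℝ≥0) : Set Ω := {ω | s < passageTime ε (R ω)}

theorem measurableSet_alive (R : Ω → C(ℝ≥0, ℝ≥0)) (ε s : ℝ≥0) :
    MeasurableSet[pathSigma R s] (alive R ε s) := by
  refine ⟨{w | ∀ u, w u ≠ ε}, (isOpen_lt_passageTime ε s).measurableSet, ?_⟩
  change _ = R ⁻¹' {w | s < passageTime ε w}
  rw [lt_passageTime_eq_preimage]
  rfl

theorem alive_anti (R : Ω → C(ℝ≥0, ℝ≥0)) (ε : ℝ≥0) {s t : ℝ≥0} (h : s ≤ t) :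
    alive R ε t ⊆ alive R ε s := fun _ hω =>
  (ENNReal.coe_le_coe.2 h).trans_lt (show (t : ℝ≥0∞) < _ from hω)

theorem lt_of_mem_alive {s : ℝ≥0} {ω : Ω} (h0 : ε < R ω 0) (h : ω ∈ alive R ε s) : ε < R ω s :=
  (lt_passageTime_iff h0).1 h s le_rfl

variable [MeasurableSpace Ω] {P : Measure Ω}

theorem pathSigma_le (hR : Measurable R) (s : ℝ≥0) : pathSigma R s ≤ ‹MeasurableSpace Ω› :=
  ((continuous_restrict_Icc s).measurable.comp hR).comap_le

theorem measurable_apply (hR : Measurable R) (u : ℝ≥0) : Measurable fun ω => R ω u :=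
  (continuous_eval_const u).measurable.comp hR

theorem measurable_uncurry_path (hR : Measurable R) :
    Measurable fun p : ℝ≥0 × Ω => R p.2 p.1 :=
  (measurable_uncurry_of_continuous_of_measurable (u := fun (u : ℝ≥0) ω => R ω u)
    (fun ω => (R ω).continuous) fun u => measurable_apply hR u)

theorem IsBesselNegOne.lintegral_markov (h : IsBesselNegOne R x P) {s t : ℝ≥0} (ht : 0 < t)
    {G : C(Set.Icc 0 s, ℝ≥0) → ℝ≥0∞} (hG : Measurable G) {f : ℝ≥0 → ℝ≥0∞} (hf : Measurable f) :
    ∫⁻ ω, G ((R ω).restrict (Set.Icc 0 s)) * f (R ω (s + t)) ∂P =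
      ∫⁻ ω, G ((R ω).restrict (Set.Icc 0 s)) * ∫⁻ z, f z ∂(transitionKernel t (R ω s)) ∂P := by
  have := h.isProbabilityMeasure
  have := isMarkovKernel_transitionKernel ht
  have hr : Measurable fun ω => (R ω).restrict (Set.Icc 0 s) :=
    (continuous_restrict_Icc s).measurable.comp h.measurable
  have hm : Measurable fun p : C(Set.Icc 0 s, ℝ≥0) × ℝ≥0 => G p.1 * f p.2 := by fun_prop
  have h1 := h.markov s t ht
  have h2 := lintegral_map hm (hr.prodMk (measurable_apply h.measurable (s + t))) (μ := P)
  rw [← h2, h1.map_eq, Measure.lintegral_compProd hm, lintegral_map _ hr]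
  · refine lintegral_congr fun ω => ?_
    exact lintegral_const_mul (μ := transitionKernel t (R ω s))
      (G ((R ω).restrict (Set.Icc 0 s))) hf
  · exact Measurable.lintegral_kernel_prod_right hm

theorem IsBesselNegOne.setLIntegral_markov (h : IsBesselNegOne R x P) {s t : ℝ≥0} (ht : 0 < t)
    {A : Set Ω} (hA : MeasurableSet[pathSigma R s] A) {f : ℝ≥0 → ℝ≥0∞} (hf : Measurable f) :
    ∫⁻ ω in A, f (R ω (s + t)) ∂P =
      ∫⁻ ω in A, ∫⁻ z, f z ∂(transitionKernel t (R ω s)) ∂P := by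
  have hA' := pathSigma_le h.measurable s _ hA
  obtain ⟨A', hA1, rfl⟩ := hA
  have := h.lintegral_markov ht (measurable_one.indicator hA1) hf
  rw [← lintegral_indicator hA', ← lintegral_indicator hA']
  convert this using 2 with ω ω
  all_goals
    ext ω
    by_cases hω : (R ω).restrict (Set.Icc 0 s) ∈ A' <;> simp [Set.indicator, hω]

/-! ### The law of the first-passage time -/

theorem transitionKernel_singleton_zero_eq (t y : ℝ≥0) :
    transitionKernel t y {0} = 1 - ∫⁻ z, transitionDensityNN t y z ∂lebNN := by
  rw [transitionKernel_apply]
  simp only [Measure.add_apply, Measure.smul_apply,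
    withDensity_apply _ (measurableSet_singleton _),
    Measure.dirac_apply_of_mem (Set.mem_singleton _), smul_eq_mul, mul_one]
  rw [setLIntegral_measure_zero _ _ (lebNN_singleton 0), zero_add]

theorem measurable_transitionKernel_singleton {α : Type*} [MeasurableSpace α] {f g : α → ℝ≥0}
    (hf : Measurable f) (hg : Measurable g) :
    Measurable fun a => transitionKernel (f a) (g a) {0} := by
  simp_rw [transitionKernel_singleton_zero_eq]
  refine measurable_const.sub (Measurable.lintegral_prod_right'
    (f := fun q : α × ℝ≥0 => transitionDensityNN (f q.1) (g q.1) q.2) ?_)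
  unfold transitionDensityNN transitionDensity besselI
  simp only [Real.cosh_eq, Real.sinh_eq]
  fun_prop

/-! ### The exponential mass of the zeros and its conditional mean -/

/-- The indicator of the times at which the path vanishes. -/
def zeroIndicator (w : C(ℝ≥0, ℝ≥0)) (t : ℝ) : ℝ≥0∞ :=
  ({0} : Set ℝ≥0).indicator 1 (w t.toNNReal)

/-- The rate-`q² / 2` exponential mass of the times in `(0, ∞)` at which the path vanishes. -/
def zeroTimes (q : ℝ) (w : C(ℝ≥0, ℝ≥0)) (I : Set ℝ) : ℝ≥0∞ :=
  ∫⁻ t in I, expRate q t * zeroIndicator w t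

theorem measurable_zeroTimes_integrand (hR : Measurable R) (q : ℝ) :
    Measurable fun p : Ω × ℝ =>
      expRate q p.2 * zeroIndicator (R p.1) p.2 := by
  refine Measurable.mul (by fun_prop) ((measurable_one.indicator
    (measurableSet_singleton 0)).comp ?_)
  exact (measurable_uncurry_path hR).comp
    (measurable_snd.real_toNNReal.prodMk measurable_fst)

theorem expRate_add (q : ℝ) (s t : ℝ) :
    expRate q (s + t) = ENNReal.ofReal (Real.exp (-q ^ 2 * s / 2)) * expRate q t := by
  unfold expRate
  rw [← ENNReal.ofReal_mul (Real.exp_pos _).le]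
  congr 1
  rw [show -q ^ 2 * (s + t) / 2 = -q ^ 2 * s / 2 + -q ^ 2 * t / 2 by ring, Real.exp_add]
  ring

theorem setLIntegral_Ioi_eq_add {f : ℝ → ℝ≥0∞} (s : ℝ) :
    ∫⁻ t in Set.Ioi s, f t = ∫⁻ t in Set.Ioi 0, f (s + t) := by
  have h := (measurePreserving_add_left volume s).setLIntegral_comp_preimage_emb
    (measurableEmbedding_addLeft s) f (Set.Ioi s)
  simpa using h.symm

/-- The Markov property at time s, applied to each later time and integrated by Tonelli: by
`lintegral_expRate_mul_transitionKernel` and the memorylessness of the exponential law, the zeros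
after s contribute e^{-q²s/2} φ_q(R_s). -/
theorem IsBesselNegOne.setLIntegral_zeroTimes (h : IsBesselNegOne R x P) {q : ℝ} (hq : 0 < q)
    {s : ℝ≥0} {A : Set Ω} (hA : MeasurableSet[pathSigma R s] A) :
    ∫⁻ ω in A, zeroTimes q (R ω) (Set.Ioi 0) ∂P =
      ∫⁻ ω in A, (zeroTimes q (R ω) (Set.Ioc 0 s) +
        ENNReal.ofReal (Real.exp (-q ^ 2 * s / 2)) *
          ENNReal.ofReal (absorptionLaplace q (R ω s))) ∂P := by
  have := h.isProbabilityMeasure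
  have hm := measurable_zeroTimes_integrand h.measurable q
  have hm1 : ∀ I : Set ℝ, Measurable fun ω => zeroTimes q (R ω) I := fun I =>
    Measurable.lintegral_prod_right' (ν := volume.restrict I) hm
  have e1 : ∀ ω, zeroTimes q (R ω) (Set.Ioi 0) =
      zeroTimes q (R ω) (Set.Ioc 0 s) + zeroTimes q (R ω) (Set.Ioi s) := fun ω => by
    unfold zeroTimes
    rw [← lintegral_union measurableSet_Ioi Set.Ioc_disjoint_Ioi_same,
      Set.Ioc_union_Ioi_eq_Ioi (NNReal.coe_nonneg s)]
  simp_rw [e1]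
  rw [lintegral_add_left (hm1 _), lintegral_add_left (hm1 _)]
  congr 1
  have hmR := measurable_apply h.measurable s
  have hmK : Measurable fun p : Ω × ℝ => expRate q (s + p.2) *
      transitionKernel p.2.toNNReal (R p.1 s) {0} := by
    exact Measurable.mul (by fun_prop) (measurable_transitionKernel_singleton
      measurable_snd.real_toNNReal (hmR.comp measurable_fst))
  calc _ = ∫⁻ ω in A, (∫⁻ t in Set.Ioi (0 : ℝ), expRate q (s + t) *
        zeroIndicator (R ω) (s + t)) ∂P := by
        unfold zeroTimes
        simp_rw [setLIntegral_Ioi_eq_add (s : ℝ)]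
    _ = ∫⁻ t in Set.Ioi (0 : ℝ), ∫⁻ ω in A, expRate q (s + t) *
        zeroIndicator (R ω) (s + t) ∂P := by
        have hm' : Measurable (Function.uncurry fun (ω : Ω) (t : ℝ) =>
            expRate q (s + t) * zeroIndicator (R ω) (s + t)) :=
          hm.comp (g := fun p : Ω × ℝ => expRate q p.2 * zeroIndicator (R p.1) p.2)
            (f := fun p : Ω × ℝ => (p.1, s + p.2))
            (measurable_fst.prodMk (measurable_snd.const_add (s : ℝ)))
        exact lintegral_lintegral_swap hm'.aemeasurable
    _ = ∫⁻ t in Set.Ioi (0 : ℝ), ∫⁻ ω in A, expRate q (s + t) *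
        transitionKernel t.toNNReal (R ω s) {0} ∂P := by
        refine setLIntegral_congr_fun measurableSet_Ioi fun t ht => ?_
        have ht : 0 < t := ht
        have hmi : Measurable (({0} : Set ℝ≥0).indicator (1 : ℝ≥0 → ℝ≥0∞)) :=
          measurable_one.indicator (measurableSet_singleton 0)
        have e : (s + t : ℝ).toNNReal = s + t.toNNReal := by
          rw [Real.toNNReal_add (NNReal.coe_nonneg s) ht.le, Real.toNNReal_coe]
        simp only [zeroIndicator, e]
        rw [lintegral_const_mul _ (show Measurable fun ω =>
            ({0} : Set ℝ≥0).indicator (1 : ℝ≥0 → ℝ≥0∞) (R ω (s + t.toNNReal)) from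
              hmi.comp (measurable_apply h.measurable _)),
          h.setLIntegral_markov (Real.toNNReal_pos.2 ht) hA hmi, lintegral_const_mul]
        · simp only [lintegral_indicator_one (measurableSet_singleton (0 : ℝ≥0))]
        · exact measurable_transitionKernel_singleton measurable_const hmR
    _ = ∫⁻ ω in A, (∫⁻ t in Set.Ioi (0 : ℝ), expRate q (s + t) *
        transitionKernel t.toNNReal (R ω s) {0}) ∂P := by
        exact (lintegral_lintegral_swap hmK.aemeasurable).symm
    _ = _ := by
        refine lintegral_congr fun ω => ?_
        simp_rw [expRate_add, mul_assoc]
        rw [lintegral_const_mul, lintegral_expRate_mul_transitionKernel hq]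
        refine Measurable.mul (by fun_prop) ?_
        exact measurable_transitionKernel_singleton
          measurable_id.real_toNNReal measurable_const

/-- Before the passage time the path is above ε, hence positive, so zeros lie in [τ, u], and the
exponential density is at most q²/2. The bound vanishes as u decreases to τ. -/
theorem zeroTimes_Ioc_le {q : ℝ} {w : C(ℝ≥0, ℝ≥0)} (hw : ε < w 0) {u τ : ℝ≥0}
    (hT : τ ≤ passageTime ε w) :
    zeroTimes q w (Set.Ioc 0 u) ≤ ENNReal.ofReal (q ^ 2 / 2 * (u - τ)) := by
  have hpt : ∀ t ∈ Set.Ioc (0 : ℝ) u,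
      expRate q t * zeroIndicator w t ≤
        (Set.Icc (τ : ℝ) u).indicator (fun _ => ENNReal.ofReal (q ^ 2 / 2)) t := by
    intro t ht
    by_cases hz : w t.toNNReal = 0
    · have h1 : (τ : ℝ) ≤ t := by
        by_contra hlt
        push Not at hlt
        have h2 : (t.toNNReal : ℝ≥0∞) < passageTime ε w := by
          refine lt_of_lt_of_le ?_ hT
          rw [ENNReal.coe_lt_coe, ← NNReal.coe_lt_coe, Real.coe_toNNReal _ ht.1.le]
          exact hlt
        have h3 := (lt_passageTime_iff hw).1 h2 _ le_rfl
        rw [hz] at h3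
        exact not_lt_zero h3
      rw [Set.indicator_of_mem (show t ∈ Set.Icc (τ : ℝ) u from ⟨h1, ht.2⟩), zeroIndicator, hz]
      simp only [Set.mem_singleton_iff, Set.indicator_of_mem, Pi.one_apply, mul_one]
      unfold expRate
      refine ENNReal.ofReal_le_ofReal (mul_le_of_le_one_right (by positivity) ?_)
      rw [Real.exp_le_one_iff]
      nlinarith [mul_nonneg (sq_nonneg q) ht.1.le]
    · simp [zeroIndicator, hz]
  unfold zeroTimes
  calc _ ≤ ∫⁻ t in Set.Ioc (0 : ℝ) u,
        (Set.Icc (τ : ℝ) u).indicator (fun _ => ENNReal.ofReal (q ^ 2 / 2)) t :=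
        setLIntegral_mono' measurableSet_Ioc hpt
    _ ≤ ∫⁻ t, (Set.Icc (τ : ℝ) u).indicator (fun _ => ENNReal.ofReal (q ^ 2 / 2)) t :=
        setLIntegral_le_lintegral _ _
    _ = _ := by
        rw [lintegral_indicator_const measurableSet_Icc, Real.volume_Icc,
          ← ENNReal.ofReal_mul (by positivity)]

theorem zeroTimes_Ioi_eq_zero {q : ℝ} {w : C(ℝ≥0, ℝ≥0)} (hw : ε < w 0)
    (hT : passageTime ε w = ∞) : zeroTimes q w (Set.Ioi 0) = 0 := by
  unfold zeroTimes
  rw [lintegral_eq_zero_of_ae_eq_zero]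
  refine ae_of_all _ fun t => ?_
  have := (lt_passageTime_iff (s := t.toNNReal) hw).1 (by rw [hT]; exact ENNReal.coe_lt_top) _ le_rfl
  simp [zeroIndicator, (pos_of_gt this).ne']

end

section

variable {Ω : Type*} {R : Ω → C(ℝ≥0, ℝ≥0)} {x ε : ℝ≥0} [MeasurableSpace Ω] {P : Measure Ω}

/-- The conditional mean, given the path `w` up to time `u`, of the rate-`q² / 2` exponential mass
of the zeros of `w`. -/
def zeroTimesMean (q : ℝ) (w : C(ℝ≥0, ℝ≥0)) (u : ℝ≥0) : ℝ≥0∞ :=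
  zeroTimes q w (Set.Ioc 0 u) + ENNReal.ofReal (Real.exp (-q ^ 2 * u / 2)) *
    ENNReal.ofReal (absorptionLaplace q (w u))

theorem measurable_zeroTimesMean (hR : Measurable R) (q : ℝ) {τ : Ω → ℝ≥0} (hτ : Measurable τ) :
    Measurable fun ω => zeroTimesMean q (R ω) (τ ω) := by
  unfold zeroTimesMean
  have h1 : Measurable fun ω => R ω (τ ω) :=
    (measurable_uncurry_path hR).comp (hτ.prodMk measurable_id)
  have h2 : Measurable fun ω => absorptionLaplace q (R ω (τ ω)) :=
    (continuous_absorptionLaplace q).measurable.comp h1.coe_nnreal_real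
  refine Measurable.add ?_ (by fun_prop)
  have e : ∀ ω, zeroTimes q (R ω) (Set.Ioc 0 (τ ω)) = ∫⁻ t in Set.Ioi (0 : ℝ),
      {p : Ω × ℝ | p.2 ≤ τ p.1}.indicator
        (fun p => expRate q p.2 * zeroIndicator (R p.1) p.2) (ω, t) := fun ω => by
    unfold zeroTimes
    rw [← Set.Ioi_inter_Iic, Set.inter_comm, ← setLIntegral_indicator measurableSet_Iic]
    rfl
  simp_rw [e]
  refine Measurable.lintegral_prod_right' (ν := volume.restrict (Set.Ioi (0 : ℝ)))
    ((measurable_zeroTimes_integrand hR q).indicator ?_)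
  exact measurableSet_le measurable_snd (by fun_prop)

theorem zeroTimesMean_le {q : ℝ} (hq : 0 < q) (w : C(ℝ≥0, ℝ≥0)) (u : ℝ≥0) :
    zeroTimesMean q w u ≤ 2 := by
  rw [show (2 : ℝ≥0∞) = 1 + 1 by norm_num]
  refine add_le_add ?_ ?_
  · calc _ ≤ ∫⁻ t in Set.Ioi (0 : ℝ), expRate q t := by
          refine (lintegral_mono fun t => ?_).trans (lintegral_mono_set Set.Ioc_subset_Ioi_self)
          refine mul_le_of_le_one_right zero_le ?_
          unfold zeroIndicator
          exact Set.indicator_le_self' (fun _ _ => zero_le) _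
      _ = 1 := by rw [lintegral_expRate hq]; simp
  · rw [← ENNReal.ofReal_mul (Real.exp_pos _).le]
    refine ENNReal.ofReal_le_one.2 (mul_le_one₀ ?_ (absorptionLaplace_pos hq.le (w u).2).le
      (absorptionLaplace_le_one _ _))
    rw [Real.exp_le_one_iff]
    have : 0 ≤ q ^ 2 * (u : ℝ) := by positivity
    linarith

theorem IsBesselNegOne.lt_start (h : IsBesselNegOne R x P) (hx : ε < x) : ∀ᵐ ω ∂P, ε < R ω 0 := by
  filter_upwards [h.start] with ω hω
  rwa [hω]

/-! ### Optional stopping along grids and the law of the passage time -/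

/-- The smallest point of the grid `s + ℕ / (n + 1)` which is at least the passage time `τ`. -/
def gridCeil (s : ℝ≥0) (n : ℕ) (τ : ℝ≥0) : ℝ≥0 := s + ⌈(τ - s) * (n + 1)⌉₊ / (n + 1)

theorem measurable_gridCeil (s : ℝ≥0) (n : ℕ) : Measurable (gridCeil s n) := by
  unfold gridCeil
  have : Measurable fun r : ℝ≥0 => ((⌈r⌉₊ : ℕ) : ℝ≥0) :=
    (measurable_from_nat (f := fun n : ℕ => (n : ℝ≥0))).comp Nat.measurable_ceil
  fun_prop

theorem gridCeil_eq {s : ℝ≥0} {n k : ℕ} {τ : ℝ≥0} (h1 : s + k / (n + 1) < τ)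
    (h2 : τ ≤ s + (k + 1 : ℕ) / (n + 1)) : gridCeil s n τ = s + (k + 1 : ℕ) / (n + 1) := by
  unfold gridCeil
  have hn : (0 : ℝ≥0) < n + 1 := by positivity
  have : ⌈(τ - s) * (n + 1)⌉₊ = k + 1 := by
    rw [Nat.ceil_eq_iff (Nat.succ_ne_zero k), ← div_lt_iff₀ hn, ← le_div_iff₀ hn]
    exact ⟨lt_tsub_iff_left.2 h1, tsub_le_iff_left.2 h2⟩
  rw [this]

theorem le_gridCeil {s : ℝ≥0} (n : ℕ) (τ : ℝ≥0) : τ ≤ gridCeil s n τ := by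
  unfold gridCeil
  rw [← tsub_le_iff_left, le_div_iff₀ (by positivity)]
  exact Nat.le_ceil _

theorem gridCeil_le {s : ℝ≥0} (n : ℕ) {τ : ℝ≥0} (hs : s ≤ τ) :
    gridCeil s n τ ≤ τ + 1 / (n + 1) := by
  unfold gridCeil
  have hn : (0 : ℝ≥0) < n + 1 := by positivity
  have h := (Nat.ceil_lt_add_one (show 0 ≤ (τ - s) * (n + 1) from zero_le)).le
  calc _ ≤ s + ((τ - s) * (n + 1) + 1) / (n + 1) := by gcongr
    _ = s + (τ - s) + 1 / (n + 1) := by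
      rw [add_div, mul_div_assoc, div_self hn.ne', mul_one, add_assoc]
    _ = _ := by rw [add_tsub_cancel_of_le hs]

theorem tendsto_gridCeil {s τ : ℝ≥0} (hs : s ≤ τ) :
    Tendsto (fun n => gridCeil s n τ) atTop (𝓝 τ) := by
  refine tendsto_of_tendsto_of_tendsto_of_le_of_le tendsto_const_nhds ?_
    (fun n => le_gridCeil n τ) (fun n => gridCeil_le n hs)
  have h : Tendsto (fun n : ℕ => 1 / ((n : ℝ≥0) + 1)) atTop (𝓝 0) :=
    tendsto_one_div_add_atTop_nhds_zero_nat
  simpa using h.const_add τ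

theorem exists_grid_mem {s τ : ℝ≥0} (n : ℕ) (hs : s < τ) :
    ∃ k : ℕ, s + k / (n + 1) < τ ∧ τ ≤ s + (k + 1 : ℕ) / (n + 1) := by
  have hn : (0 : ℝ≥0) < n + 1 := by positivity
  have hpos : 0 < ⌈(τ - s) * (n + 1)⌉₊ := Nat.ceil_pos.2 (mul_pos (tsub_pos_of_lt hs) hn)
  obtain ⟨k, hk⟩ := Nat.exists_eq_succ_of_ne_zero hpos.ne'
  refine ⟨k, ?_, ?_⟩
  · have := Nat.lt_ceil.1 (show k < ⌈(τ - s) * (n + 1)⌉₊ by omega)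
    rw [← div_lt_iff₀ hn] at this
    exact lt_tsub_iff_left.1 this
  · have := Nat.le_ceil ((τ - s) * (n + 1))
    rw [hk, ← le_div_iff₀ hn] at this
    exact tsub_le_iff_left.1 this

/-- The Laplace transform of the passage time after `s`, on an event of the past of `s`. -/
theorem IsBesselNegOne.laplace_passageTime (h : IsBesselNegOne R x P) (hx : ε < x) {q : ℝ}
    (hq : 0 < q) {s : ℝ≥0} {A : Set Ω} (hA : MeasurableSet[pathSigma R s] A) :
    (∫⁻ ω in A ∩ alive R ε s ∩ {ω | passageTime ε (R ω) ≠ ∞},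
        ENNReal.ofReal (Real.exp (-q ^ 2 * (passageTime ε (R ω)).toNNReal / 2)) ∂P) *
        ENNReal.ofReal (absorptionLaplace q ε) =
      ∫⁻ ω in A ∩ alive R ε s, ENNReal.ofReal (Real.exp (-q ^ 2 * s / 2)) *
        ENNReal.ofReal (absorptionLaplace q (R ω s)) ∂P := by
  have := h.isProbabilityMeasure
  have h0 := h.lt_start hx
  have hTm : Measurable fun ω => passageTime ε (R ω) :=
    (measurable_passageTime ε).comp h.measurable
  have hAs : MeasurableSet[pathSigma R s] (A ∩ alive R ε s) :=
    hA.inter (measurableSet_alive R ε s)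
  have hAs' := pathSigma_le h.measurable s _ hAs
  set D := {ω | passageTime ε (R ω) ≠ ∞} with hD
  have hDm : MeasurableSet D := hTm (measurableSet_singleton ∞).compl
  set E := A ∩ alive R ε s ∩ D with hE
  have hEm : MeasurableSet E := hAs'.inter hDm
  set T := fun ω => (passageTime ε (R ω)).toNNReal with hT
  have hTm' : Measurable T := hTm.ennreal_toNNReal
  have hTs : ∀ ω ∈ E, s < T ω := fun ω hω => by
    have h1 : (s : ℝ≥0∞) < passageTime ε (R ω) := hω.1.2
    rw [← ENNReal.coe_toNNReal hω.2] at h1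
    exact_mod_cast h1
  have hcoe : ∀ ω ∈ E, passageTime ε (R ω) = T ω := fun ω hω => (ENNReal.coe_toNNReal hω.2).symm
  -- Optional stopping at a time with countably many values: on the cell B k the discretised passage
  -- time is g (k + 1), and B k belongs to the past of g (k + 1).
  have hgrid : ∀ n : ℕ, ∫⁻ ω in A ∩ alive R ε s, zeroTimes q (R ω) (Set.Ioi 0) ∂P =
      ∫⁻ ω in E, zeroTimesMean q (R ω) (gridCeil s n (T ω)) ∂P := by
    intro n
    set g : ℕ → ℝ≥0 := fun k => s + k / (n + 1) with hg
    have hgm : ∀ k, s ≤ g k := fun k => le_self_add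
    have hgs : ∀ k, g k ≤ g (k + 1) := fun k => by
      simp only [hg]; gcongr; omega
    set B : ℕ → Set Ω := fun k => A ∩ (alive R ε (g k) \ alive R ε (g (k + 1))) with hB
    have hBm : ∀ k, MeasurableSet[pathSigma R (g (k + 1))] (B k) := fun k =>
      (pathSigma_mono R (hgm _) _ hA).inter
        ((pathSigma_mono R (hgs k) _ (measurableSet_alive R ε (g k))).diff
          (measurableSet_alive R ε _))
    have hBm' : ∀ k, MeasurableSet (B k) := fun k => pathSigma_le h.measurable _ _ (hBm k)
    have hBE : ∀ k, ∀ ω ∈ B k, ω ∈ E ∧ g k < T ω ∧ T ω ≤ g (k + 1) := fun k ω hω => by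
      have h2 : passageTime ε (R ω) ≤ g (k + 1) := not_lt.1 hω.2.2
      have h3 : (g k : ℝ≥0∞) < passageTime ε (R ω) := hω.2.1
      have hne : passageTime ε (R ω) ≠ ∞ := (h2.trans_lt ENNReal.coe_lt_top).ne
      refine ⟨⟨⟨hω.1, alive_anti R ε (hgm k) hω.2.1⟩, hne⟩, ?_, ?_⟩
      · rw [← ENNReal.coe_toNNReal hne] at h3; exact_mod_cast h3
      · rw [← ENNReal.coe_toNNReal hne] at h2; exact_mod_cast h2
    have hU : E = ⋃ k, B k := by
      ext ω
      rw [Set.mem_iUnion]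
      refine ⟨fun hω => ?_, fun ⟨k, hk⟩ => (hBE k ω hk).1⟩
      obtain ⟨k, hk1, hk2⟩ := exists_grid_mem n (hTs ω hω)
      refine ⟨k, hω.1.1, ?_, ?_⟩
      · change ((g k : ℝ≥0) : ℝ≥0∞) < _
        rw [hcoe ω hω]; exact ENNReal.coe_lt_coe.2 hk1
      · change ¬ ((g (k + 1) : ℝ≥0) : ℝ≥0∞) < _
        rw [hcoe ω hω, not_lt]; exact ENNReal.coe_le_coe.2 hk2
    have hdis : Pairwise (Function.onFun Disjoint B) := by
      intro i j hij
      refine Set.disjoint_left.2 fun ω hi hj => hij ?_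
      obtain ⟨-, h1, h2⟩ := hBE i ω hi
      obtain ⟨-, h3, h4⟩ := hBE j ω hj
      have e1 := gridCeil_eq h1 h2
      have e2 := gridCeil_eq h3 h4
      rw [e1] at e2
      have hn : (n + 1 : ℝ≥0) ≠ 0 := by positivity
      have := add_left_cancel e2
      rw [div_left_inj' hn] at this
      have : i + 1 = j + 1 := by exact_mod_cast this
      omega
    -- Paths that never reach ε have no zeros and may be discarded.
    have e1 : ∫⁻ ω in A ∩ alive R ε s, zeroTimes q (R ω) (Set.Ioi 0) ∂P =
        ∫⁻ ω in E, zeroTimes q (R ω) (Set.Ioi 0) ∂P := by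
      rw [hE, Set.inter_comm _ D, ← setLIntegral_indicator hDm]
      refine lintegral_congr_ae ?_
      filter_upwards [ae_restrict_of_ae h0] with ω hω
      by_cases hωD : ω ∈ D
      · rw [Set.indicator_of_mem hωD]
      · rw [Set.indicator_of_notMem hωD]
        exact zeroTimes_Ioi_eq_zero hω (not_not.1 hωD)
    rw [e1, hU, lintegral_iUnion hBm' hdis, lintegral_iUnion hBm' hdis]
    refine tsum_congr fun k => ?_
    rw [h.setLIntegral_zeroTimes hq (hBm k)]
    refine setLIntegral_congr_fun (hBm' k) fun ω hω => ?_
    obtain ⟨-, h1, h2⟩ := hBE k ω hω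
    simp only [gridCeil_eq h1 h2]
    rfl
  -- As the grid is refined, the discretised time decreases to T, the mass of the zeros before it
  -- tends to 0, and the position tends to R_T = ε.
  have hlim : Tendsto (fun n : ℕ => ∫⁻ ω in E, zeroTimesMean q (R ω) (gridCeil s n (T ω)) ∂P) atTop
      (𝓝 (∫⁻ ω in E, ENNReal.ofReal (Real.exp (-q ^ 2 * T ω / 2)) *
        ENNReal.ofReal (absorptionLaplace q ε) ∂P)) := by
    refine tendsto_lintegral_of_dominated_convergence (fun _ => 2)
      (fun n => measurable_zeroTimesMean h.measurable q ((measurable_gridCeil s n).comp hTm'))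
      (fun n => ae_of_all _ fun ω => zeroTimesMean_le hq _ _) ?_ ?_
    · rw [lintegral_const]
      exact ENNReal.mul_ne_top (by norm_num) (measure_ne_top _ _)
    · filter_upwards [ae_restrict_of_ae h0, ae_restrict_mem hEm] with ω hω hωE
      have hτ := tendsto_gridCeil (hTs ω hωE).le
      have hτ' : Tendsto (fun n => (gridCeil s n (T ω) : ℝ)) atTop (𝓝 (T ω : ℝ)) :=
        (NNReal.continuous_coe.tendsto _).comp hτ
      rw [← zero_add (ENNReal.ofReal _ * _)]
      refine Tendsto.add ?_ ?_
      · have hb : Tendsto (fun n : ℕ => ENNReal.ofReal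
            (q ^ 2 / 2 * ((gridCeil s n (T ω) : ℝ) - T ω))) atTop (𝓝 0) := by
          have := (hτ'.sub_const (T ω : ℝ)).const_mul (q ^ 2 / 2)
          rw [sub_self, mul_zero] at this
          simpa using ENNReal.tendsto_ofReal this
        exact tendsto_of_tendsto_of_tendsto_of_le_of_le tendsto_const_nhds hb
          (fun n => zero_le) fun n => zeroTimes_Ioc_le hω (hcoe ω hωE).ge
      · rw [← ENNReal.ofReal_mul (Real.exp_pos _).le]
        simp_rw [← ENNReal.ofReal_mul (Real.exp_pos _).le]
        refine ENNReal.tendsto_ofReal (Tendsto.mul ?_ ?_)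
        · exact (Real.continuous_exp.tendsto _).comp ((hτ'.const_mul (-q ^ 2)).div_const 2)
        · have h1 : Tendsto (fun n => R ω (gridCeil s n (T ω))) atTop (𝓝 (R ω (T ω))) :=
            ((R ω).continuous.tendsto _).comp hτ
          rw [show R ω (T ω) = ε from apply_passageTime hωE.2] at h1
          exact ((continuous_absorptionLaplace q).tendsto _).comp
            ((NNReal.continuous_coe.tendsto _).comp h1)
  -- The left-hand side of `hgrid` does not depend on n, so it equals the limit; conditioning the
  -- same quantity at time s gives the right-hand side of the theorem.
  have hconst := tendsto_nhds_unique (hlim.congr fun n => (hgrid n).symm) tendsto_const_nhds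
  rw [← lintegral_mul_const _ (by fun_prop), hconst, h.setLIntegral_zeroTimes hq hAs]
  refine lintegral_congr_ae ?_
  filter_upwards [ae_restrict_of_ae h0, ae_restrict_mem hAs'] with ω hω hωA
  have h1 := zeroTimes_Ioc_le (q := q) (u := s) hω (show (s : ℝ≥0∞) ≤ _ from le_of_lt hωA.2)
  rw [sub_self, mul_zero, ENNReal.ofReal_zero] at h1
  rw [le_antisymm h1 zero_le, zero_add]

/-- `r_t(y, ε)` with values in `[0, ∞]`. -/
def passageDensityNN (ε t y : ℝ≥0) : ℝ≥0∞ := ENNReal.ofReal (passageDensity t y ε)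

@[fun_prop]
theorem measurable_passageDensityNN {α : Type*} [MeasurableSpace α] {f g : α → ℝ≥0} (ε : ℝ≥0)
    (hf : Measurable f) (hg : Measurable g) :
    Measurable fun a => passageDensityNN ε (f a) (g a) := by
  unfold passageDensityNN; fun_prop

theorem laplace_passageDensityNN {q : ℝ} (hq : 0 ≤ q) {y : ℝ≥0} (hy : ε < y) :
    ∫⁻ t, ENNReal.ofReal (Real.exp (-q ^ 2 * t / 2)) * passageDensityNN ε t y ∂lebNN =
      ENNReal.ofReal (absorptionLaplace q y / absorptionLaplace q ε) := by
  have h := laplace_passageDensity (a := (y : ℝ) - ε) hq (sub_pos.2 (NNReal.coe_lt_coe.2 hy)) (NNReal.coe_nonneg ε)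
  rw [sub_add_cancel] at h
  rw [lintegral_lebNN (by fun_prop)]
  refine Eq.trans ?_ h
  refine setLIntegral_congr_fun measurableSet_Ioi fun t ht => ?_
  have ht : 0 < t := ht
  simp only [passageDensityNN, Real.coe_toNNReal _ ht.le]
  rw [ENNReal.ofReal_mul (Real.exp_pos _).le]

/-- Both measures have the same Laplace transform: the left one by
`IsBesselNegOne.laplace_passageTime`, the right one by Tonelli and the transform of r. Stated for
every event A of the past, this is the conditional law of T_ε - s given the past of s. -/
theorem IsBesselNegOne.map_passageTime_sub (h : IsBesselNegOne R x P) (hx : ε < x)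
    {s : ℝ≥0} {A : Set Ω} (hA : MeasurableSet[pathSigma R s] A) :
    (P.restrict (A ∩ alive R ε s ∩ {ω | passageTime ε (R ω) ≠ ∞})).map
        (fun ω => (passageTime ε (R ω)).toNNReal - s) =
      lebNN.withDensity fun t => ∫⁻ ω in A ∩ alive R ε s, passageDensityNN ε t (R ω s) ∂P := by
  have := h.isProbabilityMeasure
  have h0 := h.lt_start hx
  have hTm : Measurable fun ω => passageTime ε (R ω) :=
    (measurable_passageTime ε).comp h.measurable
  have hAs' := pathSigma_le h.measurable s _ (hA.inter (measurableSet_alive R ε s))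
  have hRm := measurable_apply h.measurable s
  have hdm : Measurable fun p : ℝ≥0 × Ω => passageDensityNN ε p.1 (R p.2 s) :=
    measurable_passageDensityNN ε measurable_fst (hRm.comp measurable_snd)
  have hdm' : Measurable fun t => ∫⁻ ω in A ∩ alive R ε s, passageDensityNN ε t (R ω s) ∂P :=
    Measurable.lintegral_prod_right' (ν := P.restrict (A ∩ alive R ε s)) hdm
  have key : ∀ q : ℝ, 0 ≤ q → ∫⁻ t, ENNReal.ofReal (Real.exp (-q ^ 2 * t / 2))
      ∂(lebNN.withDensity fun t => ∫⁻ ω in A ∩ alive R ε s, passageDensityNN ε t (R ω s) ∂P) =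
      ∫⁻ ω in A ∩ alive R ε s,
        ENNReal.ofReal (absorptionLaplace q (R ω s) / absorptionLaplace q ε) ∂P := by
    intro q hq
    rw [lintegral_withDensity_eq_lintegral_mul _ hdm' (by fun_prop)]
    calc _ = ∫⁻ t, ∫⁻ ω in A ∩ alive R ε s, ENNReal.ofReal (Real.exp (-q ^ 2 * t / 2)) *
          passageDensityNN ε t (R ω s) ∂P ∂lebNN := by
          refine lintegral_congr fun t => ?_
          rw [lintegral_const_mul _ (by fun_prop), Pi.mul_apply, mul_comm]
      _ = ∫⁻ ω in A ∩ alive R ε s, (∫⁻ t, ENNReal.ofReal (Real.exp (-q ^ 2 * t / 2)) *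
          passageDensityNN ε t (R ω s) ∂lebNN) ∂P := by
          refine lintegral_lintegral_swap (Measurable.aemeasurable ?_)
          exact Measurable.mul (by fun_prop) hdm
      _ = _ := by
          refine lintegral_congr_ae ?_
          filter_upwards [ae_restrict_of_ae h0, ae_restrict_mem hAs'] with ω hω hωA
          exact laplace_passageDensityNN hq (lt_of_mem_alive hω hωA.2)
  -- Finiteness, required for uniqueness, is the computation of the transform at q = 0.
  have hfin : IsFiniteMeasure (lebNN.withDensity fun t =>
      ∫⁻ ω in A ∩ alive R ε s, passageDensityNN ε t (R ω s) ∂P) := by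
    refine ⟨?_⟩
    have := key 0 le_rfl
    simp [absorptionLaplace] at this
    simp [this]
  refine ext_of_laplace fun q hq => ?_
  have hpos := absorptionLaplace_pos hq.le (NNReal.coe_nonneg ε)
  rw [key q hq.le, lintegral_map (by fun_prop) (hTm.ennreal_toNNReal.sub_const s)]
  have hL := h.laplace_passageTime hx hq hA
  have hne : ENNReal.ofReal (absorptionLaplace q ε) ≠ 0 := by simpa using hpos
  simp_rw [ENNReal.ofReal_div_of_pos hpos, div_eq_mul_inv]
  have habs : Measurable fun ω => ENNReal.ofReal (absorptionLaplace q (R ω s)) := by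
    have := (continuous_absorptionLaplace q).measurable
    fun_prop
  rw [lintegral_mul_const _ habs, ← div_eq_mul_inv, ENNReal.eq_div_iff hne ENNReal.ofReal_ne_top]
  rw [lintegral_const_mul _ habs] at hL
  have hexp : ENNReal.ofReal (Real.exp (-q ^ 2 * s / 2)) ≠ 0 := by simpa using Real.exp_pos _
  -- The factor e^{-q²s/2} turns the transform of T - s into that of T.
  rw [← ENNReal.mul_right_inj hexp ENNReal.ofReal_ne_top, ← hL, mul_left_comm, mul_comm]
  congr 1
  rw [← lintegral_const_mul _ (by fun_prop)]
  refine lintegral_congr_ae ?_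
  have hEm := hAs'.inter (hTm (measurableSet_singleton ∞).compl)
  filter_upwards [ae_restrict_mem hEm] with ω hω
  rw [← ENNReal.ofReal_mul (Real.exp_pos _).le, ← Real.exp_add]
  congr 2
  have hs : s ≤ (passageTime ε (R ω)).toNNReal := by
    have h1 : (s : ℝ≥0∞) < passageTime ε (R ω) := hω.1.2
    rw [← ENNReal.coe_toNNReal hω.2] at h1
    exact_mod_cast h1.le
  rw [NNReal.coe_sub hs]
  ring

theorem IsBesselNegOne.ae_mem_alive_zero (h : IsBesselNegOne R x P) (hx : ε < x) :
    ∀ᵐ ω ∂P, ω ∈ alive R ε 0 := by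
  filter_upwards [h.lt_start hx] with ω hω
  exact (lt_passageTime_iff hω).2 fun u hu => by rwa [le_antisymm hu zero_le]

theorem lintegral_passageDensityNN {y : ℝ≥0} (hy : ε < y) :
    ∫⁻ t, passageDensityNN ε t y ∂lebNN = 1 := by
  have := laplace_passageDensityNN (q := 0) le_rfl hy
  simpa [absorptionLaplace] using this

/-- Taking s = 0, the part of the law carried by finite passage times has density r(x, ε), whose
total mass is already 1. -/
theorem IsBesselNegOne.passageTime_ne_top (h : IsBesselNegOne R x P) (hx : ε < x) :
    ∀ᵐ ω ∂P, passageTime ε (R ω) ≠ ∞ := by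
  have := h.isProbabilityMeasure
  have hTm : Measurable fun ω => passageTime ε (R ω) :=
    (measurable_passageTime ε).comp h.measurable
  have h1 := congrArg (fun μ : Measure ℝ≥0 => μ Set.univ)
    (h.map_passageTime_sub hx (s := 0) (A := Set.univ) MeasurableSet.univ)
  have h2 : P.restrict (Set.univ ∩ alive R ε 0) = P := by
    rw [Set.univ_inter, Measure.restrict_eq_self_of_ae_mem (h.ae_mem_alive_zero hx)]
  simp only [tsub_zero, h2] at h1
  rw [Measure.map_apply hTm.ennreal_toNNReal MeasurableSet.univ, Set.preimage_univ,
    withDensity_apply _ MeasurableSet.univ, Measure.restrict_univ,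
    Measure.restrict_apply MeasurableSet.univ, Set.univ_inter] at h1
  have h3 : ∫⁻ t, ∫⁻ ω, passageDensityNN ε t (R ω 0) ∂P ∂lebNN = 1 := by
    rw [← lintegral_passageDensityNN hx]
    refine lintegral_congr fun t => ?_
    rw [lintegral_congr_ae (g := fun _ => passageDensityNN ε t x)
      (by filter_upwards [h.start] with ω hω; rw [hω])]
    simp
  rw [h3] at h1
  have h4 : P {ω | passageTime ε (R ω) ≠ ∞} = 1 :=
    le_antisymm prob_le_one (h1.symm.le.trans (measure_mono Set.inter_subset_right))
  exact (prob_compl_eq_zero_iff (hTm (measurableSet_singleton ∞).compl)).2 h4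

/-- The conditional law of the passage time given the path up to time `s`. -/
theorem IsBesselNegOne.lintegral_passageTime (h : IsBesselNegOne R x P) (hx : ε < x)
    {s : ℝ≥0} {A : Set Ω} (hA : MeasurableSet[pathSigma R s] A) {f : ℝ≥0 → ℝ≥0∞}
    (hf : Measurable f) :
    ∫⁻ ω in A ∩ alive R ε s, f (passageTime ε (R ω)).toNNReal ∂P =
      ∫⁻ t, f (s + t) * ∫⁻ ω in A ∩ alive R ε s, passageDensityNN ε t (R ω s) ∂P ∂lebNN := by
  have := h.isProbabilityMeasure
  have hTm : Measurable fun ω => passageTime ε (R ω) :=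
    (measurable_passageTime ε).comp h.measurable
  have hAs' := pathSigma_le h.measurable s _ (hA.inter (measurableSet_alive R ε s))
  have hRm := measurable_apply h.measurable s
  have hdm' : Measurable fun t => ∫⁻ ω in A ∩ alive R ε s, passageDensityNN ε t (R ω s) ∂P :=
    Measurable.lintegral_prod_right' (ν := P.restrict (A ∩ alive R ε s))
      (f := fun p : ℝ≥0 × Ω => passageDensityNN ε p.1 (R p.2 s))
      (measurable_passageDensityNN ε measurable_fst (hRm.comp measurable_snd))
  have hfs : Measurable fun t => f (s + t) := by fun_prop
  have h1 := congrArg (fun μ : Measure ℝ≥0 => ∫⁻ t, f (s + t) ∂μ)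
    (h.map_passageTime_sub hx hA)
  rw [lintegral_map hfs (hTm.ennreal_toNNReal.sub_const s),
    lintegral_withDensity_eq_lintegral_mul _ hdm' hfs] at h1
  have hne := h.passageTime_ne_top hx
  have h2 : (A ∩ alive R ε s ∩ {ω | passageTime ε (R ω) ≠ ∞} : Set Ω) =ᵐ[P] (A ∩ alive R ε s : Set Ω) :=
    inter_ae_eq_left_of_ae_eq_univ (eventuallyEq_univ.2 hne)
  rw [setLIntegral_congr h2] at h1
  simp only [Pi.mul_apply, mul_comm _ (f _)] at h1
  rw [← h1]
  refine lintegral_congr_ae ?_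
  filter_upwards [ae_restrict_mem hAs', ae_restrict_of_ae hne] with ω hω hωne
  have hs : s ≤ (passageTime ε (R ω)).toNNReal := by
    have h1 : (s : ℝ≥0∞) < passageTime ε (R ω) := hω.2
    rw [← ENNReal.coe_toNNReal hωne] at h1
    exact_mod_cast h1.le
  rw [add_tsub_cancel_of_le hs]

theorem IsBesselNegOne.hasLaw_passageTime (h : IsBesselNegOne R x P) (hx : ε < x) :
    HasLaw (fun ω => (passageTime ε (R ω)).toNNReal)
      (lebNN.withDensity fun t => ENNReal.ofReal (passageDensity t x ε)) P := by
  have := h.isProbabilityMeasure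
  have hTm : Measurable fun ω => passageTime ε (R ω) :=
    (measurable_passageTime ε).comp h.measurable
  refine ⟨hTm.ennreal_toNNReal.aemeasurable, ?_⟩
  have h1 := h.map_passageTime_sub hx (s := 0) (A := Set.univ) MeasurableSet.univ
  have h2 : P.restrict (Set.univ ∩ alive R ε 0) = P := by
    rw [Set.univ_inter, Measure.restrict_eq_self_of_ae_mem (h.ae_mem_alive_zero hx)]
  have h3 : P.restrict (Set.univ ∩ alive R ε 0 ∩ {ω | passageTime ε (R ω) ≠ ∞}) = P :=
    Measure.restrict_eq_self_of_ae_mem (by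
      filter_upwards [h.ae_mem_alive_zero hx, h.passageTime_ne_top hx] with ω h1 h2
      exact ⟨⟨trivial, h1⟩, h2⟩)
  simp only [tsub_zero, h2, h3] at h1
  rw [h1]
  congr 1
  ext t
  rw [lintegral_congr_ae (g := fun _ => passageDensityNN ε t x)
    (by filter_upwards [h.start] with ω hω; rw [hω])]
  simp [passageDensityNN]

end

/-! ### Pointwise properties of the passage density and of the bridge density -/

section

variable {Ω : Type*} {R : Ω → C(ℝ≥0, ℝ≥0)} {x ε : ℝ≥0}

theorem passageDensityNN_le {t y : ℝ≥0} (ht : 0 < t) (hy : ε ≤ y) :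
    passageDensityNN ε t y ≤ ENNReal.ofReal (7 / t) := by
  have h := passageDensity_le (a := (y : ℝ) - ε) (NNReal.coe_pos.2 ht)
    (sub_nonneg.2 (NNReal.coe_le_coe.2 hy)) (NNReal.coe_nonneg ε)
  rw [sub_add_cancel] at h
  exact ENNReal.ofReal_le_ofReal h

theorem passageDensityNN_pos {t y : ℝ≥0} (ht : 0 < t) (hy : ε < y) :
    0 < passageDensityNN ε t y := by
  have h := passageDensity_pos (a := (y : ℝ) - ε) (NNReal.coe_pos.2 ht)
    (sub_pos.2 (NNReal.coe_lt_coe.2 hy)) (NNReal.coe_nonneg ε)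
  rw [sub_add_cancel] at h
  exact ENNReal.ofReal_pos.2 h

theorem passageDensityNN_ne_top {t y : ℝ≥0} : passageDensityNN ε t y ≠ ∞ := ENNReal.ofReal_ne_top

theorem cube_mul_passageDensityNN_le {t y : ℝ≥0} (ht : 0 < t) (hy : ε ≤ y) :
    ENNReal.ofReal (((y : ℝ) - ε) ^ 3) * passageDensityNN ε t y ≤ ENNReal.ofReal (56 * √t) := by
  have hy' : (0 : ℝ) ≤ (y : ℝ) - ε := sub_nonneg.2 (NNReal.coe_le_coe.2 hy)
  have h := cube_mul_passageDensity_le (a := (y : ℝ) - ε) (NNReal.coe_pos.2 ht) hy'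
    (NNReal.coe_nonneg ε)
  rw [sub_add_cancel] at h
  unfold passageDensityNN
  rw [← ENNReal.ofReal_mul (by positivity)]
  exact ENNReal.ofReal_le_ofReal h

theorem tendsto_passageDensityNN_time {l : Filter ℝ} [l.IsCountablyGenerated] {t : ℝ}
    (ht : 0 < t) (hl : l ≤ 𝓝 t) {y : ℝ≥0} (hy : ε ≤ y) :
    Tendsto (fun v : ℝ => passageDensityNN ε v.toNNReal y) l
      (𝓝 (passageDensityNN ε t.toNNReal y)) := by
  have h := tendsto_passageDensity (l := l) (τ := fun v => (v.toNNReal : ℝ))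
    (α := fun _ => (y : ℝ) - ε) (η := fun _ => (ε : ℝ)) (t := (t.toNNReal : ℝ))
    (NNReal.coe_pos.2 (Real.toNNReal_pos.2 ht)) (sub_nonneg.2 (NNReal.coe_le_coe.2 hy))
    (NNReal.coe_nonneg ε)
    (((NNReal.continuous_coe.comp continuous_real_toNNReal).tendsto t).mono_left hl)
    tendsto_const_nhds tendsto_const_nhds
    (Eventually.of_forall fun _ => sub_nonneg.2 (NNReal.coe_le_coe.2 hy))
    (Eventually.of_forall fun _ => NNReal.coe_nonneg ε)
  simp only [sub_add_cancel] at h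
  exact ENNReal.tendsto_ofReal h

/-- The event, in the past of `u`, that the martingale of passage densities is at most `c`. -/
def lowDensity (R : Ω → C(ℝ≥0, ℝ≥0)) (ε t : ℝ≥0) (c : ℝ≥0∞) (u : ℝ≥0) : Set Ω :=
  {ω | passageDensityNN ε (t - u) (R ω u) ≤ c}

theorem measurableSet_lowDensity (R : Ω → C(ℝ≥0, ℝ≥0)) (ε t : ℝ≥0) (c : ℝ≥0∞) (u : ℝ≥0) :
    MeasurableSet[pathSigma R u] (lowDensity R ε t c u) := by
  have h1 : Measurable fun y : ℝ≥0 => passageDensityNN ε (t - u) y := by fun_prop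
  exact (h1.comp (measurable_pathSigma_apply R le_rfl)) measurableSet_Iic

theorem isOpen_setOf_lt (ε s : ℝ≥0) : IsOpen {w : C(Set.Icc 0 s, ℝ≥0) | ∀ u, ε < w u} := by
  have := ContinuousMap.isOpen_setOfPred_mapsTo (X := Set.Icc 0 s) (Y := ℝ≥0) isCompact_univ
    (isOpen_Ioi (a := ε))
  simpa [Set.MapsTo] using this

theorem measurable_bridgeDensity (x ε s t : ℝ≥0) : Measurable (bridgeDensity x ε s t) := by
  have := measurable_endpoint (s := s)
  unfold bridgeDensity
  refine Measurable.ite (isOpen_setOf_lt ε s).measurableSet ?_ measurable_const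
  fun_prop

theorem bridgeDensity_restrict {s t : ℝ≥0} (hx : ε < x) (hst : s < t) {ω : Ω}
    (h0 : ε < R ω 0) : bridgeDensity x ε s t ((R ω).restrict (Set.Icc 0 s)) =
      (alive R ε s).indicator
        (fun ω => passageDensityNN ε (t - s) (R ω s) / passageDensityNN ε t x) ω := by
  have h1 : (∀ u : Set.Icc 0 s, ε < (R ω).restrict (Set.Icc 0 s) u) ↔ ω ∈ alive R ε s := by
    refine Iff.trans ?_ (lt_passageTime_iff h0).symm
    exact ⟨fun h u hu => h ⟨u, zero_le, hu⟩, fun h u => h u u.2.2⟩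
  unfold bridgeDensity
  by_cases hω : ω ∈ alive R ε s
  · rw [if_pos (h1.2 hω), Set.indicator_of_mem hω, passageDensityNN, passageDensityNN,
      NNReal.coe_sub hst.le]
    rw [ENNReal.ofReal_div_of_pos]
    · rfl
    · exact ENNReal.ofReal_pos.1 (passageDensityNN_pos (pos_of_gt hst) hx)
  · rw [if_neg fun h => hω (h1.1 h), Set.indicator_of_notMem hω]

variable [MeasurableSpace Ω] {P : Measure Ω}

/-! ### The martingale of first-passage densities -/

/-- Dominated convergence. It serves to upgrade an equality of densities holding for almost every
duration to every duration. -/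
theorem IsBesselNegOne.continuousOn_lintegral_passageDensityNN (h : IsBesselNegOne R x P)
    (hx : ε < x) {s : ℝ≥0} {A : Set Ω} (hA : MeasurableSet[pathSigma R s] A) :
    ContinuousOn (fun v : ℝ => ∫⁻ ω in A ∩ alive R ε s, passageDensityNN ε v.toNNReal (R ω s) ∂P)
      (Set.Ioi 0) := by
  have := h.isProbabilityMeasure
  have hAs' := pathSigma_le h.measurable s _ (hA.inter (measurableSet_alive R ε s))
  have hae : ∀ᵐ ω ∂(P.restrict (A ∩ alive R ε s)), ε ≤ R ω s := by
    filter_upwards [ae_restrict_of_ae (h.lt_start hx), ae_restrict_mem hAs'] with ω h1 h2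
    exact (lt_of_mem_alive h1 h2.2).le
  have hRm := measurable_apply h.measurable s
  refine fun t ht => ContinuousAt.continuousWithinAt ?_
  have ht : 0 < t := ht
  refine tendsto_lintegral_filter_of_dominated_convergence (fun _ => ENNReal.ofReal (14 / t))
    (Eventually.of_forall fun v => by fun_prop) ?_ ?_ ?_
  · filter_upwards [eventually_gt_nhds (show t / 2 < t by linarith)] with v hv
    filter_upwards [hae] with ω hω
    have hv0 : 0 < v := by linarith
    refine (passageDensityNN_le (Real.toNNReal_pos.2 hv0) hω).trans (ENNReal.ofReal_le_ofReal ?_)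
    rw [Real.coe_toNNReal _ hv0.le, div_le_div_iff₀ hv0 ht]
    linarith
  · rw [lintegral_const]
    exact ENNReal.mul_ne_top ENNReal.ofReal_ne_top (measure_ne_top _ _)
  · filter_upwards [hae] with ω hω
    exact tendsto_passageDensityNN_time ht le_rfl hω

/-- The martingale property. On A, the law of T_ε beyond s' can be computed by conditioning at s or
at s'; the two resulting densities agree almost everywhere, hence everywhere by continuity. -/
theorem IsBesselNegOne.setLIntegral_passageDensityNN (h : IsBesselNegOne R x P) (hx : ε < x)
    {s s' t : ℝ≥0} (hs : s ≤ s') (ht : s' < t) {A : Set Ω}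
    (hA : MeasurableSet[pathSigma R s] A) :
    ∫⁻ ω in A ∩ alive R ε s', passageDensityNN ε (t - s') (R ω s') ∂P =
      ∫⁻ ω in A ∩ alive R ε s, passageDensityNN ε (t - s) (R ω s) ∂P := by
  have := h.isProbabilityMeasure
  have hTm : Measurable fun ω => passageTime ε (R ω) :=
    (measurable_passageTime ε).comp h.measurable
  have hA' := pathSigma_mono R hs _ hA
  set F : ℝ≥0 → ℝ → ℝ≥0∞ := fun s v =>
    ∫⁻ ω in A ∩ alive R ε s, passageDensityNN ε v.toNNReal (R ω s) ∂P with hF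
  have hFm : ∀ s, Measurable fun t : ℝ≥0 =>
      ∫⁻ ω in A ∩ alive R ε s, passageDensityNN ε t (R ω s) ∂P := fun s =>
    Measurable.lintegral_prod_right' (ν := P.restrict (A ∩ alive R ε s))
      (f := fun p : ℝ≥0 × Ω => passageDensityNN ε p.1 (R p.2 s))
      (measurable_passageDensityNN ε measurable_fst
        ((measurable_apply h.measurable s).comp measurable_snd))
  have hFm' : ∀ s, Measurable (F s) := fun s => (hFm s).comp measurable_real_toNNReal
  set d : ℝ := (s' : ℝ) - s with hd
  have hd0 : 0 ≤ d := sub_nonneg.2 (NNReal.coe_le_coe.2 hs)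
  have hAalive : A ∩ alive R ε s' = {ω | (s' : ℝ≥0∞) < passageTime ε (R ω)} ∩ (A ∩ alive R ε s) := by
    ext ω
    exact ⟨fun hω => ⟨hω.2, hω.1, alive_anti R ε hs hω.2⟩, fun hω => ⟨hω.2.1, hω.1⟩⟩
  have hae : F s' =ᵐ[volume.restrict (Set.Ioi 0)] fun v => F s (d + v) := by
    refine ae_eq_of_forall_setLIntegral_eq_of_sigmaFinite (hFm' s')
      ((hFm' s).comp (measurable_const_add d)) fun S hS _ => ?_
    -- This test function vanishes unless T > s', so integrating it over survival up to s or up to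
    -- s' gives the same result.
    set f : ℝ≥0 → ℝ≥0∞ := {τ : ℝ≥0 | (τ : ℝ) - s' ∈ S ∩ Set.Ioi 0}.indicator 1 with hf
    have hfS : MeasurableSet {τ : ℝ≥0 | (τ : ℝ) - s' ∈ S ∩ Set.Ioi 0} :=
      (hS.inter measurableSet_Ioi).preimage (by fun_prop)
    have hfm : Measurable f := measurable_one.indicator hfS
    have e1 := h.lintegral_passageTime hx hA' hfm
    have e2 := h.lintegral_passageTime hx hA hfm
    rw [lintegral_lebNN (f := fun t => f (s' + t) *
      ∫⁻ ω in A ∩ alive R ε s', passageDensityNN ε t (R ω s') ∂P)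
      ((hfm.comp (measurable_const_add s')).mul (hFm s'))] at e1
    rw [lintegral_lebNN (f := fun t => f (s + t) *
      ∫⁻ ω in A ∩ alive R ε s, passageDensityNN ε t (R ω s) ∂P)
      ((hfm.comp (measurable_const_add s)).mul (hFm s))] at e2
    have e3 : ∫⁻ ω in A ∩ alive R ε s', f (passageTime ε (R ω)).toNNReal ∂P =
        ∫⁻ ω in A ∩ alive R ε s, f (passageTime ε (R ω)).toNNReal ∂P := by
      rw [hAalive, ← setLIntegral_indicator
        (s := {ω | (s' : ℝ≥0∞) < passageTime ε (R ω)}) (hTm measurableSet_Ioi)]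
      refine lintegral_congr_ae ?_
      filter_upwards [ae_restrict_of_ae (h.passageTime_ne_top hx)] with ω hω
      by_cases hω' : ω ∈ {ω | (s' : ℝ≥0∞) < passageTime ε (R ω)}
      · rw [Set.indicator_of_mem hω']
      · rw [Set.indicator_of_notMem hω', hf, Set.indicator_of_notMem]
        rintro ⟨-, h2⟩
        have h2 : (0 : ℝ) < ((passageTime ε (R ω)).toNNReal : ℝ) - s' := h2
        rw [sub_pos, NNReal.coe_lt_coe, ← ENNReal.coe_lt_coe, ENNReal.coe_toNNReal hω] at h2
        exact hω' h2
    have e4 : ∫⁻ v in Set.Ioi (0 : ℝ), f (s' + v.toNNReal) * F s' v =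
        ∫⁻ v in S, F s' v ∂(volume.restrict (Set.Ioi 0)) := by
      rw [← lintegral_indicator hS]
      refine setLIntegral_congr_fun measurableSet_Ioi fun v hv => ?_
      have hv : 0 < v := hv
      by_cases hvS : v ∈ S <;> simp [hf, Set.indicator, hvS, hv, max_eq_left hv.le]
    have e5 : ∫⁻ v in Set.Ioi (0 : ℝ), f (s + v.toNNReal) * F s v =
        ∫⁻ v in S, F s (d + v) ∂(volume.restrict (Set.Ioi 0)) := by
      rw [← lintegral_indicator hS]
      -- Durations v ≤ d = s' - s correspond to T ≤ s', where f vanishes.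
      have e6 : ∫⁻ v in Set.Ioi (0 : ℝ), f (s + v.toNNReal) * F s v =
          ∫⁻ v in Set.Ioi d, f (s + v.toNNReal) * F s v := by
        rw [← Set.inter_eq_left.2 (Set.Ioi_subset_Ioi hd0), ← setLIntegral_indicator measurableSet_Ioi]
        refine setLIntegral_congr_fun measurableSet_Ioi fun v hv => ?_
        have hv : 0 < v := hv
        by_cases hvd : v ∈ Set.Ioi d
        · rw [Set.indicator_of_mem hvd]
        · simp only [Set.mem_Ioi, not_lt, hd] at hvd
          rw [Set.indicator_of_notMem (by simpa using hvd), hf, Set.indicator_of_notMem, zero_mul]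
          rintro ⟨-, h2⟩
          have h2 : (0 : ℝ) < ((s + v.toNNReal : ℝ≥0) : ℝ) - s' := h2
          rw [NNReal.coe_add, Real.coe_toNNReal _ hv.le] at h2
          linarith
      rw [e6, setLIntegral_Ioi_eq_add d]
      refine setLIntegral_congr_fun measurableSet_Ioi fun v hv => ?_
      have hv : 0 < v := hv
      have e7 : (s : ℝ) + (d + v) - s' = v := by rw [hd]; ring
      have e8 : ((s + (d + v).toNNReal : ℝ≥0) : ℝ) - s' = v := by
        rw [NNReal.coe_add, Real.coe_toNNReal _ (add_nonneg hd0 hv.le), e7]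
      by_cases hvS : v ∈ S
      · rw [Set.indicator_of_mem hvS, hf, Set.indicator_of_mem, Pi.one_apply, one_mul]
        rw [Set.mem_ofPred_eq, e8]
        exact ⟨hvS, hv⟩
      · rw [Set.indicator_of_notMem hvS, hf, Set.indicator_of_notMem, zero_mul]
        rw [Set.mem_ofPred_eq, e8]
        exact fun h => hvS h.1
    rw [← e4, ← e5]
    exact e1.symm.trans (e3.trans e2)
  have hpos : (0 : ℝ) < (t : ℝ) - s' := sub_pos.2 (NNReal.coe_lt_coe.2 ht)
  have heq := Measure.eqOn_open_of_ae_eq hae isOpen_Ioi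
    (h.continuousOn_lintegral_passageDensityNN hx hA')
    ((h.continuousOn_lintegral_passageDensityNN hx hA).comp (by fun_prop)
      fun v hv => add_pos_of_nonneg_of_pos hd0 hv) hpos
  have e1 : ((t : ℝ) - s').toNNReal = t - s' := by
    rw [← NNReal.coe_sub ht.le, Real.toNNReal_coe]
  have e2 : (d + ((t : ℝ) - s')).toNNReal = t - s := by
    rw [hd, show (s' : ℝ) - s + (t - s') = t - s by ring, ← NNReal.coe_sub (hs.trans ht.le),
      Real.toNNReal_coe]
  simp only [hF, e1, e2] at heq
  exact heq

/-- A maximal inequality. -/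
theorem IsBesselNegOne.maximal_finset (h : IsBesselNegOne R x P) (hx : ε < x) {s t : ℝ≥0}
    (ht : s < t) (c : ℝ≥0∞) (J : Finset ℝ≥0) (hJ : ∀ u ∈ J, u ≤ s) :
    ∫⁻ ω in (⋃ u ∈ J, lowDensity R ε t c u) ∩ alive R ε s, passageDensityNN ε (t - s) (R ω s) ∂P ≤
      c * P (⋃ u ∈ J, lowDensity R ε t c u) := by
  induction J using Finset.induction_on_max with
  | empty => simp
  | insert a J ha ih =>
    have hJm : MeasurableSet[pathSigma R a] (⋃ u ∈ J, lowDensity R ε t c u) :=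
      MeasurableSet.biUnion J.countable_toSet fun u hu =>
        pathSigma_mono R (ha u hu).le _ (measurableSet_lowDensity R ε t c u)
    have hJm' := pathSigma_le h.measurable _ _ hJm
    set U := ⋃ u ∈ J, lowDensity R ε t c u
    -- V is the event that the density is low at the latest time a but at no earlier time of J. It
    -- lies in the past of a, so the martingale property brings the integral back to time a, where
    -- the density is at most c.
    have hVm : MeasurableSet[pathSigma R a] (lowDensity R ε t c a \ U) :=
      (measurableSet_lowDensity R ε t c a).diff hJm
    have hVm' := pathSigma_le h.measurable _ _ hVm
    set V := lowDensity R ε t c a \ U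
    have hUV : ⋃ u ∈ insert a J, lowDensity R ε t c u = U ∪ V := by
      rw [Finset.set_biUnion_insert, Set.union_sdiff_self, Set.union_comm]
    have has : a ≤ s := hJ a (Finset.mem_insert_self _ _)
    rw [hUV, Set.union_inter_distrib_right,
      measure_union (Set.disjoint_sdiff_right) hVm', mul_add]
    refine (lintegral_union_le _ _ _).trans (add_le_add
      (ih fun u hu => hJ u (Finset.mem_insert_of_mem hu)) ?_)
    rw [h.setLIntegral_passageDensityNN hx has ht hVm]
    calc _ ≤ ∫⁻ ω in V, passageDensityNN ε (t - a) (R ω a) ∂P :=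
          lintegral_mono_set Set.inter_subset_left
      _ ≤ ∫⁻ ω in V, c ∂P := setLIntegral_mono' hVm' fun ω hω => hω.1
      _ = _ := by rw [setLIntegral_const]

/-- Continuity from below over the finite subsets of J, for the measure with density r_{t-s}(R_s, ε)
on survival up to s. After division by r_t(x, ε), it bounds the probability that the bridge ever has
low density. -/
theorem IsBesselNegOne.maximal_countable (h : IsBesselNegOne R x P) (hx : ε < x) {s t : ℝ≥0}
    (ht : s < t) (c : ℝ≥0∞) {J : Set ℝ≥0} (hJc : J.Countable) (hJ : ∀ u ∈ J, u ≤ s) :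
    ∫⁻ ω in (⋃ u ∈ J, lowDensity R ε t c u) ∩ alive R ε s,
      passageDensityNN ε (t - s) (R ω s) ∂P ≤ c := by
  have := h.isProbabilityMeasure
  have := hJc.to_subtype
  have hm : ∀ u, MeasurableSet (lowDensity R ε t c u) := fun u =>
    pathSigma_le h.measurable _ _ (measurableSet_lowDensity R ε t c u)
  have hal := pathSigma_le h.measurable _ _ (measurableSet_alive R ε s)
  have hRm := measurable_apply h.measurable s
  have e : (⋃ u ∈ J, lowDensity R ε t c u) =
      ⋃ K : Finset J, ⋃ u ∈ K, lowDensity R ε t c (u : ℝ≥0) := by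
    rw [Set.biUnion_eq_iUnion, Set.iUnion_eq_iUnion_finset]
  set ν := (P.restrict (alive R ε s)).withDensity fun ω => passageDensityNN ε (t - s) (R ω s)
  have hν : ∀ S, MeasurableSet S → ν S =
      ∫⁻ ω in S ∩ alive R ε s, passageDensityNN ε (t - s) (R ω s) ∂P := fun S hS => by
    rw [withDensity_apply _ hS, Measure.restrict_restrict hS]
  rw [← hν _ (MeasurableSet.biUnion hJc fun u _ => hm u), e, Directed.measure_iUnion]
  · refine iSup_le fun K => ?_
    classical
    have e2 : (⋃ u ∈ K, lowDensity R ε t c (u : ℝ≥0)) =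
        ⋃ u ∈ K.image (Subtype.val), lowDensity R ε t c u := by
      simp
    rw [e2, hν _ (Finset.measurableSet_biUnion _ fun u _ => hm u)]
    refine (h.maximal_finset hx ht c _ ?_).trans (mul_le_of_le_one_right zero_le prob_le_one)
    intro u hu
    obtain ⟨v, -, rfl⟩ := Finset.mem_image.1 hu
    exact hJ v v.2
  · refine Monotone.directed_le fun K L hKL => ?_
    exact Set.biUnion_subset_biUnion_left hKL

/-! ### The bridge up to a time before its end -/

/-- The law of the bridge of duration `t`, up to time `s < t`. -/
def bridgeLaw (R : Ω → C(ℝ≥0, ℝ≥0)) (P : Measure Ω) (x ε s t : ℝ≥0) :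
    Measure C(Set.Icc 0 s, ℝ≥0) :=
  (P.map fun ω => (R ω).restrict (Set.Icc 0 s)).withDensity (bridgeDensity x ε s t)

theorem measurable_restrict (hR : Measurable R) (s : ℝ≥0) :
    Measurable fun ω => (R ω).restrict (Set.Icc 0 s) :=
  (continuous_restrict_Icc s).measurable.comp hR

theorem IsBesselNegOne.bridgeLaw_apply (h : IsBesselNegOne R x P) (hx : ε < x) {s t : ℝ≥0}
    (hst : s < t) {A : Set C(Set.Icc 0 s, ℝ≥0)} (hA : MeasurableSet A) :
    bridgeLaw R P x ε s t A =
      (∫⁻ ω in (fun ω => (R ω).restrict (Set.Icc 0 s)) ⁻¹' A ∩ alive R ε s,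
        passageDensityNN ε (t - s) (R ω s) ∂P) / passageDensityNN ε t x := by
  have hr := measurable_restrict h.measurable s
  have hal := pathSigma_le h.measurable _ _ (measurableSet_alive R ε s)
  have hRm := measurable_apply h.measurable s
  rw [bridgeLaw, withDensity_apply _ hA,
    setLIntegral_map hA (measurable_bridgeDensity x ε s t) hr, Set.inter_comm,
    ← setLIntegral_indicator hal, ENNReal.div_eq_inv_mul, ← lintegral_const_mul]
  · refine lintegral_congr_ae ?_
    filter_upwards [ae_restrict_of_ae (h.lt_start hx)] with ω hω
    rw [bridgeDensity_restrict hx hst hω]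
    by_cases hω' : ω ∈ alive R ε s
    · rw [Set.indicator_of_mem hω', Set.indicator_of_mem hω', ENNReal.div_eq_inv_mul]
    · rw [Set.indicator_of_notMem hω', Set.indicator_of_notMem hω', mul_zero]
  · exact Measurable.indicator (by fun_prop) hal

/-- Consistency is the martingale property on events of the past of s; the total mass is 1 for the
same reason, compared with time 0. -/
theorem IsBesselNegOne.map_bridgeLaw (h : IsBesselNegOne R x P) (hx : ε < x) {s s' t : ℝ≥0}
    (hs : s ≤ s') (ht : s' < t) :
    (bridgeLaw R P x ε s' t).map (restrictPath hs) = bridgeLaw R P x ε s t := by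
  ext A hA
  have hr := (continuous_restrictPath hs).measurable
  rw [Measure.map_apply hr hA, h.bridgeLaw_apply hx ht (hr hA),
    h.bridgeLaw_apply hx (hs.trans_lt ht) hA]
  congr 1
  exact h.setLIntegral_passageDensityNN hx hs ht ⟨A, hA, rfl⟩

theorem IsBesselNegOne.isProbabilityMeasure_bridgeLaw (h : IsBesselNegOne R x P) (hx : ε < x)
    {s t : ℝ≥0} (ht : s < t) : IsProbabilityMeasure (bridgeLaw R P x ε s t) := by
  have := h.isProbabilityMeasure
  refine ⟨?_⟩
  have ht0 : 0 < t := pos_of_gt ht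
  rw [h.bridgeLaw_apply hx ht MeasurableSet.univ, Set.preimage_univ,
    h.setLIntegral_passageDensityNN hx zero_le ht MeasurableSet.univ, Set.univ_inter, tsub_zero,
    Measure.restrict_eq_self_of_ae_mem (h.ae_mem_alive_zero hx),
    lintegral_congr_ae (g := fun _ => passageDensityNN ε t x)
      (by filter_upwards [h.start] with ω hω; rw [hω])]
  simp only [lintegral_const, measure_univ, mul_one]
  exact ENNReal.div_self (passageDensityNN_pos ht0 hx).ne' passageDensityNN_ne_top

/-- Close to its end, the bridge is close to `ε`. -/
theorem IsBesselNegOne.bridgeLaw_far (h : IsBesselNegOne R x P) (hx : ε < x) {s₀ s t : ℝ≥0}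
    (ht : s < t) {η : ℝ≥0} (hη : 0 < η) :
    bridgeLaw R P x ε s t {w | ∃ u : Set.Icc 0 s, s₀ ≤ u ∧ ε + η < w u} ≤
      ENNReal.ofReal (56 * √((t : ℝ) - s₀) / η ^ 3) / passageDensityNN ε t x := by
  set O := {w : C(Set.Icc 0 s, ℝ≥0) | ∃ u : Set.Icc 0 s, s₀ ≤ u ∧ ε + η < w u} with hO
  have hOm : MeasurableSet O := by
    refine IsOpen.measurableSet ?_
    have : O = ⋃ u : Set.Icc 0 s, ⋃ _ : s₀ ≤ u, {w | ε + η < w u} := by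
      ext w; simp [hO]
    rw [this]
    exact isOpen_iUnion fun u => isOpen_iUnion fun _ =>
      isOpen_lt continuous_const (continuous_eval_const u)
  -- By the cubic bound, a path more than η above ε at a time v ≥ s₀ has passage density at most
  -- 56√(t - v)/η³ ≤ c. By path continuity it is enough to look at a countable dense set of times.
  set c := ENNReal.ofReal (56 * √((t : ℝ) - s₀) / η ^ 3) with hc
  obtain ⟨D, hDc, hDd⟩ := TopologicalSpace.exists_countable_dense (Set.Icc s₀ s)
  have hJc : ((Subtype.val : Set.Icc s₀ s → ℝ≥0) '' D).Countable := hDc.image _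
  have hmax := h.maximal_countable hx ht c hJc fun u hu => by
    obtain ⟨v, -, rfl⟩ := hu
    exact v.2.2
  rw [h.bridgeLaw_apply hx ht hOm]
  refine ENNReal.div_le_div_right (le_trans ?_ hmax) _
  have hUm : MeasurableSet (⋃ u ∈ (Subtype.val : Set.Icc s₀ s → ℝ≥0) '' D, lowDensity R ε t c u) :=
    MeasurableSet.biUnion hJc fun u _ =>
      pathSigma_le h.measurable _ _ (measurableSet_lowDensity R ε t c u)
  refine lintegral_mono' (Measure.restrict_mono_ae ?_) le_rfl
  filter_upwards [h.lt_start hx] with ω hω hωO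
  refine ⟨?_, hωO.2⟩
  obtain ⟨u, hu, huη⟩ := hωO.1
  have huη : ε + η < R ω u := huη
  obtain ⟨v, hvD, hv⟩ : ∃ v ∈ D, ε + η < R ω v := by
    have hopen : IsOpen {v : Set.Icc s₀ s | ε + η < R ω v} :=
      isOpen_lt continuous_const ((R ω).continuous.comp continuous_subtype_val)
    obtain ⟨v, hv1, hv2⟩ := hDd.inter_open_nonempty _ hopen ⟨⟨u, hu, u.2.2⟩, huη⟩
    exact ⟨v, hv2, hv1⟩
  refine Set.mem_biUnion ⟨v, hvD, rfl⟩ ?_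
  have hvt : (v : ℝ≥0) < t := v.2.2.trans_lt ht
  have hle := cube_mul_passageDensityNN_le (ε := ε) (tsub_pos_of_lt hvt)
    (le_self_add.trans hv.le)
  change passageDensityNN ε (t - v) (R ω v) ≤ c
  have hη3 : 0 < (η : ℝ) ^ 3 := pow_pos (NNReal.coe_pos.2 hη) 3
  rw [hc, ENNReal.ofReal_div_of_pos hη3, ENNReal.le_div_iff_mul_le
    (Or.inl (by simpa using hη.ne')) (Or.inl ENNReal.ofReal_ne_top), mul_comm]
  calc _ ≤ ENNReal.ofReal (((R ω v : ℝ) - ε) ^ 3) * passageDensityNN ε (t - v) (R ω v) := by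
        have : (η : ℝ) ≤ (R ω v : ℝ) - ε := by
          have : ((ε + η : ℝ≥0) : ℝ) < R ω v := NNReal.coe_lt_coe.2 hv
          push_cast at this
          linarith
        gcongr
    _ ≤ _ := hle
    _ ≤ _ := by
      refine ENNReal.ofReal_le_ofReal ?_
      rw [NNReal.coe_sub hvt.le]
      have : (s₀ : ℝ) ≤ v := NNReal.coe_le_coe.2 v.2.1
      gcongr

end

section

/-! ### Projective limits along almost surely convergent approximations -/

section ProjectiveLimit

variable {E : Type*} [MeasurableSpace E]

theorem compProd_comap {F G : Type*} [MeasurableSpace F] [MeasurableSpace G] {ρ : Measure F}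
    [SFinite ρ] {g : F → E} (hg : Measurable g) (κ : Kernel E G) [IsSFiniteKernel κ] :
    (ρ ⊗ₘ κ.comap g hg).map (Prod.map g id) = ρ.map g ⊗ₘ κ := by
  have hgm : Measurable (Prod.map g (id : G → G)) := hg.prodMap measurable_id
  refine Measure.ext_of_lintegral _ fun f hf => ?_
  rw [lintegral_map hf hgm, Measure.lintegral_compProd (f := fun p => f (Prod.map g id p)) (hf.comp hgm),
    Measure.lintegral_compProd hf, lintegral_map hf.lintegral_kernel_prod_right' hg]
  rfl

variable [StandardBorelSpace E] [Nonempty E]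

/-- Measures which are images of each other by a sequence of maps are the laws of the terms of a
random sequence. -/
theorem exists_measure_forall_map_prodMk (μ : ℕ → Measure E) [∀ n, IsProbabilityMeasure (μ n)]
    {f : ℕ → E → E} (hf : ∀ n, Measurable (f n)) (hμ : ∀ n, (μ (n + 1)).map (f n) = μ n) :
    ∃ ν : Measure (ℕ → E), IsProbabilityMeasure ν ∧
      ∀ n, ν.map (fun x => (x n, x (n + 1))) = (μ (n + 1)).map fun w => (f n w, w) := by
  have hlast : ∀ n : ℕ, Measurable fun x : (i : Finset.Iic n) → E => x ⟨n, Finset.mem_Iic.2 (le_refl n)⟩ :=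
    fun n => measurable_pi_apply _
  -- The maps f n are reversed into transition kernels: κ n is the conditional law of w given f n w
  -- under μ (n + 1). The Ionescu–Tulcea theorem then produces the sequence.
  let κ : (n : ℕ) → Kernel ((i : Finset.Iic n) → E) E := fun n =>
    (condDistrib id (f n) (μ (n + 1))).comap _ (hlast n)
  have hκ : ∀ n, IsMarkovKernel (κ n) := fun n => by dsimp only [κ]; infer_instance
  let ν : Measure (ℕ → E) := Kernel.trajMeasure (X := fun _ => E) (μ 0) κ
  have hν : IsProbabilityMeasure ν := by dsimp only [ν]; infer_instance
  have hstep : ∀ n, ν.map (fun x => x n) = μ n →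
      ν.map (fun x => (x n, x (n + 1))) = (μ (n + 1)).map fun w => (f n w, w) := fun n hn => by
    have e := Kernel.map_frestrictLe_trajMeasure_compProd_eq_map_trajMeasure (X := fun _ => E)
      (μ₀ := μ 0) (κ := κ) (a := n)
    have e1 := congrArg (Measure.map (Prod.map (fun x : (i : Finset.Iic n) → E =>
      x ⟨n, Finset.mem_Iic.2 le_rfl⟩) (id : E → E))) e
    have hfr : Measurable (Preorder.frestrictLe (π := fun _ => E) n) := by fun_prop
    have : IsProbabilityMeasure (ν.map (Preorder.frestrictLe (π := fun _ => E) n)) :=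
      Measure.isProbabilityMeasure_map hfr.aemeasurable
    rw [compProd_comap, Measure.map_map (hlast n) hfr,
      Measure.map_map ((hlast n).prodMap measurable_id) (by fun_prop)] at e1
    have e2 : ν.map ((fun x : (i : Finset.Iic n) → E => x ⟨n, Finset.mem_Iic.2 le_rfl⟩) ∘
      Preorder.frestrictLe (π := fun _ => E) n) = (μ (n + 1)).map (f n) := by
      rw [hμ n]; exact hn
    rw [e2, compProd_map_condDistrib aemeasurable_id] at e1
    exact e1.symm
  have hmarg : ∀ n, ν.map (fun x => x n) = μ n := fun n => by
    induction n with
    | zero =>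
      have h0 : ν.map (Preorder.frestrictLe (π := fun _ => E) 0) =
          (μ 0).map (MeasurableEquiv.piUnique fun _ : Finset.Iic 0 => E).symm := by
        dsimp only [ν]
        rw [Kernel.trajMeasure, Measure.map_comp _ _ (by fun_prop), Kernel.traj_map_frestrictLe,
          Kernel.partialTraj_self, Measure.id_comp]
      have h1 := congrArg (Measure.map fun x : (i : Finset.Iic 0) → E =>
        x ⟨0, Finset.mem_Iic.2 le_rfl⟩) h0
      rw [Measure.map_map (hlast 0) (by fun_prop), Measure.map_map (hlast 0) (by fun_prop)] at h1
      refine Eq.trans h1 ?_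
      exact Measure.map_id
    | succ n ih =>
      have h1 := congrArg (Measure.map Prod.snd) (hstep n ih)
      rw [Measure.map_map measurable_snd (by fun_prop), Measure.map_map measurable_snd
        ((hf n).prodMk measurable_id')] at h1
      exact h1.trans Measure.map_id
  exact ⟨ν, hν, fun n => hstep n (hmarg n)⟩

end ProjectiveLimit

/-- Realise the measures as a random sequence with x n = f n (x (n + 1)). By Borel–Cantelli its
steps are eventually at most 2^{-n}, so it converges almost surely. Since f n takes the value x n at
every later term, continuity gives the same value at the limit, whose law is the measure sought. -/
theorem exists_measure_forall_map_eq {E : Type*} [MetricSpace E] [CompleteSpace E]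
    [SecondCountableTopology E] [MeasurableSpace E] [BorelSpace E] [Nonempty E]
    (μ : ℕ → Measure E) [∀ n, IsProbabilityMeasure (μ n)]
    {f : ℕ → E → E} (hf : ∀ n, Continuous (f n)) (hμ : ∀ n, (μ (n + 1)).map (f n) = μ n)
    (hff : ∀ n m, n ≤ m → ∀ w, f n (f m w) = f n w)
    (hsum : ∑' n, μ (n + 1) {w | (1 / 2 : ℝ) ^ n < dist (f n w) w} ≠ ∞) :
    ∃ ν : Measure E, IsProbabilityMeasure ν ∧ ∀ n, ν.map (f n) = μ n := by
  obtain ⟨ν, hν, hνμ⟩ := exists_measure_forall_map_prodMk μ (fun n => (hf n).measurable) hμ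
  have hgraph : ∀ᵐ x ∂ν, ∀ n, x n = f n (x (n + 1)) := by
    refine ae_all_iff.2 fun n => ?_
    have hm : Measurable fun x : ℕ → E => (x n, x (n + 1)) := by fun_prop
    have hS : MeasurableSet {p : E × E | p.1 = f n p.2} :=
      measurableSet_eq_fun measurable_fst ((hf n).measurable.comp measurable_snd)
    refine ae_of_ae_map (p := fun p : E × E => p.1 = f n p.2) hm.aemeasurable ?_
    rw [hνμ n, ae_map_iff ((hf n).measurable.prodMk measurable_id').aemeasurable hS]
    exact Eventually.of_forall fun _ => rfl
  have hdist : ∀ᵐ x ∂ν, ∀ᶠ n in atTop, dist (x n) (x (n + 1)) ≤ (1 / 2 : ℝ) ^ n := by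
    have h0 := measure_limsup_atTop_eq_zero (μ := ν)
      (s := fun n => {x : ℕ → E | (1 / 2 : ℝ) ^ n < dist (x n) (x (n + 1))}) (by
        convert hsum using 3 with n
        have hm : Measurable fun x : ℕ → E => (x n, x (n + 1)) := by fun_prop
        have hS : MeasurableSet {p : E × E | (1 / 2 : ℝ) ^ n < dist p.1 p.2} :=
          (isOpen_lt continuous_const continuous_dist).measurableSet
        have e := congrArg (fun ρ => ρ {p : E × E | (1 / 2 : ℝ) ^ n < dist p.1 p.2}) (hνμ n)
        beta_reduce at e
        rw [Measure.map_apply hm hS,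
          Measure.map_apply ((hf n).measurable.prodMk measurable_id') hS] at e
        exact e)
    have h1 : ∀ᵐ x ∂ν, x ∉ limsup (fun n => {x : ℕ → E |
        (1 / 2 : ℝ) ^ n < dist (x n) (x (n + 1))}) atTop := measure_eq_zero_iff_ae_notMem.1 h0
    filter_upwards [h1] with x hx
    rw [mem_limsup_iff_frequently_mem, not_frequently] at hx
    exact hx.mono fun n hn => not_lt.1 hn
  have hlim : ∀ᵐ x ∂ν, ∃ y, Tendsto x atTop (𝓝 y) := by
    filter_upwards [hdist] with x hx
    obtain ⟨N, hN⟩ := eventually_atTop.1 hx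
    have hc : CauchySeq fun n => x (n + N) := by
      refine cauchySeq_of_le_geometric (1 / 2) 1 (by norm_num) fun n => ?_
      rw [one_mul, show n + 1 + N = n + N + 1 by ring]
      refine (hN _ (by omega)).trans ?_
      exact pow_le_pow_of_le_one (by norm_num) (by norm_num) (by omega)
    obtain ⟨y, hy⟩ := cauchySeq_tendsto_of_complete hc
    exact ⟨y, (tendsto_add_atTop_iff_nat N).1 hy⟩
  obtain ⟨L, hLm, hL⟩ : ∃ L : (ℕ → E) → E, Measurable L ∧
      ∀ᵐ x ∂ν, Tendsto x atTop (𝓝 (L x)) := by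
    classical
    obtain ⟨L, hL1, hL2⟩ := measurable_limit_of_tendsto_metrizable_ae (μ := ν) (L := atTop)
      (f := fun n (x : ℕ → E) => x n) (fun n => (measurable_pi_apply n).aemeasurable) hlim
    exact ⟨L, hL1, hL2⟩
  refine ⟨ν.map L, Measure.isProbabilityMeasure_map hLm.aemeasurable, fun n => ?_⟩
  have hfL : ∀ᵐ x ∂ν, f n (L x) = f n (x (n + 1)) := by
    filter_upwards [hL, hgraph] with x h1 h2
    -- Constancy along the sequence is where `hff` enters: f n forgets any intermediate f m with m ≥
    -- n.
    have h3 : ∀ m, f n (x (n + 1 + m)) = f n (x (n + 1)) := fun m => by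
      induction m with
      | zero => rfl
      | succ m ih => rw [← ih, h2 (n + 1 + m), hff _ _ (by omega)]; rfl
    have h4 := ((hf n).tendsto _).comp (h1.comp (tendsto_add_atTop_nat (n + 1)))
    refine tendsto_nhds_unique h4 ?_
    refine tendsto_const_nhds.congr fun m => ?_
    rw [Function.comp_apply, Function.comp_apply, ← h3 m, add_comm m]
  have hm1 : Measurable fun x : ℕ → E => x (n + 1) := measurable_pi_apply _
  have e := congrArg (Measure.map Prod.fst) (hνμ n)
  rw [Measure.map_map measurable_fst (by fun_prop), Measure.map_map measurable_fst
    ((hf n).measurable.prodMk measurable_id')] at e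
  rw [Measure.map_map (hf n).measurable hLm, ← hμ n]
  refine Eq.trans (Measure.map_congr ?_) e
  filter_upwards [hfL, hgraph] with x h1 h2
  rw [Function.comp_apply, h1, ← h2 n]
  rfl

/-! ### Construction of the bridge -/

/-- The path on `[0, t]` which follows a path on `[0, s]` up to time `s` and is constant later. -/
def prolongPath {s : ℝ≥0} (t : ℝ≥0) (w : C(Set.Icc 0 s, ℝ≥0)) : C(Set.Icc 0 t, ℝ≥0) :=
  ⟨fun u => w ⟨min u s, zero_le, min_le_right _ _⟩, by fun_prop⟩

theorem continuous_prolongPath (s t : ℝ≥0) : Continuous (prolongPath (s := s) t) :=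
  ContinuousMap.continuous_precomp
    (⟨fun u => ⟨min u s, zero_le, min_le_right _ _⟩, by fun_prop⟩ : C(Set.Icc 0 t, Set.Icc 0 s))

/-- The path on `[0, t]` frozen at time `s`. -/
def cutPath {t : ℝ≥0} (s : ℝ≥0) (w : C(Set.Icc 0 t, ℝ≥0)) : C(Set.Icc 0 t, ℝ≥0) :=
  ⟨fun u => w ⟨min u s, zero_le, (min_le_left _ _).trans u.2.2⟩, by fun_prop⟩

theorem continuous_cutPath {t : ℝ≥0} :
    Continuous fun p : ℝ≥0 × C(Set.Icc 0 t, ℝ≥0) => cutPath p.1 p.2 := by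
  refine ContinuousMap.continuous_of_continuous_uncurry _ ?_
  have : Continuous fun p : (ℝ≥0 × C(Set.Icc 0 t, ℝ≥0)) × Set.Icc 0 t =>
      p.1.2 ⟨min p.2 p.1.1, zero_le, (min_le_left _ _).trans p.2.2.2⟩ := by fun_prop
  exact this

theorem cutPath_self {t : ℝ≥0} (w : C(Set.Icc 0 t, ℝ≥0)) : cutPath t w = w := by
  ext u
  have : min (u : ℝ≥0) t = u := min_eq_left u.2.2
  simp [cutPath, this]

theorem cutPath_cutPath {s s' t : ℝ≥0} (h : s ≤ s') (w : C(Set.Icc 0 t, ℝ≥0)) :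
    cutPath s (cutPath s' w) = cutPath s w := by
  ext u
  have : min (min (u : ℝ≥0) s) s' = min (u : ℝ≥0) s := min_eq_left ((min_le_right _ _).trans h)
  simp [cutPath, this]

theorem restrictPath_prolongPath {s t : ℝ≥0} (h : s ≤ t) (w : C(Set.Icc 0 s, ℝ≥0)) :
    restrictPath h (prolongPath t w) = w := by
  ext u
  have : min (u : ℝ≥0) s = u := min_eq_left u.2.2
  simp [restrictPath, prolongPath, this]

variable {Ω : Type*} {R : Ω → C(ℝ≥0, ℝ≥0)} {x ε : ℝ≥0} [MeasurableSpace Ω] {P : Measure Ω}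

theorem bridgeLaw_ae_lt (R : Ω → C(ℝ≥0, ℝ≥0)) (P : Measure Ω) (x ε s t : ℝ≥0) :
    ∀ᵐ w ∂(bridgeLaw R P x ε s t), ∀ u, ε < w u := by
  have hm := (isOpen_setOf_lt ε s).measurableSet
  rw [ae_iff]
  have e : {w : C(Set.Icc 0 s, ℝ≥0) | ¬ ∀ u, ε < w u} = {w | ∀ u, ε < w u}ᶜ := rfl
  rw [e, bridgeLaw, withDensity_apply _ hm.compl]
  refine (setLIntegral_congr_fun (g := fun _ => 0) hm.compl fun w hw => ?_).trans (by simp)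
  exact if_neg hw

/-- Freezing at s changes the path only after s. Off the event of `IsBesselNegOne.bridgeLaw_far` all
values there lie between ε and ε + δ, so they differ by at most δ. -/
theorem IsBesselNegOne.bridgeLaw_dist (h : IsBesselNegOne R x P) (hx : ε < x) {s s' t : ℝ≥0}
    (hs : s ≤ s') (ht : s' < t) {δ : ℝ≥0} (hδ : 0 < δ) :
    bridgeLaw R P x ε s' t
        {v | (δ : ℝ) < dist (cutPath s (prolongPath t v)) (prolongPath t v)} ≤
      ENNReal.ofReal (56 * √((t : ℝ) - s) / δ ^ 3) / passageDensityNN ε t x := by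
  refine (measure_mono_ae ?_).trans (h.bridgeLaw_far hx (s₀ := s) ht hδ)
  filter_upwards [bridgeLaw_ae_lt R P x ε s' t] with w hw hwd
  by_contra hcon
  have hcon : ¬ ∃ u : Set.Icc 0 s', s ≤ u ∧ ε + δ < w u := hcon
  push Not at hcon
  refine not_le.2 (show (δ : ℝ) < dist (cutPath s (prolongPath t w)) (prolongPath t w)
    from hwd) ((ContinuousMap.dist_le (NNReal.coe_nonneg δ)).2 fun u => ?_)
  rcases le_total (u : ℝ≥0) s with hu | hu
  · have h1 : min (u : ℝ≥0) s = u := min_eq_left hu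
    have : cutPath s (prolongPath t w) u = prolongPath t w u := by simp [cutPath, h1]
    rw [this, dist_self]
    exact NNReal.coe_nonneg δ
  · obtain ⟨v1, hv1, e1⟩ : ∃ v : Set.Icc 0 s', s ≤ v ∧ cutPath s (prolongPath t w) u = w v := by
      refine ⟨⟨s, zero_le, hs⟩, le_rfl, ?_⟩
      have h1 : min (u : ℝ≥0) s = s := min_eq_right hu
      have h2 : min s s' = s := min_eq_left hs
      simp [cutPath, prolongPath, h1, h2]
    obtain ⟨v2, hv2, e2⟩ : ∃ v : Set.Icc 0 s', s ≤ v ∧ prolongPath t w u = w v :=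
      ⟨⟨min u s', zero_le, min_le_right _ _⟩, le_min hu hs, rfl⟩
    rw [e1, e2, NNReal.dist_eq, abs_le]
    have h1 : ((w v1 : ℝ≥0) : ℝ) ≤ ((ε + δ : ℝ≥0) : ℝ) := NNReal.coe_le_coe.2 (hcon v1 hv1)
    have h2 : ((w v2 : ℝ≥0) : ℝ) ≤ ((ε + δ : ℝ≥0) : ℝ) := NNReal.coe_le_coe.2 (hcon v2 hv2)
    have h3 : (ε : ℝ) < w v1 := NNReal.coe_lt_coe.2 (hw v1)
    have h4 : (ε : ℝ) < w v2 := NNReal.coe_lt_coe.2 (hw v2)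
    rw [NNReal.coe_add] at h1 h2
    constructor <;> linarith

/-- The laws on [0, σ n], prolonged as constants to [0, t], satisfy `exists_measure_forall_map_eq`
with f n the freezing at σ n. Any s < t lies below some σ n, so all the marginals follow by
consistency. -/
theorem IsBesselNegOne.exists_bridge (h : IsBesselNegOne R x P) (hx : ε < x) {t : ℝ≥0}
    (ht : 0 < t) :
    ∃ B : ProbabilityMeasure C(Set.Icc 0 t, ℝ≥0), ∀ (s : ℝ≥0) (hst : s < t),
      (B : Measure C(Set.Icc 0 t, ℝ≥0)).map (restrictPath hst.le) = bridgeLaw R P x ε s t := by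
  -- With this ratio √(t - σ n) = √t/16ⁿ; dividing by the cube of the tolerance 2^{-n} leaves √t/2ⁿ,
  -- which is summable.
  set r : ℝ≥0 := 1 / 256 with hr
  have hr1 : r < 1 := by rw [hr]; norm_num
  have hr0 : 0 < r := by rw [hr]; norm_num
  set σ : ℕ → ℝ≥0 := fun n => t - t * r ^ n with hσ
  have hσt : ∀ n, σ n < t := fun n => tsub_lt_self ht (mul_pos ht (pow_pos hr0 n))
  have hσm : Monotone σ := fun n m hnm =>
    tsub_le_tsub_left (mul_le_mul_right (pow_le_pow_of_le_one hr0.le hr1.le hnm) t) t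
  have hσl : Tendsto σ atTop (𝓝 t) := by
    have h1 : Tendsto (fun n => t * r ^ n) atTop (𝓝 (t * 0)) :=
      (NNReal.tendsto_pow_atTop_nhds_zero_of_lt_one hr1).const_mul t
    have h2 := (tendsto_const_nhds (x := t)).sub h1
    simpa using h2
  let μ : ℕ → Measure C(Set.Icc 0 t, ℝ≥0) := fun n =>
    (bridgeLaw R P x ε (σ n) t).map (prolongPath t)
  let f : ℕ → C(Set.Icc 0 t, ℝ≥0) → C(Set.Icc 0 t, ℝ≥0) := fun n => cutPath (σ n)
  have hpm : ∀ s, Measurable (prolongPath (s := s) t) := fun s =>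
    (continuous_prolongPath s t).measurable
  have hrm : ∀ {s s' : ℝ≥0} (h : s ≤ s'), Measurable (restrictPath h) := fun h =>
    (continuous_restrictPath h).measurable
  have hprob : ∀ n, IsProbabilityMeasure (μ n) := fun n => by
    have := h.isProbabilityMeasure_bridgeLaw hx (hσt n)
    exact Measure.isProbabilityMeasure_map (hpm _).aemeasurable
  have hfc : ∀ n, Continuous (f n) := fun n =>
    continuous_cutPath.comp (continuous_const.prodMk continuous_id)
  have hfμ : ∀ n, (μ (n + 1)).map (f n) = μ n := fun n => by
    have hle := hσm n.le_succ
    dsimp only [μ]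
    rw [← h.map_bridgeLaw hx hle (hσt (n + 1)), Measure.map_map (hfc n).measurable (hpm _),
      Measure.map_map (hpm _) (hrm _)]
    congr 1
    ext w u
    have : min (min (u : ℝ≥0) (σ n)) (σ (n + 1)) = min (u : ℝ≥0) (σ n) :=
      min_eq_left ((min_le_right _ _).trans hle)
    simp [f, prolongPath, restrictPath, cutPath, this]
  have hff : ∀ n m, n ≤ m → ∀ w, f n (f m w) = f n w := fun n m hnm w =>
    cutPath_cutPath (hσm hnm) w
  have hbound : ∀ n, μ (n + 1) {w | (1 / 2 : ℝ) ^ n < dist (f n w) w} ≤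
      ENNReal.ofReal (56 * √t * (1 / 2) ^ n) / passageDensityNN ε t x := fun n => by
    have hOm : MeasurableSet {w | (1 / 2 : ℝ) ^ n < dist (f n w) w} :=
      (isOpen_lt continuous_const ((hfc n).dist continuous_id)).measurableSet
    have hη : (0 : ℝ≥0) < (1 / 2) ^ n := pow_pos (by norm_num) n
    have hfar := h.bridgeLaw_dist hx (hσm n.le_succ) (hσt (n + 1)) hη
    push_cast at hfar
    dsimp only [μ]
    rw [Measure.map_apply (hpm _) hOm]
    refine hfar.trans (ENNReal.div_le_div_right (ENNReal.ofReal_le_ofReal (le_of_eq ?_)) _)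
    have e1 : (t : ℝ) - σ n = t * ((1 / 16) ^ n) ^ 2 := by
      have : t * r ^ n ≤ t := mul_le_of_le_one_right zero_le (pow_le_one₀ zero_le hr1.le)
      rw [hσ, NNReal.coe_sub this, hr]
      push_cast
      rw [← pow_mul, mul_comm n 2, pow_mul]
      norm_num
    rw [e1, Real.sqrt_mul (NNReal.coe_nonneg t), Real.sqrt_sq (by positivity),
      ← pow_mul, mul_comm n 3, pow_mul, mul_div_assoc, mul_div_assoc, ← div_pow, mul_assoc]
    norm_num
  have hsum : ∑' n, μ (n + 1) {w | (1 / 2 : ℝ) ^ n < dist (f n w) w} ≠ ∞ := by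
    refine ne_top_of_le_ne_top ?_ (ENNReal.tsum_le_tsum hbound)
    simp only [div_eq_mul_inv _ (passageDensityNN ε t x)]
    rw [ENNReal.tsum_mul_right]
    refine ENNReal.mul_ne_top ?_ (ENNReal.inv_ne_top.2 (passageDensityNN_pos ht hx).ne')
    exact (summable_geometric_two.mul_left _).tsum_ofReal_ne_top
  obtain ⟨B, hB, hBf⟩ := exists_measure_forall_map_eq μ hfc hfμ hff hsum
  refine ⟨⟨B, hB⟩, fun s hst => ?_⟩
  obtain ⟨n, hn⟩ := (hσl.eventually (eventually_gt_nhds hst)).exists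
  have e1 : restrictPath hst.le = restrictPath (t := σ n) hn.le ∘ restrictPath (hσt n).le ∘ f n := by
    ext w u
    have : min (u : ℝ≥0) (σ n) = u := min_eq_left (u.2.2.trans hn.le)
    simp [f, cutPath, restrictPath, this]
  change B.map _ = _
  rw [e1, ← Measure.map_map (hrm _) ((hrm _).comp (hfc n).measurable),
    ← Measure.map_map (hrm _) (hfc n).measurable, hBf n]
  dsimp only [μ]
  have e2 : restrictPath (hσt n).le ∘ prolongPath t = id := by
    ext1 w
    exact restrictPath_prolongPath _ w
  rw [Measure.map_map (hrm _) (hpm _), e2, Measure.map_id]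
  exact h.map_bridgeLaw hx hn.le (hσt n)

end

section

/-! ### Stopped paths -/

theorem continuous_stopPath : Continuous fun p : ℝ≥0 × C(ℝ≥0, ℝ≥0) => stopPath p.1 p.2 := by
  refine ContinuousMap.continuous_of_continuous_uncurry _ ?_
  have : Continuous fun p : (ℝ≥0 × C(ℝ≥0, ℝ≥0)) × ℝ≥0 => p.1.2 (min p.2 p.1.1) := by fun_prop
  exact this

theorem continuous_extendPath (t : ℝ≥0) : Continuous (extendPath (t := t)) :=
  ContinuousMap.continuous_precomp
    (⟨fun u => ⟨min u t, zero_le, min_le_right _ _⟩, by fun_prop⟩ : C(ℝ≥0, Set.Icc 0 t))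

theorem stopPath_eq_extendPath (s : ℝ≥0) (w : C(ℝ≥0, ℝ≥0)) :
    stopPath s w = extendPath (w.restrict (Set.Icc 0 s)) := rfl

theorem stopPath_extendPath {s t : ℝ≥0} (h : s ≤ t) (w : C(Set.Icc 0 t, ℝ≥0)) :
    stopPath s (extendPath w) = extendPath (restrictPath h w) := by
  ext u
  have : min (min u s) t = min u s := min_eq_left ((min_le_right _ _).trans h)
  simp [stopPath, extendPath, restrictPath, this]

theorem stopPath_extendPath_self {t : ℝ≥0} (w : C(Set.Icc 0 t, ℝ≥0)) :
    stopPath t (extendPath w) = extendPath w := by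
  rw [stopPath_extendPath le_rfl]
  rfl

/-! ### The grid from below -/

/-- The index of the cell of the grid `ℕ / (n + 1)` which ends at or after `t`. -/
def gridIndex (n : ℕ) (t : ℝ≥0) : ℕ := ⌈t * (n + 1)⌉₊

/-- The largest point of the grid `ℕ / (n + 1)` smaller than `t`. -/
def gridFloor (n : ℕ) (t : ℝ≥0) : ℝ≥0 := (gridIndex n t - 1 : ℕ) / (n + 1)

theorem measurable_gridIndex (n : ℕ) : Measurable (gridIndex n) :=
  Nat.measurable_ceil.comp (measurable_id.mul_const _)

theorem measurable_gridFloor (n : ℕ) : Measurable (gridFloor n) :=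
  (measurable_from_nat (f := fun k : ℕ => ((k - 1 : ℕ) : ℝ≥0) / (n + 1))).comp
    (measurable_gridIndex n)

theorem gridIndex_pos {n : ℕ} {t : ℝ≥0} (ht : 0 < t) : 0 < gridIndex n t :=
  Nat.ceil_pos.2 (mul_pos ht (by positivity))

/-- The strict inequality puts the path up to the grid point within reach of the bridge law at a
time before t. It fails at t = 0, where truncated subtraction gives the value 0. -/
theorem gridFloor_lt (n : ℕ) {t : ℝ≥0} (ht : 0 < t) : gridFloor n t < t := by
  have h := gridIndex_pos (n := n) ht
  rw [gridFloor, div_lt_iff₀ (by positivity)]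
  exact Nat.lt_ceil.1 (show gridIndex n t - 1 < gridIndex n t by omega)

theorem le_gridFloor_add (n : ℕ) (t : ℝ≥0) : t ≤ gridFloor n t + 1 / (n + 1) := by
  rw [gridFloor, ← add_div, le_div_iff₀ (by positivity)]
  have h1 : gridIndex n t ≤ gridIndex n t - 1 + 1 := by omega
  have h2 : t * (n + 1) ≤ (gridIndex n t : ℝ≥0) := Nat.le_ceil (t * (n + 1))
  exact h2.trans (by exact_mod_cast h1)

theorem tendsto_gridFloor {t : ℝ≥0} (ht : 0 < t) :
    Tendsto (fun n => gridFloor n t) atTop (𝓝 t) := by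
  have h : Tendsto (fun n : ℕ => 1 / ((n : ℝ≥0) + 1)) atTop (𝓝 0) :=
    tendsto_one_div_add_atTop_nhds_zero_nat
  have h1 := (tendsto_const_nhds (x := t)).sub h
  rw [tsub_zero] at h1
  exact tendsto_of_tendsto_of_tendsto_of_le_of_le h1 tendsto_const_nhds
    (fun n => tsub_le_iff_right.2 (le_gridFloor_add n t)) fun n => (gridFloor_lt n ht).le

theorem iUnion_gridIndex (n : ℕ) : ⋃ k : ℕ, {t | gridIndex n t = k + 1} = Set.Ioi 0 := by
  ext t
  simp only [Set.mem_iUnion, Set.mem_ofPred_eq, Set.mem_Ioi]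
  constructor
  · rintro ⟨k, hk⟩
    have : 0 < gridIndex n t := by omega
    by_contra h0
    rw [not_lt, nonpos_iff_eq_zero] at h0
    simp [gridIndex, h0] at this
  · intro ht
    have := gridIndex_pos (n := n) ht
    exact ⟨gridIndex n t - 1, by omega⟩

theorem gridFloor_eq {n k : ℕ} {t : ℝ≥0} (h : gridIndex n t = k + 1) :
    gridFloor n t = k / (n + 1) := by
  rw [gridFloor, h, Nat.add_sub_cancel]

theorem lintegral_lebNN_add (s : ℝ≥0) {f : ℝ≥0 → ℝ≥0∞} (hf : Measurable f) :
    ∫⁻ t, f (s + t) ∂lebNN = ∫⁻ t in Set.Ioi s, f t ∂lebNN := by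
  rw [lintegral_lebNN (f := fun t => f (s + t)) (by fun_prop),
    ← lintegral_indicator (s := Set.Ioi s) measurableSet_Ioi,
    lintegral_lebNN (hf.indicator measurableSet_Ioi)]
  have e : ∀ z ∈ Set.Ioi (0 : ℝ), (Set.Ioi s).indicator f z.toNNReal =
      (Set.Ioi (s : ℝ)).indicator (fun z => f z.toNNReal) z := fun z _ => by
    simp only [Set.indicator, Set.mem_Ioi, Real.lt_toNNReal_iff_coe_lt]
  rw [setLIntegral_congr_fun measurableSet_Ioi e,
    setLIntegral_indicator (s := Set.Ioi (s : ℝ)) measurableSet_Ioi,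
    Set.inter_eq_left.2 (Set.Ioi_subset_Ioi (NNReal.coe_nonneg s)), setLIntegral_Ioi_eq_add (s : ℝ)]
  refine setLIntegral_congr_fun measurableSet_Ioi fun z hz => ?_
  have hz : 0 < z := hz
  simp only [Real.toNNReal_add (NNReal.coe_nonneg s) hz.le, Real.toNNReal_coe]

/-! ### Conditioning on the passage time -/

variable {Ω : Type*} {R : Ω → C(ℝ≥0, ℝ≥0)} {x ε : ℝ≥0} [MeasurableSpace Ω] {P : Measure Ω}

/-- `IsBesselNegOne.lintegral_passageTime` is the case of indicators of rectangles S × A, and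
rectangles determine finite measures on the product. -/
theorem IsBesselNegOne.lintegral_passageTime_restrict (h : IsBesselNegOne R x P) (hx : ε < x)
    {s : ℝ≥0} {f : ℝ≥0 × C(Set.Icc 0 s, ℝ≥0) → ℝ≥0∞} (hf : Measurable f) :
    ∫⁻ ω in alive R ε s, f ((passageTime ε (R ω)).toNNReal, (R ω).restrict (Set.Icc 0 s)) ∂P =
      ∫⁻ t, (∫⁻ ω in alive R ε s, f (s + t, (R ω).restrict (Set.Icc 0 s)) *
        passageDensityNN ε t (R ω s) ∂P) ∂lebNN := by
  have := h.isProbabilityMeasure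
  have hTm : Measurable fun ω => (passageTime ε (R ω)).toNNReal :=
    ((measurable_passageTime ε).comp h.measurable).ennreal_toNNReal
  have hRm := measurable_apply h.measurable s
  have hr := measurable_restrict h.measurable s
  have hal := pathSigma_le h.measurable _ _ (measurableSet_alive R ε s)
  have hg1 : Measurable fun ω => ((passageTime ε (R ω)).toNNReal, (R ω).restrict (Set.Icc 0 s)) :=
    hTm.prodMk hr
  have hg2 : Measurable fun p : ℝ≥0 × Ω => (s + p.1, (R p.2).restrict (Set.Icc 0 s)) :=
    (measurable_fst.const_add s).prodMk (hr.comp measurable_snd)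
  have hd : Measurable fun p : ℝ≥0 × Ω => passageDensityNN ε p.1 (R p.2 s) :=
    measurable_passageDensityNN ε measurable_fst (hRm.comp measurable_snd)
  have key : (P.restrict (alive R ε s)).map
      (fun ω => ((passageTime ε (R ω)).toNNReal, (R ω).restrict (Set.Icc 0 s))) =
      ((lebNN.prod (P.restrict (alive R ε s))).withDensity
        fun p => passageDensityNN ε p.1 (R p.2 s)).map
        fun p => (s + p.1, (R p.2).restrict (Set.Icc 0 s)) := by
    refine Measure.ext_prod fun {S A} hS hA => ?_
    have hA' : MeasurableSet ((fun ω => (R ω).restrict (Set.Icc 0 s)) ⁻¹' A) := hr hA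
    have e1 := h.lintegral_passageTime hx (A := (fun ω => (R ω).restrict (Set.Icc 0 s)) ⁻¹' A)
      ⟨A, hA, rfl⟩ (measurable_one.indicator hS)
    have hpre := hg2 (hS.prod hA)
    rw [Measure.map_apply hg1 (hS.prod hA), Measure.map_apply hg2 (hS.prod hA),
      withDensity_apply _ hpre, ← lintegral_indicator hpre,
      lintegral_prod _ (hd.indicator hpre).aemeasurable,
      ← lintegral_indicator_one (hg1 (hS.prod hA))]
    rw [← Measure.restrict_restrict hA', ← lintegral_indicator hA'] at e1
    refine Eq.trans (lintegral_congr fun ω => ?_) (e1.trans (lintegral_congr fun t => ?_))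
    · by_cases h1 : ω ∈ (fun ω => (R ω).restrict (Set.Icc 0 s)) ⁻¹' A
      · rw [Set.indicator_of_mem h1]
        have h1 : (R ω).restrict (Set.Icc 0 s) ∈ A := h1
        by_cases h2 : (passageTime ε (R ω)).toNNReal ∈ S
        · rw [Set.indicator_of_mem h2, Set.indicator_of_mem]
          · rfl
          · exact Set.mk_mem_prod h2 h1
        · rw [Set.indicator_of_notMem h2, Set.indicator_of_notMem]
          exact fun h3 => h2 h3.1
      · rw [Set.indicator_of_notMem h1, Set.indicator_of_notMem]
        exact fun h2 => h1 h2.2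
    · rw [← lintegral_indicator hA', ← lintegral_const_mul _
        ((measurable_passageDensityNN ε measurable_const hRm).indicator hA')]
      refine lintegral_congr fun ω => ?_
      by_cases h1 : ω ∈ (fun ω => (R ω).restrict (Set.Icc 0 s)) ⁻¹' A
      · rw [Set.indicator_of_mem h1]
        have h1 : (R ω).restrict (Set.Icc 0 s) ∈ A := h1
        by_cases h2 : s + t ∈ S
        · rw [Set.indicator_of_mem h2, Set.indicator_of_mem, Pi.one_apply, one_mul]
          exact Set.mk_mem_prod h2 h1
        · rw [Set.indicator_of_notMem h2, Set.indicator_of_notMem, zero_mul]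
          exact fun h3 => h2 h3.1
      · rw [Set.indicator_of_notMem h1, mul_zero, Set.indicator_of_notMem]
        exact fun h2 : (s + t, (R ω).restrict (Set.Icc 0 s)) ∈ S ×ˢ A => h1 h2.2
  have e := congrArg (fun μ => ∫⁻ p, f p ∂μ) key
  beta_reduce at e
  have hf2 : Measurable fun p : ℝ≥0 × Ω => f (s + p.1, (R p.2).restrict (Set.Icc 0 s)) :=
    hf.comp hg2
  rw [lintegral_map hf hg1, lintegral_map hf hg2, lintegral_withDensity_eq_lintegral_mul _ hd hf2,
    lintegral_prod _ (hd.mul hf2).aemeasurable] at e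
  rw [e]
  simp only [Pi.mul_apply, mul_comm]

theorem IsBesselNegOne.lintegral_bridgeLaw (h : IsBesselNegOne R x P) (hx : ε < x) {s t : ℝ≥0}
    (hst : s < t) {G : C(Set.Icc 0 s, ℝ≥0) → ℝ≥0∞} (hG : Measurable G) :
    ∫⁻ ω in alive R ε s, G ((R ω).restrict (Set.Icc 0 s)) *
        passageDensityNN ε (t - s) (R ω s) ∂P =
      passageDensityNN ε t x * ∫⁻ v, G v ∂(bridgeLaw R P x ε s t) := by
  have hr := measurable_restrict h.measurable s
  have hal := pathSigma_le h.measurable _ _ (measurableSet_alive R ε s)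
  have hbd := measurable_bridgeDensity x ε s t
  have hc := passageDensityNN_pos (pos_of_gt hst) hx
  have hm : Measurable fun ω => (bridgeDensity x ε s t * G) ((R ω).restrict (Set.Icc 0 s)) :=
    (hbd.mul hG).comp hr
  rw [bridgeLaw, lintegral_withDensity_eq_lintegral_mul _ hbd hG, lintegral_map (hbd.mul hG) hr,
    ← lintegral_const_mul _ hm, ← lintegral_indicator hal]
  refine lintegral_congr_ae ?_
  filter_upwards [h.lt_start hx] with ω hω
  rw [Pi.mul_apply, bridgeDensity_restrict hx hst hω]
  by_cases hω' : ω ∈ alive R ε s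
  · rw [Set.indicator_of_mem hω', Set.indicator_of_mem hω', ← mul_assoc,
      ENNReal.mul_div_cancel hc.ne' passageDensityNN_ne_top, mul_comm]
  · rw [Set.indicator_of_notMem hω', Set.indicator_of_notMem hω', zero_mul, mul_zero]

theorem IsBesselNegOne.measurable_lintegral_bridgeLaw (h : IsBesselNegOne R x P) {s : ℝ≥0}
    {f : ℝ≥0 × C(Set.Icc 0 s, ℝ≥0) → ℝ≥0∞} (hf : Measurable f) :
    Measurable fun t => ∫⁻ v, f (t, v) ∂(bridgeLaw R P x ε s t) := by
  have := h.isProbabilityMeasure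
  have hr := measurable_restrict h.measurable s
  have hbd : Measurable fun p : ℝ≥0 × C(Set.Icc 0 s, ℝ≥0) => bridgeDensity x ε s p.1 p.2 := by
    have := measurable_endpoint (s := s)
    unfold bridgeDensity
    refine Measurable.ite ?_ ?_ measurable_const
    · exact measurable_snd (isOpen_setOf_lt ε s).measurableSet
    · fun_prop
  have e : ∀ t, ∫⁻ v, f (t, v) ∂(bridgeLaw R P x ε s t) =
      ∫⁻ v, bridgeDensity x ε s t v * f (t, v)
        ∂(P.map fun ω => (R ω).restrict (Set.Icc 0 s)) := fun t => by
    rw [bridgeLaw, lintegral_withDensity_eq_lintegral_mul _ (measurable_bridgeDensity x ε s t)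
      (g := fun v => f (t, v)) (hf.comp measurable_prodMk_left)]
    rfl
  simp_rw [e]
  have : IsProbabilityMeasure (P.map fun ω => (R ω).restrict (Set.Icc 0 s)) :=
    Measure.isProbabilityMeasure_map hr.aemeasurable
  exact (hbd.mul hf).lintegral_prod_right'

/-- Translating the remaining duration by s turns the conditional density of T_ε into r_{t-s}(R_s,
ε), which is r_t(x, ε) times the density defining `bridgeLaw`. -/
theorem IsBesselNegOne.setLIntegral_passageTime_bridgeLaw (h : IsBesselNegOne R x P) (hx : ε < x)
    {s : ℝ≥0} {f : ℝ≥0 × C(Set.Icc 0 s, ℝ≥0) → ℝ≥0∞} (hf : Measurable f) {S : Set ℝ≥0}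
    (hS : MeasurableSet S) (hSs : ∀ t ∈ S, s < t) :
    ∫⁻ ω in {ω | (passageTime ε (R ω)).toNNReal ∈ S},
        f ((passageTime ε (R ω)).toNNReal, (R ω).restrict (Set.Icc 0 s)) ∂P =
      ∫⁻ t in S, passageDensityNN ε t x * ∫⁻ v, f (t, v) ∂(bridgeLaw R P x ε s t) ∂lebNN := by
  have := h.isProbabilityMeasure
  have hTm : Measurable fun ω => (passageTime ε (R ω)).toNNReal :=
    ((measurable_passageTime ε).comp h.measurable).ennreal_toNNReal
  have hRm := measurable_apply h.measurable s
  have hr := measurable_restrict h.measurable s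
  have hal := pathSigma_le h.measurable _ _ (measurableSet_alive R ε s)
  have hSm : MeasurableSet {ω | (passageTime ε (R ω)).toNNReal ∈ S} := hTm hS
  have hS' : MeasurableSet {p : ℝ≥0 × C(Set.Icc 0 s, ℝ≥0) | p.1 ∈ S} := measurable_fst hS
  have e1 := h.lintegral_passageTime_restrict hx (hf.indicator hS')
  have e2 : ∫⁻ ω in alive R ε s, {p : ℝ≥0 × C(Set.Icc 0 s, ℝ≥0) | p.1 ∈ S}.indicator f
      ((passageTime ε (R ω)).toNNReal, (R ω).restrict (Set.Icc 0 s)) ∂P =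
      ∫⁻ ω in {ω | (passageTime ε (R ω)).toNNReal ∈ S},
        f ((passageTime ε (R ω)).toNNReal, (R ω).restrict (Set.Icc 0 s)) ∂P := by
    rw [← lintegral_indicator hal, ← lintegral_indicator hSm]
    refine lintegral_congr fun ω => ?_
    by_cases h1 : ω ∈ {ω | (passageTime ε (R ω)).toNNReal ∈ S}
    · have h2 : ω ∈ alive R ε s := by
        refine lt_of_lt_of_le (ENNReal.coe_lt_coe.2 (hSs _ h1)) ENNReal.coe_toNNReal_le_self
      rw [Set.indicator_of_mem h1, Set.indicator_of_mem h2, Set.indicator_of_mem]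
      exact h1
    · have h2 : ((passageTime ε (R ω)).toNNReal, (R ω).restrict (Set.Icc 0 s)) ∉
          {p : ℝ≥0 × C(Set.Icc 0 s, ℝ≥0) | p.1 ∈ S} := h1
      rw [Set.indicator_of_notMem h1, Set.indicator_apply_eq_zero]
      exact fun _ => Set.indicator_of_notMem h2 _
  have hg : Measurable fun t => ∫⁻ ω in alive R ε s,
      {p : ℝ≥0 × C(Set.Icc 0 s, ℝ≥0) | p.1 ∈ S}.indicator f (t, (R ω).restrict (Set.Icc 0 s)) *
        passageDensityNN ε (t - s) (R ω s) ∂P := by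
    refine Measurable.lintegral_prod_right' (ν := P.restrict (alive R ε s))
      (f := fun p : ℝ≥0 × Ω => {p : ℝ≥0 × C(Set.Icc 0 s, ℝ≥0) | p.1 ∈ S}.indicator f
        (p.1, (R p.2).restrict (Set.Icc 0 s)) * passageDensityNN ε (p.1 - s) (R p.2 s)) ?_
    exact ((hf.indicator hS').comp (measurable_fst.prodMk (hr.comp measurable_snd))).mul
      (measurable_passageDensityNN ε (measurable_fst.sub_const s) (hRm.comp measurable_snd))
  rw [← e2, e1]
  have e3 := lintegral_lebNN_add s hg
  simp only [add_tsub_cancel_left] at e3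
  have e4 : lebNN.restrict S = lebNN.restrict (S ∩ Set.Ioi s) := by
    rw [Set.inter_eq_left.2 (show S ⊆ Set.Ioi s from hSs)]
  rw [e3, e4, ← setLIntegral_indicator hS]
  refine setLIntegral_congr_fun measurableSet_Ioi fun t ht => ?_
  by_cases htS : t ∈ S
  · rw [Set.indicator_of_mem htS,
      ← h.lintegral_bridgeLaw hx ht (G := fun v => f (t, v)) (hf.comp measurable_prodMk_left)]
    simp only [Set.indicator, Set.mem_ofPred_eq, htS, if_true]
  · rw [Set.indicator_of_notMem htS]
    simp [Set.indicator, htS]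

/-! ### The regular conditional distributions -/

section Regular

variable {B : (t : ℝ≥0) → ProbabilityMeasure C(Set.Icc 0 t, ℝ≥0)}

theorem lintegral_stopPath_bridge
    (hB : ∀ (s t : ℝ≥0) (hst : s < t), (B t : Measure C(Set.Icc 0 t, ℝ≥0)).map
      (restrictPath hst.le) = bridgeLaw R P x ε s t) {s t : ℝ≥0} (hst : s < t)
    {φ : C(ℝ≥0, ℝ≥0) → ℝ≥0∞} (hφ : Measurable φ) :
    ∫⁻ w, φ (stopPath s (extendPath w)) ∂(B t : Measure C(Set.Icc 0 t, ℝ≥0)) =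
      ∫⁻ v, φ (extendPath v) ∂(bridgeLaw R P x ε s t) := by
  rw [← hB s t hst, lintegral_map (f := fun v => φ (extendPath v)) (hφ.comp (continuous_extendPath s).measurable)
    (continuous_restrictPath hst.le).measurable]
  simp only [stopPath_extendPath hst.le]

/-- The measures B t live on different spaces, so measurability in t cannot be asked directly. On
one cell of the grid the cut time is fixed and the integral is against `bridgeLaw`, whose density
depends measurably on t. Index 0 is the single point t = 0. -/
theorem IsBesselNegOne.measurable_lintegral_stopPath (h : IsBesselNegOne R x P)
    (hB : ∀ (s t : ℝ≥0) (hst : s < t), (B t : Measure C(Set.Icc 0 t, ℝ≥0)).map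
      (restrictPath hst.le) = bridgeLaw R P x ε s t) (n : ℕ)
    {φ : ℝ≥0 × C(ℝ≥0, ℝ≥0) → ℝ≥0∞} (hφ : Measurable φ) :
    Measurable fun t : ℝ≥0 => ∫⁻ w, φ (t, stopPath (gridFloor n t) (extendPath w))
      ∂(B t : Measure C(Set.Icc 0 t, ℝ≥0)) := by
  let g : ℕ → ℝ≥0 → ℝ≥0∞ := fun m t => match m with
    | 0 => ∫⁻ w, φ (0, stopPath (gridFloor n 0) (extendPath w))
      ∂(B 0 : Measure C(Set.Icc (0 : ℝ≥0) 0, ℝ≥0))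
    | k + 1 => ∫⁻ v, φ (t, extendPath v) ∂(bridgeLaw R P x ε (k / (n + 1)) t)
  have hg : Measurable fun p : ℕ × ℝ≥0 => g p.1 p.2 := by
    refine measurable_from_prod_countable_right fun m => ?_
    match m with
    | 0 => exact measurable_const
    | k + 1 => exact h.measurable_lintegral_bridgeLaw (hφ.comp (measurable_fst.prodMk
        ((continuous_extendPath _).measurable.comp measurable_snd)))
  have e : (fun t : ℝ≥0 => ∫⁻ w, φ (t, stopPath (gridFloor n t) (extendPath w))
      ∂(B t : Measure C(Set.Icc 0 t, ℝ≥0))) = fun t => g (gridIndex n t) t := by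
    funext t
    rcases eq_zero_or_pos t with rfl | ht
    · have : gridIndex n 0 = 0 := by simp [gridIndex]
      rw [this]
    · have h1 := gridIndex_pos (n := n) ht
      obtain ⟨k, hk⟩ := Nat.exists_eq_succ_of_ne_zero h1.ne'
      have h2 := gridFloor_lt n ht
      rw [lintegral_stopPath_bridge hB h2 (φ := fun w => φ (t, w)) (hφ.comp measurable_prodMk_left),
        gridFloor_eq hk, hk]
  rw [e]
  exact hg.comp ((measurable_gridIndex n).prodMk measurable_id)

/-- Summation over the cells, on each of which the cut time is deterministic and strictly before the
passage time. T = 0 and t = 0 are negligible for P and for `lebNN`. -/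
theorem IsBesselNegOne.lintegral_stopPath_gridFloor (h : IsBesselNegOne R x P) (hx : ε < x)
    (hB : ∀ (s t : ℝ≥0) (hst : s < t), (B t : Measure C(Set.Icc 0 t, ℝ≥0)).map
      (restrictPath hst.le) = bridgeLaw R P x ε s t) (n : ℕ)
    {φ : ℝ≥0 × C(ℝ≥0, ℝ≥0) → ℝ≥0∞} (hφ : Measurable φ) :
    ∫⁻ ω, φ ((passageTime ε (R ω)).toNNReal,
        stopPath (gridFloor n (passageTime ε (R ω)).toNNReal) (R ω)) ∂P =
      ∫⁻ t, passageDensityNN ε t x * ∫⁻ w, φ (t, stopPath (gridFloor n t) (extendPath w))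
        ∂(B t : Measure C(Set.Icc 0 t, ℝ≥0)) ∂lebNN := by
  have hTm : Measurable fun ω => (passageTime ε (R ω)).toNNReal :=
    ((measurable_passageTime ε).comp h.measurable).ennreal_toNNReal
  have hSm : ∀ k : ℕ, MeasurableSet {t | gridIndex n t = k + 1} := fun k =>
    measurable_gridIndex n (measurableSet_singleton _)
  have hdisj : Pairwise (Function.onFun Disjoint fun k : ℕ => {t | gridIndex n t = k + 1}) := by
    intro k l hkl
    refine Set.disjoint_left.2 fun t h1 h2 => hkl ?_
    have h1 : gridIndex n t = k + 1 := h1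
    have h2 : gridIndex n t = l + 1 := h2
    omega
  have hT0 : ∀ᵐ ω ∂P, ω ∈ ⋃ k : ℕ, {ω | (passageTime ε (R ω)).toNNReal ∈
      {t | gridIndex n t = k + 1}} := by
    filter_upwards [h.ae_mem_alive_zero hx, h.passageTime_ne_top hx] with ω h1 h2
    have h3 : (passageTime ε (R ω)).toNNReal ∈ Set.Ioi 0 :=
      ENNReal.toNNReal_pos (ne_of_gt (by simpa [alive] using h1)) h2
    rw [← iUnion_gridIndex n] at h3
    simpa using h3
  have hl0 : ∀ᵐ t ∂lebNN, t ∈ ⋃ k : ℕ, {t | gridIndex n t = k + 1} := by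
    rw [iUnion_gridIndex n, ae_iff]
    refine measure_mono_null (t := {0}) (fun t ht => ?_) (lebNN_singleton 0)
    simpa using ht
  rw [← Measure.restrict_eq_self_of_ae_mem hT0, ← Measure.restrict_eq_self_of_ae_mem hl0,
    lintegral_iUnion (s := fun k : ℕ => {ω | (passageTime ε (R ω)).toNNReal ∈
      {t | gridIndex n t = k + 1}}) (fun k => hTm (hSm k)) fun k l hkl => (hdisj hkl).preimage _,
    lintegral_iUnion hSm hdisj]
  refine tsum_congr fun k => ?_
  have hlt : ∀ t ∈ {t | gridIndex n t = k + 1}, ((k / (n + 1) : ℝ≥0)) < t := fun t ht => by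
    rw [← gridFloor_eq ht]
    refine gridFloor_lt n ?_
    have : t ∈ Set.Ioi 0 := by
      rw [← iUnion_gridIndex n]
      exact Set.mem_iUnion.2 ⟨k, ht⟩
    exact this
  have e := h.setLIntegral_passageTime_bridgeLaw hx
    (f := fun p : ℝ≥0 × C(Set.Icc 0 (k / (n + 1) : ℝ≥0), ℝ≥0) => φ (p.1, extendPath p.2))
    (hφ.comp (measurable_fst.prodMk ((continuous_extendPath _).measurable.comp measurable_snd)))
    (hSm k) hlt
  refine Eq.trans (setLIntegral_congr_fun (hTm (hSm k)) fun ω hω => ?_)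
    (e.trans (setLIntegral_congr_fun (hSm k) fun t ht => ?_))
  · simp only [gridFloor_eq hω, stopPath_eq_extendPath]
  · simp only [gridFloor_eq ht]
    rw [lintegral_stopPath_bridge hB (hlt t ht) (φ := fun w => φ (t, w))
      (hφ.comp measurable_prodMk_left)]

theorem tendsto_lintegral_stopPath (φ : ℝ≥0 × C(ℝ≥0, ℝ≥0) → ℝ≥0) (hφ : Continuous φ) {C : ℝ≥0}
    (hC : ∀ p, φ p ≤ C) {t : ℝ≥0} (ht : 0 < t) :
    Tendsto (fun n => ∫⁻ w, φ (t, stopPath (gridFloor n t) (extendPath w))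
      ∂(B t : Measure C(Set.Icc 0 t, ℝ≥0))) atTop
      (𝓝 (∫⁻ w, φ (t, extendPath w) ∂(B t : Measure C(Set.Icc 0 t, ℝ≥0)))) := by
  have hst : ∀ n, Continuous fun w : C(Set.Icc 0 t, ℝ≥0) => stopPath (gridFloor n t) (extendPath w) :=
    fun n => continuous_stopPath.comp (continuous_const.prodMk (continuous_extendPath t))
  refine tendsto_lintegral_of_dominated_convergence (fun _ => C) (fun n => ?_) (fun n => ?_) ?_ ?_
  · exact (hφ.comp (continuous_const.prodMk (hst n))).measurable.coe_nnreal_ennreal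
  · exact Eventually.of_forall fun w => ENNReal.coe_le_coe.2 (hC _)
  · rw [lintegral_const]
    exact ENNReal.mul_ne_top ENNReal.coe_ne_top (measure_ne_top _ _)
  · refine Eventually.of_forall fun w => ENNReal.tendsto_coe.2 ?_
    have h1 : Tendsto (fun n => stopPath (gridFloor n t) (extendPath w)) atTop
        (𝓝 (stopPath t (extendPath w))) :=
      (continuous_stopPath.tendsto (t, extendPath w)).comp
        ((tendsto_gridFloor ht).prodMk_nhds tendsto_const_nhds)
    rw [stopPath_extendPath_self] at h1
    exact (hφ.tendsto (t, extendPath w)).comp (tendsto_const_nhds.prodMk_nhds h1)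

/-- Closed sets form a generating π-system and are limits of continuous functions. For these the
integral against B t is the limit of the integrals along paths cut at grid points, which are
measurable in t. -/
theorem IsBesselNegOne.measurable_bridge (h : IsBesselNegOne R x P)
    (hB : ∀ (s t : ℝ≥0) (hst : s < t), (B t : Measure C(Set.Icc 0 t, ℝ≥0)).map
      (restrictPath hst.le) = bridgeLaw R P x ε s t) :
    Measurable fun t : ℝ≥0 => (B t : Measure C(Set.Icc 0 t, ℝ≥0)).map extendPath := by
  have hem : ∀ t : ℝ≥0, Measurable (extendPath (t := t)) := fun t =>
    (continuous_extendPath t).measurable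
  have : ∀ t : ℝ≥0, IsProbabilityMeasure ((B t : Measure C(Set.Icc 0 t, ℝ≥0)).map extendPath) :=
    fun t => Measure.isProbabilityMeasure_map (hem t).aemeasurable
  refine Measurable.measure_of_isPiSystem_of_isProbabilityMeasure
    (S := {F : Set C(ℝ≥0, ℝ≥0) | IsClosed F}) ?_ isPiSystem_isClosed fun F hF => ?_
  · rw [← borel_eq_generateFrom_isClosed]
    exact BorelSpace.measurable_eq
  · have hφ : ∀ (m : ℕ) (t : ℝ≥0), ∫⁻ w, (hF.apprSeq m w : ℝ≥0∞)
        ∂((B t : Measure C(Set.Icc 0 t, ℝ≥0)).map extendPath) =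
        ∫⁻ w, hF.apprSeq m (extendPath w) ∂(B t : Measure C(Set.Icc 0 t, ℝ≥0)) := fun m t =>
      lintegral_map (hF.apprSeq m).continuous.measurable.coe_nnreal_ennreal (hem t)
    refine measurable_of_tendsto_metrizable (f := fun (m : ℕ) (t : ℝ≥0) => ∫⁻ w, (hF.apprSeq m w : ℝ≥0∞)
      ∂((B t : Measure C(Set.Icc 0 t, ℝ≥0)).map extendPath)) (fun m => ?_)
      (tendsto_pi_nhds.2 fun t => HasOuterApproxClosed.tendsto_lintegral_apprSeq hF _)
    simp_rw [hφ]
    -- The point t = 0, where B is unconstrained, is split off and treated as a constant on a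
    -- singleton.
    have hlim : ∀ t : ℝ≥0, Tendsto (fun n => ({0} : Set ℝ≥0)ᶜ.indicator (fun t : ℝ≥0 => ∫⁻ w,
        (hF.apprSeq m (stopPath (gridFloor n t) (extendPath w)) : ℝ≥0∞)
          ∂(B t : Measure C(Set.Icc 0 t, ℝ≥0))) t) atTop (𝓝 (({0} : Set ℝ≥0)ᶜ.indicator (fun t : ℝ≥0 =>
          ∫⁻ w, (hF.apprSeq m (extendPath w) : ℝ≥0∞) ∂(B t : Measure C(Set.Icc 0 t, ℝ≥0))) t)) :=
        fun t => by
      rcases eq_zero_or_pos t with rfl | ht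
      · simp
      · have h1 : t ∈ ({0} : Set ℝ≥0)ᶜ := ht.ne'
        simp only [Set.indicator_of_mem h1]
        exact tendsto_lintegral_stopPath (fun p => hF.apprSeq m p.2)
          ((hF.apprSeq m).continuous.comp continuous_snd)
          (fun p => HasOuterApproxClosed.apprSeq_apply_le_one hF m p.2) ht
    have hmeas := measurable_of_tendsto_metrizable (fun n =>
      (h.measurable_lintegral_stopPath hB n (φ := fun p => (hF.apprSeq m p.2 : ℝ≥0∞))
        ((hF.apprSeq m).continuous.measurable.coe_nnreal_ennreal.comp measurable_snd)).indicator
        (measurableSet_singleton (0 : ℝ≥0)).compl) (tendsto_pi_nhds.2 hlim)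
    have hmeas0 : Measurable (({0} : Set ℝ≥0).indicator (fun t : ℝ≥0 =>
        ∫⁻ w, (hF.apprSeq m (extendPath w) : ℝ≥0∞) ∂(B t : Measure C(Set.Icc 0 t, ℝ≥0)))) := by
      have : ({0} : Set ℝ≥0).indicator (fun t : ℝ≥0 =>
          ∫⁻ w, (hF.apprSeq m (extendPath w) : ℝ≥0∞) ∂(B t : Measure C(Set.Icc 0 t, ℝ≥0))) =
          ({0} : Set ℝ≥0).indicator fun _ => ∫⁻ w, (hF.apprSeq m (extendPath w) : ℝ≥0∞)
            ∂(B 0 : Measure C(Set.Icc (0 : ℝ≥0) 0, ℝ≥0)) := by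
        funext t
        by_cases h0 : t = 0
        · subst h0; rfl
        · simp [Set.indicator, h0]
      rw [this]
      exact measurable_const.indicator (measurableSet_singleton 0)
    have := hmeas.add hmeas0
    rwa [Set.indicator_compl_add_self] at this

/-- Refine the grid in `IsBesselNegOne.lintegral_stopPath_gridFloor`: the cut times increase to the
passage time, stopping is continuous in time, and φ is bounded and continuous. -/
theorem IsBesselNegOne.lintegral_stopPath_passageTime (h : IsBesselNegOne R x P) (hx : ε < x)
    (hB : ∀ (s t : ℝ≥0) (hst : s < t), (B t : Measure C(Set.Icc 0 t, ℝ≥0)).map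
      (restrictPath hst.le) = bridgeLaw R P x ε s t)
    (φ : BoundedContinuousFunction (ℝ≥0 × C(ℝ≥0, ℝ≥0)) ℝ≥0) :
    ∫⁻ ω, φ ((passageTime ε (R ω)).toNNReal, stopPath (passageTime ε (R ω)).toNNReal (R ω)) ∂P =
      ∫⁻ t, passageDensityNN ε t x * ∫⁻ w, (φ (t, extendPath w) : ℝ≥0∞)
        ∂(B t : Measure C(Set.Icc 0 t, ℝ≥0)) ∂lebNN := by
  have := h.isProbabilityMeasure
  have hTm : Measurable fun ω => (passageTime ε (R ω)).toNNReal :=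
    ((measurable_passageTime ε).comp h.measurable).ennreal_toNNReal
  have hdm : Measurable fun t => passageDensityNN ε t x :=
    measurable_passageDensityNN ε measurable_id measurable_const
  have hst : ∀ {τ : Ω → ℝ≥0}, Measurable τ → Measurable fun ω => stopPath (τ ω) (R ω) :=
    fun hτ => continuous_stopPath.measurable.comp (hτ.prodMk h.measurable)
  have hφm : Measurable fun p => (φ p : ℝ≥0∞) := φ.continuous.measurable.coe_nnreal_ennreal
  have hφC : ∀ p, φ p ≤ nndist φ 0 := fun p =>
    BoundedContinuousFunction.NNReal.upper_bound φ p
  have hlim1 : Tendsto (fun n => ∫⁻ ω, (φ ((passageTime ε (R ω)).toNNReal,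
      stopPath (gridFloor n (passageTime ε (R ω)).toNNReal) (R ω)) : ℝ≥0∞) ∂P) atTop
      (𝓝 (∫⁻ ω, φ ((passageTime ε (R ω)).toNNReal,
        stopPath (passageTime ε (R ω)).toNNReal (R ω)) ∂P)) := by
    refine tendsto_lintegral_of_dominated_convergence (fun _ => (nndist φ 0 : ℝ≥0))
      (fun n => hφm.comp (hTm.prodMk (hst ((measurable_gridFloor n).comp hTm))))
      (fun n => Eventually.of_forall fun ω => ENNReal.coe_le_coe.2 (hφC _)) ?_ ?_
    · rw [lintegral_const]
      exact ENNReal.mul_ne_top ENNReal.coe_ne_top (measure_ne_top _ _)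
    · filter_upwards [h.ae_mem_alive_zero hx, h.passageTime_ne_top hx] with ω h1 h2
      have h3 : 0 < (passageTime ε (R ω)).toNNReal :=
        ENNReal.toNNReal_pos (ne_of_gt (by simpa [alive] using h1)) h2
      refine ENNReal.tendsto_coe.2 ((φ.continuous.tendsto _).comp
        (tendsto_const_nhds.prodMk_nhds ?_))
      exact (continuous_stopPath.tendsto (_, R ω)).comp
        ((tendsto_gridFloor h3).prodMk_nhds tendsto_const_nhds)
  have hlim2 : Tendsto (fun n => ∫⁻ t, passageDensityNN ε t x * ∫⁻ w,
      (φ (t, stopPath (gridFloor n t) (extendPath w)) : ℝ≥0∞)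
        ∂(B t : Measure C(Set.Icc 0 t, ℝ≥0)) ∂lebNN) atTop
      (𝓝 (∫⁻ t, passageDensityNN ε t x * ∫⁻ w, (φ (t, extendPath w) : ℝ≥0∞)
        ∂(B t : Measure C(Set.Icc 0 t, ℝ≥0)) ∂lebNN)) := by
    refine tendsto_lintegral_of_dominated_convergence
      (fun t => passageDensityNN ε t x * (nndist φ 0 : ℝ≥0)) (fun n => ?_) (fun n => ?_) ?_ ?_
    · exact hdm.mul (h.measurable_lintegral_stopPath hB n hφm)
    · refine Eventually.of_forall fun t => mul_le_mul_right ?_ _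
      refine (lintegral_mono fun w => ENNReal.coe_le_coe.2 (hφC _)).trans ?_
      rw [lintegral_const, measure_univ, mul_one]
    · rw [lintegral_mul_const _ hdm, lintegral_passageDensityNN hx, one_mul]
      exact ENNReal.coe_ne_top
    · have h0 : ∀ᵐ t ∂lebNN, t ≠ 0 := by
        rw [ae_iff]
        simp
      filter_upwards [h0] with t ht
      refine ENNReal.Tendsto.const_mul ?_ (Or.inr passageDensityNN_ne_top)
      exact tendsto_lintegral_stopPath φ φ.continuous hφC (pos_iff_ne_zero.2 ht)
  exact tendsto_nhds_unique hlim1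
    (hlim2.congr fun n => (h.lintegral_stopPath_gridFloor hx hB n hφm).symm)

theorem IsBesselNegOne.isRegularPassageBridge (h : IsBesselNegOne R x P) (hx : ε < x)
    (hB : ∀ (s t : ℝ≥0) (hst : s < t), (B t : Measure C(Set.Icc 0 t, ℝ≥0)).map
      (restrictPath hst.le) = bridgeLaw R P x ε s t) : IsRegularPassageBridge R P ε B := by
  have := h.isProbabilityMeasure
  have hem : ∀ t : ℝ≥0, Measurable (extendPath (t := t)) := fun t =>
    (continuous_extendPath t).measurable
  have hTm : Measurable fun ω => (passageTime ε (R ω)).toNNReal :=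
    ((measurable_passageTime ε).comp h.measurable).ennreal_toNNReal
  obtain ⟨κ, hκt⟩ : ∃ κ : Kernel ℝ≥0 C(ℝ≥0, ℝ≥0),
      ∀ t : ℝ≥0, κ t = (B t : Measure C(Set.Icc 0 t, ℝ≥0)).map extendPath :=
    ⟨⟨_, h.measurable_bridge hB⟩, fun _ => rfl⟩
  have hκ : IsMarkovKernel κ := ⟨fun t => by
    rw [hκt]
    exact Measure.isProbabilityMeasure_map (hem t).aemeasurable⟩
  have hdm : Measurable fun t : ℝ≥0 => ENNReal.ofReal (passageDensity t x ε) :=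
    measurable_passageDensityNN ε measurable_id measurable_const
  have hst : Measurable fun ω => stopPath (passageTime ε (R ω)).toNNReal (R ω) :=
    continuous_stopPath.measurable.comp (hTm.prodMk h.measurable)
  have hpair := hTm.prodMk hst
  refine ⟨κ, hκ, fun t _ => hκt t, ⟨hpair.aemeasurable, ?_⟩⟩
  have : IsProbabilityMeasure (P.map fun ω => (passageTime ε (R ω)).toNNReal) :=
    Measure.isProbabilityMeasure_map hTm.aemeasurable
  have : IsProbabilityMeasure (P.map fun ω => ((passageTime ε (R ω)).toNNReal,
    stopPath (passageTime ε (R ω)).toNNReal (R ω))) :=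
    Measure.isProbabilityMeasure_map hpair.aemeasurable
  -- Bounded continuous functions of the pair determine its law, and for these the disintegration is
  -- already known.
  refine ext_of_forall_lintegral_eq_of_IsFiniteMeasure fun φ => ?_
  have hφm : Measurable fun p => (φ p : ℝ≥0∞) := φ.continuous.measurable.coe_nnreal_ennreal
  rw [lintegral_map hφm hpair, Measure.lintegral_compProd hφm,
    (h.hasLaw_passageTime hx).map_eq,
    lintegral_withDensity_eq_lintegral_mul _ hdm hφm.lintegral_kernel_prod_right',
    h.lintegral_stopPath_passageTime hx hB φ]
  refine lintegral_congr fun t => ?_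
  rw [Pi.mul_apply, hκt, lintegral_map (f := fun w => (φ (t, w) : ℝ≥0∞))
    (hφm.comp measurable_prodMk_left) (hem t)]
  rfl

end Regular

end

section

/-! ### Scaling -/

/-- The law of a continuous path on `[0, s]` is determined by its finite-dimensional marginals. -/
theorem measure_path_ext {s : ℝ≥0} {μ ν : Measure C(Set.Icc 0 s, ℝ≥0)} [IsFiniteMeasure μ]
    (h : ∀ (J : Finset (Set.Icc 0 s)) (S : Set.Icc 0 s → Set ℝ≥0), (∀ u, MeasurableSet (S u)) →
      μ {w | ∀ u ∈ J, w u ∈ S u} = ν {w | ∀ u ∈ J, w u ∈ S u}) : μ = ν := by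
  classical
  obtain ⟨D, hDc, hDd⟩ := TopologicalSpace.exists_countable_dense (Set.Icc 0 s)
  have := hDc.to_subtype
  let e : C(Set.Icc 0 s, ℝ≥0) → (D → ℝ≥0) := fun w u => w u
  have hem : Measurable e := measurable_pi_lambda _ fun u => (continuous_eval_const _).measurable
  have hei : Function.Injective e := fun w v hwv => by
    refine ContinuousMap.coe_injective (Continuous.ext_on hDd w.continuous v.continuous ?_)
    exact fun u hu => congrFun hwv ⟨u, hu⟩
  -- An injective Borel map between standard Borel spaces is a measurable embedding, so evaluation
  -- at countably many dense times loses no information about the measures.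
  have hee := hem.measurableEmbedding hei
  suffices hmap : μ.map e = ν.map e by
    rw [← hee.comap_map μ, hmap, hee.comap_map]
  refine ext_of_generate_finite _ generateFrom_squareCylinders.symm
    (isPiSystem_squareCylinders (fun _ => MeasurableSpace.isPiSystem_measurableSet)
      fun _ => by simp) ?_ ?_
  · rintro _ ⟨K, S, hS, rfl⟩
    have hS : ∀ u, MeasurableSet (S u) := fun u => hS u (Set.mem_univ u)
    rw [Measure.map_apply hem (MeasurableSet.pi K.countable_toSet fun u _ => hS u),
      Measure.map_apply hem (MeasurableSet.pi K.countable_toSet fun u _ => hS u)]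
    have key := h (K.image Subtype.val) (fun u => if hu : u ∈ D then S ⟨u, hu⟩ else Set.univ)
      fun u => by
        by_cases hu : u ∈ D
        · simpa only [hu, dite_true] using hS _
        · simp only [hu, dite_false, MeasurableSet.univ]
    have e1 : e ⁻¹' ((K : Set D).pi S) = {w | ∀ u ∈ K.image Subtype.val,
        w u ∈ (fun u => if hu : u ∈ D then S ⟨u, hu⟩ else Set.univ) u} := by
      ext w
      constructor
      · intro hw u hu
        obtain ⟨v, hv, rfl⟩ := Finset.mem_image.1 hu
        simpa only [v.2, dite_true] using hw v hv
      · intro hw v hv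
        simpa only [v.2, dite_true] using hw v (Finset.mem_image_of_mem _ hv)
    rw [e1, key]
  · have key := h ∅ (fun _ => Set.univ) fun _ => MeasurableSet.univ
    simp only [Finset.notMem_empty, false_imp_iff, implies_true] at key
    rw [Measure.map_apply hem MeasurableSet.univ, Measure.map_apply hem MeasurableSet.univ]
    exact key

/-- The path `u ↦ c w(u / c²)` on `[0, s]`. -/
def scalePath (s c : ℝ≥0) (w : C(ℝ≥0, ℝ≥0)) : C(Set.Icc 0 s, ℝ≥0) :=
  ⟨fun u => c * w (u / c ^ 2), by
    have : Continuous fun u : Set.Icc 0 s => (u : ℝ≥0) / c ^ 2 := by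
      simp only [div_eq_mul_inv]; fun_prop
    fun_prop⟩

theorem continuous_scalePath (s c : ℝ≥0) : Continuous (scalePath s c) := by
  refine ContinuousMap.continuous_of_continuous_uncurry _ ?_
  have h1 : Continuous fun p : C(ℝ≥0, ℝ≥0) × Set.Icc 0 s => (p.2 : ℝ≥0) / c ^ 2 := by
    simp only [div_eq_mul_inv]; fun_prop
  have : Continuous fun p : C(ℝ≥0, ℝ≥0) × Set.Icc 0 s => c * p.1 (p.2 / c ^ 2) := by fun_prop
  exact this

/-- The expression c w(u/c²) is jointly continuous in (c, u) for c > 0; currying over the compact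
interval gives uniform convergence. -/
theorem tendsto_scalePath {ι : Type*} {l : Filter ι} (s : ℝ≥0) {c : ι → ℝ≥0} (hc : ∀ i, 0 < c i)
    (hl : Tendsto c l (𝓝 1)) (w : C(ℝ≥0, ℝ≥0)) :
    Tendsto (fun i => scalePath s (c i) w) l (𝓝 (w.restrict (Set.Icc 0 s))) := by
  have h1 : Continuous fun p : Set.Ioi (0 : ℝ≥0) × Set.Icc 0 s => (p.2 : ℝ≥0) / (p.1 : ℝ≥0) ^ 2 :=
    Continuous.div₀ (by fun_prop) (by fun_prop) fun p => (pow_pos p.1.2 2).ne'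
  have h2 : Continuous fun p : Set.Ioi (0 : ℝ≥0) × Set.Icc 0 s =>
      (p.1 : ℝ≥0) * w ((p.2 : ℝ≥0) / (p.1 : ℝ≥0) ^ 2) := by fun_prop
  have h3 : Continuous fun c : Set.Ioi (0 : ℝ≥0) => scalePath s c w :=
    ContinuousMap.continuous_of_continuous_uncurry _ h2
  have h4 : Tendsto (fun i => (⟨c i, hc i⟩ : Set.Ioi (0 : ℝ≥0))) l
      (𝓝 ⟨1, Set.mem_Ioi.2 one_pos⟩) := tendsto_subtype_rng.2 hl
  have h5 := (h3.tendsto _).comp h4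
  have e : scalePath s 1 w = w.restrict (Set.Icc 0 s) := by
    ext u
    simp [scalePath]
  rw [← e]
  exact h5

variable {Ω Ω' : Type*} {R : Ω → C(ℝ≥0, ℝ≥0)} {R' : Ω' → C(ℝ≥0, ℝ≥0)} {x c : ℝ≥0}
  [MeasurableSpace Ω] {P : Measure Ω} [MeasurableSpace Ω'] {P' : Measure Ω'}

theorem IsBesselNegOne.lintegral_start (h : IsBesselNegOne R x P) (b : ℝ≥0) (hb : 0 < b)
    {g : ℝ≥0 → ℝ≥0∞} (hg : Measurable g) :
    ∫⁻ ω, g (R ω b) ∂P = ∫⁻ z, g z ∂(transitionKernel b x) := by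
  have := h.isProbabilityMeasure
  have h1 := h.lintegral_markov (s := 0) hb (G := fun _ => 1) measurable_const hg
  simp only [one_mul, zero_add] at h1
  rw [h1, lintegral_congr_ae (g := fun _ => ∫⁻ z, g z ∂(transitionKernel b x))
    (by filter_upwards [h.start] with ω hω; rw [hω]), lintegral_const, measure_univ, mul_one]

/-- The Markov property, for products of functions of the path at finitely many times. -/
theorem IsBesselNegOne.lintegral_prod_markov (h : IsBesselNegOne R x P) {a t : ℝ≥0} (ht : 0 < t)
    (J : Finset ℝ≥0) (r : ℝ≥0 → ℝ≥0) (hJ : ∀ u ∈ J, r u ≤ a) {f : ℝ≥0 → ℝ≥0 → ℝ≥0∞}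
    (hf : ∀ u, Measurable (f u)) {k g : ℝ≥0 → ℝ≥0∞} (hk : Measurable k) (hg : Measurable g) :
    ∫⁻ ω, (∏ u ∈ J, f u (R ω (r u))) * k (R ω a) * g (R ω (a + t)) ∂P =
      ∫⁻ ω, (∏ u ∈ J, f u (R ω (r u))) * (k (R ω a) *
        ∫⁻ z, g z ∂(transitionKernel t (R ω a))) ∂P := by
  have hev : ∀ u : Set.Icc 0 a, Measurable fun w : C(Set.Icc 0 a, ℝ≥0) => w u := fun u =>
    (continuous_eval_const u).measurable
  have hG : Measurable fun w : C(Set.Icc 0 a, ℝ≥0) =>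
      (∏ u ∈ J, f u (w ⟨min (r u) a, zero_le, min_le_right _ _⟩)) * k (endpoint w) :=
    (Finset.measurable_prod _ fun u _ => (hf u).comp (hev _)).mul (hk.comp measurable_endpoint)
  have h1 := h.lintegral_markov ht hG hg
  have e : ∀ ω, (∏ u ∈ J, f u ((R ω).restrict (Set.Icc 0 a)
      ⟨min (r u) a, zero_le, min_le_right _ _⟩)) = ∏ u ∈ J, f u (R ω (r u)) := fun ω => by
    refine Finset.prod_congr rfl fun u hu => ?_
    have : min (r u) a = r u := min_eq_left (hJ u hu)
    simp [this]
  simp only [e] at h1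
  refine h1.trans (lintegral_congr fun ω => ?_)
  rw [mul_assoc]
  rfl

/-- Induction on the set of times, the latest being added last. The extra factor g at the terminal
time b is what makes the induction run: the Markov property replaces g by its kernel integral, again
a function of one earlier position, and the kernels correspond under scaling. -/
theorem IsBesselNegOne.lintegral_prod_scale (h : IsBesselNegOne R x P)
    (h' : IsBesselNegOne R' (c * x) P') (hc : 0 < c) {f : ℝ≥0 → ℝ≥0 → ℝ≥0∞}
    (hf : ∀ u, Measurable (f u)) (J : Finset ℝ≥0) :
    ∀ (b : ℝ≥0), (∀ u ∈ J, u ≤ b) → ∀ (g : ℝ≥0 → ℝ≥0∞), Measurable g →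
      ∫⁻ ω, (∏ u ∈ J, f u (R' ω u)) * g (R' ω b) ∂P' =
        ∫⁻ ω, (∏ u ∈ J, f u (c * R ω (u / c ^ 2))) * g (c * R ω (b / c ^ 2)) ∂P := by
  have hc2 : 0 < c ^ 2 := pow_pos hc 2
  have hp := h.isProbabilityMeasure
  have hp' := h'.isProbabilityMeasure
  induction J using Finset.induction_on_max with
  | empty =>
    intro b _ g hg
    simp only [Finset.prod_empty, one_mul]
    rcases eq_zero_or_pos b with rfl | hb
    · rw [zero_div, lintegral_congr_ae (g := fun _ => g (c * x))
        (by filter_upwards [h'.start] with ω hω; rw [hω]),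
        lintegral_congr_ae (μ := P) (g := fun _ => g (c * x))
        (by filter_upwards [h.start] with ω hω; rw [hω])]
      simp
    · have hb' : 0 < b / c ^ 2 := div_pos hb hc2
      rw [h'.lintegral_start b hb hg, h.lintegral_start (b / c ^ 2) hb' (g := fun z => g (c * z))
        (by fun_prop), ← lintegral_transitionKernel_scale hc hb' x hg,
        mul_div_cancel₀ _ hc2.ne']
  | insert a J ha ih =>
    intro b hb g hg
    have hab : a ≤ b := hb a (Finset.mem_insert_self _ _)
    have haJ : a ∉ J := fun haJ => lt_irrefl a (ha a haJ)
    have hJa : ∀ u ∈ J, u ≤ a := fun u hu => (ha u hu).le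
    simp only [Finset.prod_insert haJ]
    rcases hab.eq_or_lt with rfl | hab
    · have h1 := ih a hJa (fun y => f a y * g y) ((hf a).mul hg)
      simp only [mul_comm (f a _), mul_assoc] at h1 ⊢
      exact h1
    · obtain ⟨t, ht, rfl⟩ : ∃ t, 0 < t ∧ b = a + t :=
        ⟨b - a, tsub_pos_of_lt hab, (add_tsub_cancel_of_le hab.le).symm⟩
      have ht' : 0 < t / c ^ 2 := div_pos ht hc2
      have hm : Measurable fun y => ∫⁻ z, g z ∂(transitionKernel t y) := hg.lintegral_kernel
      have h1 := ih a hJa (fun y => f a y * ∫⁻ z, g z ∂(transitionKernel t y)) ((hf a).mul hm)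
      have h2 := h'.lintegral_prod_markov ht J id hJa hf (hf a) hg
      have h3 := h.lintegral_prod_markov (a := a / c ^ 2) ht' J (fun u => u / c ^ 2)
        (fun u hu => by gcongr; exact hJa u hu) (f := fun u y => f u (c * y)) (fun u => by fun_prop)
        (k := fun y => f a (c * y)) (g := fun y => g (c * y)) (by fun_prop) (by fun_prop)
      simp only [← lintegral_transitionKernel_scale hc ht' _ hg, mul_div_cancel₀ _ hc2.ne'] at h3
      simp only [id_eq] at h2
      simp only [mul_comm (f a _) (∏ u ∈ J, _), add_div]
      rw [h2, h1, h3]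

/-- Brownian scaling. -/
theorem IsBesselNegOne.map_scalePath (h : IsBesselNegOne R x P)
    (h' : IsBesselNegOne R' (c * x) P') (hc : 0 < c) (s : ℝ≥0) :
    P'.map (fun ω => (R' ω).restrict (Set.Icc 0 s)) = P.map fun ω => scalePath s c (R ω) := by
  classical
  have hp' := h'.isProbabilityMeasure
  have hr' := measurable_restrict h'.measurable s
  have hZ : Measurable fun ω => scalePath s c (R ω) :=
    (continuous_scalePath s c).measurable.comp h.measurable
  have : IsProbabilityMeasure (P'.map fun ω => (R' ω).restrict (Set.Icc 0 s)) :=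
    Measure.isProbabilityMeasure_map hr'.aemeasurable
  refine measure_path_ext fun J S hS => ?_
  have hm : MeasurableSet {w : C(Set.Icc 0 s, ℝ≥0) | ∀ u ∈ J, w u ∈ S u} := by
    have e : {w : C(Set.Icc 0 s, ℝ≥0) | ∀ u ∈ J, w u ∈ S u} =
        ⋂ u ∈ J, (fun w : C(Set.Icc 0 s, ℝ≥0) => w u) ⁻¹' S u := by
      ext w; simp
    rw [e]
    exact Finset.measurableSet_biInter _ fun u _ => (continuous_eval_const u).measurable (hS u)
  -- The indicators, indexed by times in [0, s], are extended by 1 to all times.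
  let f : ℝ≥0 → ℝ≥0 → ℝ≥0∞ := fun u =>
    if hu : u ∈ Set.Icc 0 s then (S ⟨u, hu⟩).indicator 1 else 1
  have hf : ∀ u, Measurable (f u) := fun u => by
    by_cases hu : u ∈ Set.Icc 0 s
    · simpa only [f, hu, dite_true] using measurable_one.indicator (hS _)
    · simpa only [f, hu, dite_false] using measurable_one
  have key := h.lintegral_prod_scale h' hc hf (J.image Subtype.val) s
    (fun u hu => by
      obtain ⟨v, -, rfl⟩ := Finset.mem_image.1 hu
      exact v.2.2) 1 measurable_one
  have e : ∀ v : C(Set.Icc 0 s, ℝ≥0), ∀ V : ℝ≥0 → ℝ≥0, (∀ u : Set.Icc 0 s, v u = V u) →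
      (∏ u ∈ J.image Subtype.val, f u (V u)) * 1 =
        {w : C(Set.Icc 0 s, ℝ≥0) | ∀ u ∈ J, w u ∈ S u}.indicator 1 v := fun v V hV => by
    rw [mul_one, Finset.prod_image Subtype.val_injective.injOn]
    have e1 : ∀ u : Set.Icc 0 s, f u (V u) = (S u).indicator 1 (v u) := fun u => by
      rw [hV u]
      exact congrFun (dif_pos u.2) _
    simp only [e1]
    by_cases hv : v ∈ {w : C(Set.Icc 0 s, ℝ≥0) | ∀ u ∈ J, w u ∈ S u}
    · rw [Set.indicator_of_mem hv, Pi.one_apply]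
      exact Finset.prod_eq_one fun u hu => Set.indicator_of_mem (hv u hu) _
    · rw [Set.indicator_of_notMem hv]
      have hv : ¬ ∀ u ∈ J, v u ∈ S u := hv
      push Not at hv
      obtain ⟨u, hu, hvu⟩ := hv
      exact Finset.prod_eq_zero hu (Set.indicator_of_notMem hvu _)
  rw [← lintegral_indicator_one hm, ← lintegral_indicator_one hm,
    lintegral_map (measurable_one.indicator hm) hr', lintegral_map (measurable_one.indicator hm) hZ]
  refine Eq.trans (lintegral_congr fun ω => ?_) (key.trans (lintegral_congr fun ω => ?_))
  · exact (e _ (R' ω) fun _ => rfl).symm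
  · exact e _ (fun u => c * R ω (u / c ^ 2)) fun _ => rfl

end

section

/-! ### Weak convergence of the bridges -/

/-- Fatou's lemma for indicators: a point of the open set is eventually mapped into it. -/
theorem measure_isOpen_le_liminf {E ι : Type*} [TopologicalSpace E] [MeasurableSpace E]
    [OpensMeasurableSpace E] (μ : Measure E) {l : Filter ι} [l.IsCountablyGenerated]
    {f : ι → E → E} (hf : ∀ i, Measurable (f i)) (hl : ∀ w, Tendsto (fun i => f i w) l (𝓝 w))
    {U : Set E} (hU : IsOpen U) : μ U ≤ liminf (fun i => μ (f i ⁻¹' U)) l := by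
  have hm := fun i => (hf i) hU.measurableSet
  have h := lintegral_liminf_le (μ := μ) (u := l) (f := fun i w => (f i ⁻¹' U).indicator 1 w)
    fun i => measurable_one.indicator (hm i)
  simp only [lintegral_indicator_one (hm _)] at h
  refine le_trans ?_ h
  rw [← lintegral_indicator_one hU.measurableSet]
  refine lintegral_mono fun w => ?_
  by_cases hw : w ∈ U
  · rw [Set.indicator_of_mem hw]
    refine le_liminf_of_le (by isBoundedDefault) ?_
    filter_upwards [(hl w).eventually (hU.mem_nhds hw)] with i hi
    rw [Set.indicator_of_mem (show w ∈ f i ⁻¹' U from hi)]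
  · rw [Set.indicator_of_notMem hw]
    exact zero_le

variable {Ω : Type*} [MeasurableSpace Ω] {R : Ω → C(ℝ≥0, ℝ≥0)} {P : ℝ≥0 → Measure Ω} {x : ℝ≥0}

theorem tendsto_passageDensityNN_level {t : ℝ≥0} (ht : 0 < t) {y : ℝ≥0 → ℝ≥0} {z : ℝ≥0}
    (hy : Tendsto y (𝓝 0) (𝓝 z)) (hyε : ∀ᶠ ε in 𝓝 0, ε ≤ y ε) :
    Tendsto (fun ε => passageDensity t (y ε) ε) (𝓝 0) (𝓝 (passageDensity t z 0)) := by
  have h0 : Tendsto (fun ε : ℝ≥0 => (ε : ℝ)) (𝓝 0) (𝓝 0) := by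
    simpa using (NNReal.continuous_coe.tendsto 0)
  have hyr : Tendsto (fun ε : ℝ≥0 => (y ε : ℝ)) (𝓝 0) (𝓝 z) :=
    (NNReal.continuous_coe.tendsto z).comp hy
  have h := tendsto_passageDensity (l := 𝓝 (0 : ℝ≥0)) (τ := fun _ => (t : ℝ))
    (α := fun ε => (y ε : ℝ) - ε) (η := fun ε => (ε : ℝ)) (t := (t : ℝ)) (a := (z : ℝ)) (ε := 0)
    (NNReal.coe_pos.2 ht) (NNReal.coe_nonneg z) le_rfl tendsto_const_nhds
    (by simpa using hyr.sub h0) h0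
    (hyε.mono fun ε hε => sub_nonneg.2 (NNReal.coe_le_coe.2 hε))
    (Eventually.of_forall fun ε => NNReal.coe_nonneg ε)
  simpa only [sub_add_cancel, add_zero] using h

/-- Scaling by c = (x + ε)/x carries all the laws to the single measure P x, under which the scaled
paths converge pointwise. Fatou's lemma then needs only a pointwise lower bound: where the limiting
integrand is nonzero, the passage densities converge by their continuity at ε = 0. -/
theorem bridgeLaw_le_liminf (hR : ∀ x, IsBesselNegOne R x (P x)) (hx : 0 < x) {s t : ℝ≥0}
    (hst : s < t) {O : Set C(Set.Icc 0 s, ℝ≥0)} (hO : IsOpen O) :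
    bridgeLaw R (P x) x 0 s t O ≤
      liminf (fun ε => bridgeLaw R (P (x + ε)) (x + ε) ε s t O) (𝓝 0) := by
  set c : ℝ≥0 → ℝ≥0 := fun ε => (x + ε) / x with hc
  have hc0 : ∀ ε, 0 < c ε := fun ε => div_pos (add_pos_of_pos_of_nonneg hx zero_le) hx
  have hadd : Tendsto (fun ε : ℝ≥0 => x + ε) (𝓝 0) (𝓝 x) := by
    simpa using (continuous_const_add x).tendsto 0
  have hcl : Tendsto c (𝓝 0) (𝓝 1) := by
    have := hadd.div_const x
    rwa [div_self hx.ne'] at this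
  have hZm : ∀ ε, Measurable fun ω => scalePath s (c ε) (R ω) := fun ε =>
    (continuous_scalePath s (c ε)).measurable.comp (hR x).measurable
  have hDm : ∀ ε, Measurable (O.indicator (bridgeDensity (x + ε) ε s t)) := fun ε =>
    (measurable_bridgeDensity _ _ _ _).indicator hO.measurableSet
  have e : ∀ ε, bridgeLaw R (P (x + ε)) (x + ε) ε s t O =
      ∫⁻ ω, O.indicator (bridgeDensity (x + ε) ε s t) (scalePath s (c ε) (R ω)) ∂(P x) :=
      fun ε => by
    have hcx : c ε * x = x + ε := div_mul_cancel₀ _ hx.ne'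
    have h' : IsBesselNegOne R (c ε * x) (P (x + ε)) := by
      rw [hcx]
      exact hR _
    rw [bridgeLaw, withDensity_apply _ hO.measurableSet, ← lintegral_indicator hO.measurableSet,
      (hR x).map_scalePath h' (hc0 ε) s, lintegral_map (hDm ε) (hZm ε)]
  simp_rw [e]
  refine le_trans ?_ (lintegral_liminf_le fun ε => (hDm ε).comp (hZm ε))
  rw [bridgeLaw, withDensity_apply _ hO.measurableSet, ← lintegral_indicator hO.measurableSet,
    lintegral_map ((measurable_bridgeDensity _ _ _ _).indicator hO.measurableSet)
      (measurable_restrict (hR x).measurable s)]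
  refine lintegral_mono fun ω => ?_
  set w := (R ω).restrict (Set.Icc 0 s) with hw
  have hZ : Tendsto (fun ε => scalePath s (c ε) (R ω)) (𝓝 0) (𝓝 w) :=
    tendsto_scalePath s hc0 hcl (R ω)
  by_cases hwO : w ∈ O
  swap
  · rw [Set.indicator_of_notMem hwO]
    exact zero_le
  by_cases hpos : ∀ u, 0 < w u
  swap
  · rw [Set.indicator_of_mem hwO, bridgeDensity, if_neg hpos]
    exact zero_le
  rw [Set.indicator_of_mem hwO, bridgeDensity, if_pos hpos]
  -- A positive path on a compact interval stays above some η > 0, so nearby paths are above ε once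
  -- ε is small, and the indicator equals 1.
  obtain ⟨η, hη, hηw⟩ : ∃ η : ℝ≥0, 0 < η ∧ ∀ u, η < w u := by
    have : Nonempty (Set.Icc 0 s) := ⟨⟨0, le_rfl, zero_le⟩⟩
    obtain ⟨u, -, hu⟩ := isCompact_univ.exists_isMinOn Set.univ_nonempty w.continuous.continuousOn
    refine ⟨w u / 2, half_pos (hpos u), fun v => ?_⟩
    exact (half_lt_self (hpos u)).trans_le (hu (Set.mem_univ v))
  have hev : ∀ᶠ ε in 𝓝 0, ∀ u, ε < scalePath s (c ε) (R ω) u := by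
    filter_upwards [hZ.eventually ((isOpen_setOf_lt η s).mem_nhds hηw),
      eventually_lt_nhds hη] with ε h1 h2 u
    exact h2.trans (h1 u)
  have hend : Tendsto (fun ε => endpoint (scalePath s (c ε) (R ω))) (𝓝 0) (𝓝 (endpoint w)) :=
    ((continuous_eval_const _).tendsto w).comp hZ
  have h1 := tendsto_passageDensityNN_level (tsub_pos_of_lt hst) hend
    (hev.mono fun ε hε => (hε _).le)
  have h2 := tendsto_passageDensityNN_level (pos_of_gt hst) hadd
    (Eventually.of_forall fun ε => le_add_self)
  have h2pos : 0 < passageDensity t x 0 :=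
    ENNReal.ofReal_pos.1 (passageDensityNN_pos (ε := 0) (pos_of_gt hst) hx)
  have h3 := ENNReal.tendsto_ofReal (h1.div h2 h2pos.ne')
  rw [NNReal.coe_sub hst.le] at h3
  refine le_of_eq (Tendsto.liminf_eq (h3.congr' ?_)).symm
  filter_upwards [hev, hZ.eventually (hO.mem_nhds hwO)] with ε h4 h5
  rw [Set.indicator_of_mem h5, bridgeDensity, if_pos h4]
  rfl

/-- Passage to the limit s' → t in `IsBesselNegOne.bridgeLaw_dist`: the event is open and freezing
at s' converges to the identity. -/
theorem IsBesselNegOne.bridge_dist {ε : ℝ≥0} {Q : Measure Ω} (h : IsBesselNegOne R x Q)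
    (hx : ε < x) {s t : ℝ≥0} (hst : s < t) {B : Measure C(Set.Icc 0 t, ℝ≥0)}
    (hB : ∀ (s : ℝ≥0) (hst : s < t), B.map (restrictPath hst.le) = bridgeLaw R Q x ε s t)
    {δ : ℝ≥0} (hδ : 0 < δ) :
    B {w | (δ : ℝ) < dist (cutPath s w) w} ≤
      ENNReal.ofReal (56 * √((t : ℝ) - s) / δ ^ 3) / passageDensityNN ε t x := by
  have hcc : ∀ s, Continuous fun w : C(Set.Icc 0 t, ℝ≥0) => cutPath s w := fun s =>
    continuous_cutPath.comp (continuous_const.prodMk continuous_id)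
  have hU : IsOpen {w : C(Set.Icc 0 t, ℝ≥0) | (δ : ℝ) < dist (cutPath s w) w} :=
    isOpen_lt continuous_const ((hcc s).dist continuous_id)
  have hne : (𝓝[<] t).NeBot := nhdsLT_neBot_of_exists_lt ⟨s, hst⟩
  refine (measure_isOpen_le_liminf B (l := 𝓝[<] t) (f := fun s' => cutPath s')
    (fun s' => (hcc s').measurable) (fun w => ?_) hU).trans ?_
  · have h1 : Tendsto (fun s' => cutPath s' w) (𝓝[<] t) (𝓝 (cutPath t w)) :=
      (continuous_cutPath.tendsto (t, w)).comp
        ((tendsto_nhdsWithin_of_tendsto_nhds tendsto_id).prodMk_nhds tendsto_const_nhds)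
    rwa [cutPath_self] at h1
  · refine liminf_le_of_frequently_le' (Eventually.frequently ?_)
    filter_upwards [Ioo_mem_nhdsLT hst] with s' hs'
    obtain ⟨hs1, hs2⟩ : s < s' ∧ s' < t := hs'
    have hle := h.bridgeLaw_dist hx hs1.le hs2 hδ
    have hm := (hU.preimage (continuous_prolongPath s' t)).measurableSet
    have e := Measure.map_apply (μ := B) (continuous_restrictPath hs2.le).measurable hm
    rw [hB s' hs2] at e
    exact e.symm.le.trans hle

/-- Portmanteau with open sets G. Cutting at s < t reduces to `bridgeLaw_le_liminf`, and the cost of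
cutting is bounded by `IsBesselNegOne.bridge_dist` uniformly for small ε. Letting s increase to t
and then shrinking the margin δ around the complement of G removes both approximations. -/
theorem tendsto_bridge (hR : ∀ x, IsBesselNegOne R x (P x)) (hx : 0 < x) {t : ℝ≥0} (ht : 0 < t)
    {B : ℝ≥0 → ProbabilityMeasure C(Set.Icc 0 t, ℝ≥0)}
    {B₀ : ProbabilityMeasure C(Set.Icc 0 t, ℝ≥0)}
    (hB : ∀ (ε s : ℝ≥0) (hst : s < t), (B ε : Measure C(Set.Icc 0 t, ℝ≥0)).map
      (restrictPath hst.le) = bridgeLaw R (P (x + ε)) (x + ε) ε s t)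
    (hB₀ : ∀ (s : ℝ≥0) (hst : s < t), (B₀ : Measure C(Set.Icc 0 t, ℝ≥0)).map
      (restrictPath hst.le) = bridgeLaw R (P x) x 0 s t) :
    Tendsto B (𝓝 0) (𝓝 B₀) := by
  refine tendsto_of_forall_isOpen_le_liminf' fun G hG => ?_
  have hcc : ∀ s, Continuous fun w : C(Set.Icc 0 t, ℝ≥0) => cutPath s w := fun s =>
    continuous_cutPath.comp (continuous_const.prodMk continuous_id)
  have hne : (𝓝[<] t).NeBot := nhdsLT_neBot_of_exists_lt ⟨0, ht⟩
  set L := liminf (fun ε => (B ε : Measure C(Set.Icc 0 t, ℝ≥0)) G) (𝓝 0)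
  have hp0 : 0 < passageDensityNN 0 t x := passageDensityNN_pos ht hx
  -- the part of `G` at distance more than `δ` of its complement
  let V : ℝ≥0 → Set C(Set.Icc 0 t, ℝ≥0) := fun δ => {w | (δ : ℝ≥0∞) < Metric.infEDist w Gᶜ}
  have hVo : ∀ δ, IsOpen (V δ) := fun δ =>
    isOpen_lt continuous_const Metric.continuous_infEDist
  -- The denominator r_t(x + ε, ε) is eventually at least half its limit. A path whose cut is in V δ
  -- lies in G unless cutting moves it by more than δ.
  have hcut : ∀ δ : ℝ≥0, 0 < δ → ∀ s : ℝ≥0, s < t →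
      (B₀ : Measure C(Set.Icc 0 t, ℝ≥0)) (cutPath s ⁻¹' V δ) ≤
        L + ENNReal.ofReal (56 * √((t : ℝ) - s) / δ ^ 3) / (passageDensityNN 0 t x / 2) := by
    intro δ hδ s hst
    have hO : IsOpen (prolongPath (s := s) t ⁻¹' V δ) := (hVo δ).preimage (continuous_prolongPath s t)
    have hrm := (continuous_restrictPath hst.le).measurable
    have h1 := bridgeLaw_le_liminf hR hx hst hO
    rw [← hB₀ s hst, Measure.map_apply hrm hO.measurableSet] at h1
    refine h1.trans ?_
    rw [← liminf_add_const (𝓝 (0 : ℝ≥0)) _ _ (by isBoundedDefault) (by isBoundedDefault)]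
    refine liminf_le_liminf ?_ (by isBoundedDefault) (by isBoundedDefault)
    have hadd : Tendsto (fun ε : ℝ≥0 => x + ε) (𝓝 0) (𝓝 x) := by
      simpa using (continuous_const_add x).tendsto 0
    have hpd : Tendsto (fun ε => passageDensityNN ε t (x + ε)) (𝓝 0)
        (𝓝 (passageDensityNN 0 t x)) := ENNReal.tendsto_ofReal (by
      simpa using tendsto_passageDensityNN_level ht hadd
        (Eventually.of_forall fun ε => le_add_self))
    filter_upwards [hpd.eventually (eventually_gt_nhds
      (ENNReal.half_lt_self hp0.ne' passageDensityNN_ne_top))] with ε hε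
    have hxε : ε < x + ε := lt_add_of_pos_left ε hx
    rw [← hB ε s hst, Measure.map_apply hrm hO.measurableSet]
    have h2 := (hR (x + ε)).bridge_dist hxε hst (hB ε) hδ
    refine le_trans (measure_mono fun w hw => ?_) ((measure_union_le G
      {w | (δ : ℝ) < dist (cutPath s w) w}).trans (add_le_add le_rfl (h2.trans ?_)))
    · have hw : (δ : ℝ≥0∞) < Metric.infEDist (cutPath s w) Gᶜ := hw
      by_contra hcon
      rw [Set.mem_union, not_or] at hcon
      have h3 : dist (cutPath s w) w ≤ δ := not_lt.1 hcon.2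
      have h4 := Metric.infEDist_le_edist_of_mem (x := cutPath s w) (s := Gᶜ) (y := w) hcon.1
      rw [edist_dist] at h4
      have h5 := hw.trans_le (h4.trans (ENNReal.ofReal_le_ofReal h3))
      rw [ENNReal.ofReal_coe_nnreal] at h5
      exact lt_irrefl _ h5
    · exact ENNReal.div_le_div_left hε.le _
  have hV : ∀ δ : ℝ≥0, 0 < δ → (B₀ : Measure C(Set.Icc 0 t, ℝ≥0)) (V δ) ≤ L := by
    intro δ hδ
    refine (measure_isOpen_le_liminf (B₀ : Measure C(Set.Icc 0 t, ℝ≥0)) (l := 𝓝[<] t)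
      (f := fun s => cutPath s) (fun s => (hcc s).measurable) (fun w => ?_) (hVo δ)).trans ?_
    · have h1 : Tendsto (fun s' => cutPath s' w) (𝓝[<] t) (𝓝 (cutPath t w)) :=
        (continuous_cutPath.tendsto (t, w)).comp
          ((tendsto_nhdsWithin_of_tendsto_nhds tendsto_id).prodMk_nhds tendsto_const_nhds)
      rwa [cutPath_self] at h1
    · have hlim : Tendsto (fun s : ℝ≥0 => L + ENNReal.ofReal (56 * √((t : ℝ) - s) / δ ^ 3) /
          (passageDensityNN 0 t x / 2)) (𝓝[<] t) (𝓝 (L + ENNReal.ofReal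
            (56 * √((t : ℝ) - t) / δ ^ 3) / (passageDensityNN 0 t x / 2))) := by
        refine Tendsto.const_add L (ENNReal.Tendsto.div_const (ENNReal.tendsto_ofReal ?_)
          (Or.inr (ENNReal.half_pos hp0.ne').ne'))
        refine Tendsto.mono_left (Continuous.tendsto ?_ t) nhdsWithin_le_nhds
        fun_prop
      rw [sub_self, Real.sqrt_zero, mul_zero, zero_div, ENNReal.ofReal_zero, ENNReal.zero_div,
        add_zero] at hlim
      rw [← hlim.liminf_eq]
      refine liminf_le_liminf ?_ (by isBoundedDefault) (by isBoundedDefault)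
      filter_upwards [self_mem_nhdsWithin] with s hs
      exact hcut δ hδ s hs
  have hGV : G = ⋃ n : ℕ, V (1 / (n + 1)) := by
    ext w
    rw [Set.mem_iUnion]
    constructor
    · intro hw
      have h1 : Metric.infEDist w Gᶜ ≠ 0 := fun h0 => by
        rw [← Metric.mem_closure_iff_infEDist_zero, hG.isClosed_compl.closure_eq] at h0
        exact h0 hw
      have h2 : Tendsto (fun n : ℕ => ((1 / (n + 1) : ℝ≥0) : ℝ≥0∞)) atTop (𝓝 ((0 : ℝ≥0) : ℝ≥0∞)) :=
        ENNReal.tendsto_coe.2 tendsto_one_div_add_atTop_nhds_zero_nat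
      exact (h2.eventually (eventually_lt_nhds (pos_iff_ne_zero.2 h1))).exists
    · rintro ⟨n, hn⟩
      by_contra hw
      have hn : ((1 / (n + 1) : ℝ≥0) : ℝ≥0∞) < Metric.infEDist w Gᶜ := hn
      rw [Metric.infEDist_zero_of_mem (show w ∈ Gᶜ from hw)] at hn
      exact not_lt_zero hn
  have hmono : Monotone fun n : ℕ => V (1 / (n + 1)) := fun n m hnm w hw => by
    refine lt_of_le_of_lt (ENNReal.coe_le_coe.2 ?_) (show _ < _ from hw)
    gcongr
  rw [hGV, hmono.measure_iUnion]
  exact iSup_le fun n => hV _ (by positivity)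

end

end BesselBridge

end

/-! ### Assembly of the theorem -/

theorem mainTheorem7 {Ω : Type*} [MeasurableSpace Ω] (R : Ω → C(ℝ≥0, ℝ≥0))
    (P : ℝ≥0 → Measure Ω) (hR : ∀ x, BesselBridge.IsBesselNegOne R x (P x)) :
    ∃ B : ℝ≥0 → ℝ≥0 → (t : ℝ≥0) → ProbabilityMeasure C(Set.Icc 0 t, ℝ≥0),
      (∀ x ε : ℝ≥0, ε < x →
        -- the first-passage time at `ε` is finite and `r_t(x, ε)` is the density of its law
        ((∀ᵐ ω ∂(P x), BesselBridge.passageTime ε (R ω) < ∞) ∧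
          HasLaw (fun ω => (BesselBridge.passageTime ε (R ω)).toNNReal)
            (BesselBridge.lebNN.withDensity
              fun t => ENNReal.ofReal (BesselBridge.passageDensity t x ε)) (P x)) ∧
        -- (i)
        BesselBridge.IsRegularPassageBridge R (P x) ε (B x ε) ∧
        -- (ii)
        (∀ (s t : ℝ≥0) (hst : s < t),
          (B x ε t : Measure C(Set.Icc 0 t, ℝ≥0)).map (BesselBridge.restrictPath hst.le) =
            ((P x).map fun ω => (R ω).restrict (Set.Icc 0 s)).withDensity
              (BesselBridge.bridgeDensity x ε s t))) ∧
      -- weak convergence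
      (∀ x t : ℝ≥0, 0 < x → 0 < t →
        Tendsto (fun ε : ℝ≥0 => B (x + ε) ε t) (𝓝[>] 0) (𝓝 (B x 0 t))) := by
  classical
  have hex : ∀ x ε t : ℝ≥0, ∃ B : ProbabilityMeasure C(Set.Icc 0 t, ℝ≥0), ε < x →
      ∀ (s : ℝ≥0) (hst : s < t), (B : Measure C(Set.Icc 0 t, ℝ≥0)).map
        (BesselBridge.restrictPath hst.le) = BesselBridge.bridgeLaw R (P x) x ε s t := by
    intro x ε t
    by_cases h : ε < x ∧ 0 < t
    · obtain ⟨B, hB⟩ := (hR x).exists_bridge h.1 h.2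
      exact ⟨B, fun _ => hB⟩
    -- When t = 0 or x ≤ ε no bridge is required, and the point mass at the zero path is a default
    -- value.
    · exact ⟨⟨Measure.dirac (ContinuousMap.const _ 0), inferInstance⟩, fun hx s hst =>
        absurd ⟨hx, pos_of_gt hst⟩ h⟩
  choose B hB using hex
  refine ⟨B, fun x ε hx => ⟨⟨?_, (hR x).hasLaw_passageTime hx⟩, ?_, fun s t hst => hB x ε t hx s hst⟩,
    fun x t hx ht => ?_⟩
  · filter_upwards [(hR x).passageTime_ne_top hx] with ω hω
    exact lt_top_iff_ne_top.2 hω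
  · exact (hR x).isRegularPassageBridge hx fun s t hst => hB x ε t hx s hst
  · exact (BesselBridge.tendsto_bridge hR hx ht
      (fun ε s hst => hB (x + ε) ε t (lt_add_of_pos_left ε hx) s hst)
      (fun s hst => hB x 0 t hx s hst)).mono_left nhdsWithin_le_nhds
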